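/- **Theorem 1.6.** For $n\ge 1$ let $K_n$ be the transition matrix of an irreducible birth and death chain $(X^{(n)}_m)_{m\ge 0}$ on $\mathcal X_n=\{0,1,\dots,n\}$ (that is, $K_n$ is an irreducible stochastic matrix with $K_n(i,j)=0$ whenever $|i-j|>1$), with stationary distribution $\pi_n$, and let $\lambda_n$ be the smallest non-zero eigenvalue of $I-K_n$. Let $N_t$ be a Poisson process of parameter $1$ independent of $(X^{(n)}_m)$, and set $$\tau^{(n)}_i=\inf\{m\ge 0: X^{(n)}_m=i\},\qquad \widetilde\tau^{(n)}_i=\inf\{t\ge 0: X^{(n)}_{N_t}=i\};$$ $\mathbb E_j$ and $\mathrm{Var}_j$ denote expectation and variance given $X^{(n)}_0=j$. Let $M_n\in\mathcal X_n$ satisfy $$\inf_{n\ge1}\pi_n([0,M_n])>0,\qquad \inf_{n\ge1}\pi_n([M_n,n])>0 .$$ The hitting times of $M_n$ from $0$ and from $n$ are almost surely finite with finite second moment, and one may set $$\theta_n=\max\{\mathbb E_0\tau^{(n)}_{M_n},\mathbb E_n\tau^{(n)}_{M_n}\}=\max\{\mathbb E_0\widetilde\tau^{(n)}_{M_n},\mathbb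 E_n\widetilde\tau^{(n)}_{M_n}\},$$ $$\alpha_n^2=\max\{\mathrm{Var}_0\widetilde\tau^{(n)}_{M_n},\mathrm{Var}_n\widetilde\tau^{(n)}_{M_n}\},\qquad \beta_n^2=\max\{\mathrm{Var}_0\tau^{(n)}_{M_n},\mathrm{Var}_n\tau^{(n)}_{M_n}\},\qquad \alpha_n,\beta_n\ge0.$$ For probabilities $\mu,\nu$ on $\mathcal X_n$ let $\|\mu-\nu\|_{TV}=\max_{A\subset\mathcal X_n}(\mu(A)-\nu(A))$. For $\epsilon\in(0,1)$ let $T_n(\epsilon)=\min\{m\in\mathbb Z_{\ge0}:\max_x\|K_n^m(x,\cdot)-\pi_n\|_{TV}\le\epsilon\}$ and $T^{(c)}_n(\epsilon)=\min\{t\ge 0:\max_x\|e^{-t(I-K_n)}(x,\cdot)-\pi_n\|_{TV}\le\epsilon\}$ be the maximum total variation mixing times in discrete and continuous time. A family with mixing times $S_n(\epsilon)$ has a *cutoff* if there are $t_n>0$ (integers in discrete time, reals in continuous time) with $S_n(\epsilon)/t_n\to1$ for every $\epsilon\in(0,1)$; it has a *$(t_n,b_n)$ cutoff* if $t_n>0$,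 $b_n>0$, $b_n/t_n\to0$ and $\limsup_n|S_n(\epsilon)-t_n|/b_n<\infty$ for every $\epsilon\in(0,1)$. Let $\mathcal F$ be the family of the discrete time chains (mixing times $T_n$) and $\mathcal F_c$ the family of the associated continuous time chains (mixing times $T_n^{(c)}$). 1. $\mathcal F_c$ has a cutoff if and only if $\theta_n\lambda_n\to\infty$, if and only if $\theta_n/\alpha_n\to\infty$. Furthermore, if $\mathcal F_c$ has a cutoff, then it has a $(\theta_n,\alpha_n)$ cutoff. 2. Assume $\inf_{i,n}K_n(i,i)>0$. Then $\mathcal F$ has a cutoff if and only if $\theta_n\lambda_n\to\infty$, if and only if $\theta_n/\beta_n\to\infty$. Furthermore, if $\mathcal F$ has a cutoff, then it has a $(\theta_n,\beta_n)$ cutoff. -/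

import Mathlib

open MeasureTheory ProbabilityTheory Filter Topology

noncomputable section

namespace BDCutoff

/-! ### Birth and death chains on `{0, 1, ..., n}` -/

/-- An irreducible birth and death chain on `{0, 1, ..., n}`, given by its transition matrix:
a stochastic matrix whose only possibly nonzero entries are `K(i, i+1)` (birth rates),
`K(i, i-1)` (death rates) and `K(i, i)` (holding rates), and which is irreducible. -/
structure BirthDeathChain (n : ℕ) where
  /-- the transition matrix -/
  K : Matrix (Fin (n + 1)) (Fin (n + 1)) ℝ
  nonneg : ∀ i j, 0 ≤ K i j
  row_sum : ∀ i, ∑ j, K i j = 1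
  nearest : ∀ i j : Fin (n + 1), (i : ℕ) + 1 < j ∨ (j : ℕ) + 1 < i → K i j = 0
  irreducible : K.IsIrreducible

variable {n : ℕ}

/-- `π` is a stationary distribution of the transition matrix `K`. -/
structure IsStationary (K : Matrix (Fin (n + 1)) (Fin (n + 1)) ℝ) (π : Fin (n + 1) → ℝ) :
    Prop where
  nonneg : ∀ i, 0 ≤ π i
  sum_one : ∑ i, π i = 1
  stationary : Matrix.vecMul π K = π

/-- The smallest nonzero eigenvalue of `I - K`. -/
def spectralGap (K : Matrix (Fin (n + 1)) (Fin (n + 1)) ℝ) : ℝ :=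
  sInf {μ : ℝ | μ ≠ 0 ∧ Module.End.HasEigenvalue (Matrix.toLin' (1 - K)) μ}

/-! ### Total variation distance to stationarity and mixing times -/

/-- Total variation distance `max_A (μ(A) - ν(A))`, probabilities being given by their weights. -/
def tvDist (μ ν : Fin (n + 1) → ℝ) : ℝ :=
  ⨆ A : Finset (Fin (n + 1)), (∑ x ∈ A, μ x - ∑ x ∈ A, ν x)

/-- The transition function `H_t = exp(-t (I - K))` of the associated continuous time chain. -/
def heat (K : Matrix (Fin (n + 1)) (Fin (n + 1)) ℝ) (t : ℝ) :
    Matrix (Fin (n + 1)) (Fin (n + 1)) ℝ :=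
  NormedSpace.exp (-t • (1 - K))

/-- Maximum (over the initial state) total variation distance at the discrete time `m`. -/
def maxTV (K : Matrix (Fin (n + 1)) (Fin (n + 1)) ℝ) (π : Fin (n + 1) → ℝ) (m : ℕ) : ℝ :=
  ⨆ x : Fin (n + 1), tvDist ((K ^ m) x) π

/-- Maximum (over the initial state) total variation distance at the continuous time `t`. -/
def maxTVc (K : Matrix (Fin (n + 1)) (Fin (n + 1)) ℝ) (π : Fin (n + 1) → ℝ) (t : ℝ) : ℝ :=
  ⨆ x : Fin (n + 1), tvDist (heat K t x) π

/-- Discrete time mixing time in maximum total variation. -/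
def mixTime (K : Matrix (Fin (n + 1)) (Fin (n + 1)) ℝ) (π : Fin (n + 1) → ℝ) (ε : ℝ) : ℕ :=
  sInf {m : ℕ | maxTV K π m ≤ ε}

/-- Continuous time mixing time in maximum total variation. -/
def mixTimec (K : Matrix (Fin (n + 1)) (Fin (n + 1)) ℝ) (π : Fin (n + 1) → ℝ) (ε : ℝ) : ℝ :=
  sInf {t : ℝ | 0 ≤ t ∧ maxTVc K π t ≤ ε}

/-! ### Cutoffs

Families are indexed by `n ≥ 1`; `T n ε` is the mixing time of the `n`-th chain. -/

/-- Cutoff of a family of discrete time chains (the cutoff times are positive integers). -/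
def HasCutoff (T : ℕ → ℝ → ℕ) : Prop :=
  ∃ t : ℕ → ℕ, (∀ n, 1 ≤ n → 0 < t n) ∧
    ∀ ε ∈ Set.Ioo (0 : ℝ) 1, Tendsto (fun n => (T n ε : ℝ) / (t n : ℝ)) atTop (𝓝 1)

/-- Cutoff of a family of continuous time chains (the cutoff times are positive reals). -/
def HasCutoffc (T : ℕ → ℝ → ℝ) : Prop :=
  ∃ t : ℕ → ℝ, (∀ n, 1 ≤ n → 0 < t n) ∧
    ∀ ε ∈ Set.Ioo (0 : ℝ) 1, Tendsto (fun n => T n ε / t n) atTop (𝓝 1)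

/-- The quantitative condition in a `(t_n, b_n)` cutoff: `t_n > 0`, `b_n > 0`, `b_n / t_n → 0`, and
`limsup |T_n(ε) - t_n| / b_n < ∞` for every `ε ∈ (0, 1)`. -/
def HasWindow (T : ℕ → ℝ → ℝ) (t b : ℕ → ℝ) : Prop :=
  (∀ n, 1 ≤ n → 0 < t n ∧ 0 < b n) ∧
    Tendsto (fun n => b n / t n) atTop (𝓝 0) ∧
    ∀ ε ∈ Set.Ioo (0 : ℝ) 1, ∃ C : ℝ, ∀ᶠ n in atTop, |T n ε - t n| / b n ≤ C

/-! ### The Markov chain, the Poisson process and the hitting times -/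

/-- The one-step transition kernel of the chain. -/
def stepKernel (C : BirthDeathChain n) : Kernel (Fin (n + 1)) (Fin (n + 1)) :=
  Kernel.ofFunOfCountable fun x => ∑ y, ENNReal.ofReal (C.K x y) • Measure.dirac y

instance (C : BirthDeathChain n) : IsMarkovKernel (stepKernel C) := by
  refine ⟨fun x => ⟨?_⟩⟩
  change (∑ y, ENNReal.ofReal (C.K x y) • Measure.dirac y) Set.univ = 1
  simp only [Measure.coe_finsetSum, Finset.sum_apply, Measure.smul_apply, measure_univ,
    smul_eq_mul, mul_one]
  rw [← ENNReal.ofReal_sum_of_nonneg fun y _ => C.nonneg x y, C.row_sum, ENNReal.ofReal_one]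

/-- The kernel giving the state at time `m + 1` from the trajectory up to time `m`: it depends on
the state at time `m` only. -/
def historyKernel (C : BirthDeathChain n) (m : ℕ) :
    Kernel ((i : Finset.Iic m) → (fun _ : ℕ => Fin (n + 1)) i) (Fin (n + 1)) :=
  (stepKernel C).comap (fun h => h ⟨m, Finset.mem_Iic.2 le_rfl⟩) (measurable_pi_apply _)

instance (C : BirthDeathChain n) (m : ℕ) : IsMarkovKernel (historyKernel C m) := by
  unfold historyKernel; infer_instance

/-- The law, on the space of trajectories `ℕ → {0, ..., n}`, of the discrete time Markov chain
`(X_m)` with transition matrix `K` and initial state `x`. -/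
def chainLaw (C : BirthDeathChain n) (x : Fin (n + 1)) : Measure (ℕ → Fin (n + 1)) :=
  Kernel.traj (X := fun _ => Fin (n + 1)) (historyKernel C) 0 (fun _ => x)

/-- The law of a sequence of independent exponential variables of parameter `1`
(the interarrival times of the Poisson process). -/
def clockLaw : Measure (ℕ → ℝ) := Measure.infinitePi fun _ => expMeasure 1

/-- The Poisson process of parameter `1` with interarrival times `ξ`: `N_t` is the number of
arrival times `ξ_0 + ... + ξ_k` in `[0, t]`. -/
def poissonProcess (ξ : ℕ → ℝ) (t : ℝ) : ℕ :=
  Set.ncard {k : ℕ | ∑ l ∈ Finset.range (k + 1), ξ l ≤ t}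

/-- The joint law of the chain started at `x` and of an independent Poisson clock. -/
def jointLaw (C : BirthDeathChain n) (x : Fin (n + 1)) :
    Measure ((ℕ → Fin (n + 1)) × (ℕ → ℝ)) :=
  (chainLaw C x).prod clockLaw

/-- The hitting time `τ_i = inf {m ≥ 0 | X_m = i}`. -/
def hit (i : Fin (n + 1)) (X : ℕ → Fin (n + 1)) : ℝ :=
  ((sInf {m : ℕ | X m = i} : ℕ) : ℝ)

/-- The hitting time `τ̃_i = inf {t ≥ 0 | X_{N_t} = i}`. -/
def hitc (i : Fin (n + 1)) (ω : (ℕ → Fin (n + 1)) × (ℕ → ℝ)) : ℝ :=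
  sInf {t : ℝ | 0 ≤ t ∧ ω.1 (poissonProcess ω.2 t) = i}

/-- `max {E_0 τ_i, E_n τ_i}`. -/
def theta (C : BirthDeathChain n) (i : Fin (n + 1)) : ℝ :=
  max (∫ X, hit i X ∂(chainLaw C 0)) (∫ X, hit i X ∂(chainLaw C (Fin.last n)))

/-- `max {E_0 τ̃_i, E_n τ̃_i}`. -/
def thetac (C : BirthDeathChain n) (i : Fin (n + 1)) : ℝ :=
  max (∫ ω, hitc i ω ∂(jointLaw C 0)) (∫ ω, hitc i ω ∂(jointLaw C (Fin.last n)))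

/-- `α`, where `α ^ 2 = max {Var_0 τ̃_i, Var_n τ̃_i}`. -/
def alpha (C : BirthDeathChain n) (i : Fin (n + 1)) : ℝ :=
  √(max (variance (hitc i) (jointLaw C 0)) (variance (hitc i) (jointLaw C (Fin.last n))))

/-- `β`, where `β ^ 2 = max {Var_0 τ_i, Var_n τ_i}`. -/
def beta (C : BirthDeathChain n) (i : Fin (n + 1)) : ℝ :=
  √(max (variance (hit i) (chainLaw C 0)) (variance (hit i) (chainLaw C (Fin.last n))))

/-- The hitting times of `i` by both chains started at `x` are almost surely finite, and are
square integrable (so that their means and variances are meaningful). -/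
def HitRegular (C : BirthDeathChain n) (x i : Fin (n + 1)) : Prop :=
  (∀ᵐ X ∂(chainLaw C x), ∃ m, X m = i) ∧
  (∀ᵐ ω ∂(jointLaw C x), ∃ t, 0 ≤ t ∧ ω.1 (poissonProcess ω.2 t) = i) ∧
  MemLp (hit i) 2 (chainLaw C x) ∧
  MemLp (hitc i) 2 (jointLaw C x)

end BDCutoff

end

/-!
Let `α ^ 2` be the larger of the variances of the continuous time hitting times of the central
state `M` from the two ends. The first passage decomposition and Hardy's inequality express mean,
variance and Poincaré constant through the rates, and give two comparisons with the spectral gap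
`lam`: `1 ≤ lam * α`, and `lam * α ^ 2` is at most a constant multiple of `θ`.

The mixing time then differs from `θ` by `O(α)`. Until time `θ - O(α)` the chain started at the
worse end has, by Chebyshev's inequality, not yet reached a set of almost full stationary measure.
Conversely, the `L²` maximal inequality for lazy reversible chains shows that, for a bounded
centred `g` and from a time of order `1 / lam ≤ α` on, `K ^ k g` stays small for all `k` at once
at a single state `z` near `M`. By time `θ + O(α)` the chain has very likely passed through `z`,
so that the strong Markov property at this passage makes `K ^ m g` small everywhere. The
continuous time chain is the half-lazy chain observed at the jumps of a Poisson clock of rate `2`,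
and the fluctuations of that clock are absorbed in `O(α)`.

If `θ * lam → ∞`, then `lam * α ^ 2 = O(θ)` gives `α / θ → 0`, hence a cutoff with window `α`; and
`θ / α → ∞` gives back `θ * lam → ∞` since `1 ≤ lam * α`. Conversely, an eigenfunction of the
spectral gap bounds `lam` times the mixing time at level `ε` from below by a multiple of
`log (1 / (2 * ε))`, which is incompatible with a cutoff if `θ * lam` stays bounded. In discrete
time, holding probabilities at least `δ` make `β` and `α` comparable.
-/

noncomputable section

namespace BDCutoff

open RCLike

/-! ### Reversible chains on a finite set -/

section Reversible

variable {ι : Type*} [Fintype ι]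

/-- `K` is a stochastic matrix, reversible with respect to the probability weights `π`. -/
structure IsReversible (K : Matrix ι ι ℝ) (π : ι → ℝ) : Prop where
  nonneg : ∀ x y, 0 ≤ K x y
  row_sum : ∀ x, ∑ y, K x y = 1
  weight_nonneg : ∀ x, 0 ≤ π x
  weight_sum : ∑ x, π x = 1
  balance : ∀ x y, π x * K x y = π y * K y x

/-- The Dirichlet form `⟨(I - K) f, f⟩` of `K` in `L²(π)`. -/
def dirichlet (K : Matrix ι ι ℝ) (π f : ι → ℝ) : ℝ := ⟪f - K.mulVec f, f⟫_[ℝ, π]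

/-- The Poincaré inequality with constant `lam` (the variance being written for centred `f`). -/
def Poincare (K : Matrix ι ι ℝ) (π : ι → ℝ) (lam : ℝ) : Prop :=
  ∀ f : ι → ℝ, ∑ x, π x * f x = 0 → lam * ⟪f, f⟫_[ℝ, π] ≤ dirichlet K π f

variable {K : Matrix ι ι ℝ} {π : ι → ℝ}

lemma wInner_eq_sum (π f g : ι → ℝ) : ⟪f, g⟫_[ℝ, π] = ∑ x, π x * (f x * g x) := by
  simp only [wInner, RCLike.inner_apply, conj_trivial, smul_eq_mul, mul_comm]

lemma wInner_self_eq_sum_sq (π f : ι → ℝ) : ⟪f, f⟫_[ℝ, π] = ∑ x, π x * f x ^ 2 := by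
  simp only [wInner_eq_sum, sq]

lemma wInner_self_nonneg (hπ : ∀ x, 0 ≤ π x) (f : ι → ℝ) : 0 ≤ ⟪f, f⟫_[ℝ, π] := by
  rw [wInner_self_eq_sum_sq]
  exact Finset.sum_nonneg fun x _ => mul_nonneg (hπ x) (sq_nonneg _)

lemma wInner_mulVec_self (K : Matrix ι ι ℝ) (π f : ι → ℝ) :
    ⟪K.mulVec f, f⟫_[ℝ, π] = ∑ x, ∑ y, π x * K x y * (f x * f y) := by
  simp only [wInner_eq_sum, Matrix.mulVec, dotProduct, Finset.mul_sum, Finset.sum_mul]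
  exact Finset.sum_congr rfl fun _ _ => Finset.sum_congr rfl fun _ _ => by ring

namespace IsReversible

variable (h : IsReversible K π)
include h

lemma sum_weight_mul (y : ι) : ∑ x, π x * K x y = π y := by
  simp_rw [h.balance _ y, ← Finset.mul_sum, h.row_sum, mul_one]

lemma sum_mulVec (f : ι → ℝ) : ∑ x, π x * K.mulVec f x = ∑ x, π x * f x := by
  simp_rw [Matrix.mulVec, dotProduct, Finset.mul_sum, ← mul_assoc]
  rw [Finset.sum_comm]
  simp_rw [← Finset.sum_mul, h.sum_weight_mul]

lemma wInner_mulVec_left (f g : ι → ℝ) :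
    ⟪K.mulVec f, g⟫_[ℝ, π] = ⟪f, K.mulVec g⟫_[ℝ, π] := by
  simp only [wInner_eq_sum, Matrix.mulVec, dotProduct, Finset.mul_sum, Finset.sum_mul]
  rw [Finset.sum_comm]
  refine Finset.sum_congr rfl fun y _ => Finset.sum_congr rfl fun x _ => ?_
  linear_combination (f y * g x) * h.balance x y

lemma wInner_self_eq_left (f : ι → ℝ) :
    ⟪f, f⟫_[ℝ, π] = ∑ x, ∑ y, π x * K x y * f x ^ 2 := by
  simp_rw [wInner_self_eq_sum_sq, ← Finset.sum_mul, ← Finset.mul_sum, h.row_sum, mul_one]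

lemma wInner_self_eq_right (f : ι → ℝ) :
    ⟪f, f⟫_[ℝ, π] = ∑ x, ∑ y, π x * K x y * f y ^ 2 := by
  rw [Finset.sum_comm]
  simp_rw [wInner_self_eq_sum_sq, ← Finset.sum_mul, h.sum_weight_mul]

lemma dirichlet_eq (f : ι → ℝ) :
    dirichlet K π f = 1 / 2 * ∑ x, ∑ y, π x * K x y * (f x - f y) ^ 2 := by
  have expand : ∑ x, ∑ y, π x * K x y * (f x - f y) ^ 2 =
      ∑ x, ∑ y, π x * K x y * f x ^ 2 + ∑ x, ∑ y, π x * K x y * f y ^ 2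
        - 2 * ∑ x, ∑ y, π x * K x y * (f x * f y) := by
    simp only [Finset.mul_sum, ← Finset.sum_add_distrib, ← Finset.sum_sub_distrib]
    exact Finset.sum_congr rfl fun _ _ => Finset.sum_congr rfl fun _ _ => by ring
  rw [dirichlet, wInner_sub_left, expand, ← h.wInner_self_eq_left, ← h.wInner_self_eq_right,
    ← wInner_mulVec_self]
  ring

lemma wInner_add_mulVec (f : ι → ℝ) :
    ⟪f + K.mulVec f, f⟫_[ℝ, π] = 1 / 2 * ∑ x, ∑ y, π x * K x y * (f x + f y) ^ 2 := by
  have expand : ∑ x, ∑ y, π x * K x y * (f x + f y) ^ 2 =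
      ∑ x, ∑ y, π x * K x y * f x ^ 2 + ∑ x, ∑ y, π x * K x y * f y ^ 2
        + 2 * ∑ x, ∑ y, π x * K x y * (f x * f y) := by
    simp only [Finset.mul_sum, ← Finset.sum_add_distrib]
    exact Finset.sum_congr rfl fun _ _ => Finset.sum_congr rfl fun _ _ => by ring
  rw [wInner_add_left, expand, ← h.wInner_self_eq_left, ← h.wInner_self_eq_right,
    ← wInner_mulVec_self]
  ring

lemma dirichlet_nonneg (f : ι → ℝ) : 0 ≤ dirichlet K π f := by
  rw [h.dirichlet_eq]
  exact mul_nonneg (by norm_num) <| Finset.sum_nonneg fun x _ => Finset.sum_nonneg fun y _ =>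
    mul_nonneg (mul_nonneg (h.weight_nonneg x) (h.nonneg x y)) (sq_nonneg _)

lemma mul_self : IsReversible (K * K) π where
  nonneg x y := Finset.sum_nonneg fun z _ => mul_nonneg (h.nonneg x z) (h.nonneg z y)
  row_sum x := by
    simp_rw [Matrix.mul_apply]
    rw [Finset.sum_comm]
    simp_rw [← Finset.mul_sum, h.row_sum, mul_one, h.row_sum]
  weight_nonneg := h.weight_nonneg
  weight_sum := h.weight_sum
  balance x y := by
    simp_rw [Matrix.mul_apply, Finset.mul_sum]
    refine Finset.sum_congr rfl fun z _ => ?_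
    linear_combination K z y * h.balance x z + K z x * h.balance z y

lemma wInner_sub_wInner_mulVec (f : ι → ℝ) :
    ⟪f, f⟫_[ℝ, π] - ⟪K.mulVec f, K.mulVec f⟫_[ℝ, π] = dirichlet (K * K) π f := by
  rw [dirichlet, wInner_sub_left, ← Matrix.mulVec_mulVec, h.wInner_mulVec_left (K.mulVec f) f]

lemma wInner_mulVec_le (f : ι → ℝ) :
    ⟪K.mulVec f, K.mulVec f⟫_[ℝ, π] ≤ ⟪f, f⟫_[ℝ, π] := by
  linarith [h.wInner_sub_wInner_mulVec f, h.mul_self.dirichlet_nonneg f]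

lemma dirichlet_sub_dirichlet_mulVec (f : ι → ℝ) :
    dirichlet K π f - dirichlet K π (K.mulVec f) =
      ⟪(f - K.mulVec f) + K.mulVec (f - K.mulVec f), f - K.mulVec f⟫_[ℝ, π] := by
  simp only [dirichlet, wInner_add_left, wInner_sub_left, wInner_sub_right, Matrix.mulVec_sub,
    h.wInner_mulVec_left (K.mulVec f) f]
  linarith [h.wInner_mulVec_left f f]

end IsReversible

end Reversible

/-! ### The `L²` maximal inequality for lazy reversible chains -/

section Maximal

lemma sum_Ico_sub_succ {G : Type*} [AddCommGroup G] (f : ℕ → G) {s m : ℕ} (hsm : s ≤ m) :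
    ∑ k ∈ Finset.Ico s m, (f k - f (k + 1)) = f s - f m := by
  simpa [neg_add_eq_sub] using Finset.sum_Ico_sub (fun k => -f k) hsm

variable {ι : Type*} [Fintype ι] {K : Matrix ι ι ℝ} {π : ι → ℝ}

namespace IsReversible

section Lazy

variable (h : IsReversible K π) {δ : ℝ} (hδ : ∀ x, δ ≤ K x x)
include h hδ

lemma two_mul_le_mul_self_apply {x y : ι} (hxy : x ≠ y) : 2 * δ * K x y ≤ (K * K) x y := by
  classical
  have two_terms : ∑ z ∈ {x, y}, K x z * K z y ≤ ∑ z, K x z * K z y :=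
    Finset.sum_le_sum_of_subset_of_nonneg (Finset.subset_univ _)
      fun z _ _ => mul_nonneg (h.nonneg x z) (h.nonneg z y)
  rw [Finset.sum_pair hxy] at two_terms
  rw [Matrix.mul_apply]
  linarith [mul_le_mul_of_nonneg_right (hδ x) (h.nonneg x y),
    mul_le_mul_of_nonneg_left (hδ y) (h.nonneg x y)]

lemma two_mul_wInner_le (f : ι → ℝ) :
    2 * δ * ⟪f, f⟫_[ℝ, π] ≤ ⟪f + K.mulVec f, f⟫_[ℝ, π] := by
  rw [h.wInner_add_mulVec, wInner_self_eq_sum_sq, Finset.mul_sum, Finset.mul_sum]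
  refine Finset.sum_le_sum fun x _ => ?_
  have diagonal : π x * K x x * (f x + f x) ^ 2 ≤ ∑ y, π x * K x y * (f x + f y) ^ 2 :=
    Finset.single_le_sum (f := fun y => π x * K x y * (f x + f y) ^ 2)
      (fun y _ => mul_nonneg (mul_nonneg (h.weight_nonneg x) (h.nonneg x y)) (sq_nonneg _))
      (Finset.mem_univ x)
  have lazy : δ * (π x * f x ^ 2) ≤ K x x * (π x * f x ^ 2) :=
    mul_le_mul_of_nonneg_right (hδ x) (mul_nonneg (h.weight_nonneg x) (sq_nonneg _))
  linarith

lemma two_mul_dirichlet_le (f : ι → ℝ) :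
    2 * δ * dirichlet K π f ≤ ⟪f, f⟫_[ℝ, π] - ⟪K.mulVec f, K.mulVec f⟫_[ℝ, π] := by
  rw [h.wInner_sub_wInner_mulVec, h.dirichlet_eq, h.mul_self.dirichlet_eq, mul_left_comm]
  simp only [Finset.mul_sum (a := 2 * δ)]
  gcongr 1 / 2 * ∑ x, ∑ y, ?_ with x _ y _
  rcases eq_or_ne x y with rfl | hxy
  · simp
  · linarith [mul_le_mul_of_nonneg_left (h.two_mul_le_mul_self_apply hδ hxy)
      (mul_nonneg (h.weight_nonneg x) (sq_nonneg (f x - f y)))]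

lemma two_mul_wInner_sub_le (f : ι → ℝ) :
    2 * δ * ⟪f - K.mulVec f, f - K.mulVec f⟫_[ℝ, π] ≤
      dirichlet K π f - dirichlet K π (K.mulVec f) := by
  rw [h.dirichlet_sub_dirichlet_mulVec]
  exact h.two_mul_wInner_le hδ _

end Lazy

section Orbit

variable (h : IsReversible K π) {δ : ℝ} (hδ0 : 0 < δ) (hδ : ∀ x, δ ≤ K x x)
  {φ : ℕ → ι → ℝ} (hφ : ∀ k, φ (k + 1) = K.mulVec (φ k))
include h hφ

lemma sum_mul_orbit (h0 : ∑ x, π x * φ 0 x = 0) (k : ℕ) : ∑ x, π x * φ k x = 0 := by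
  induction k with
  | zero => exact h0
  | succ k ih => rw [hφ, h.sum_mulVec, ih]

lemma antitone_wInner_orbit : Antitone fun k => ⟪φ k, φ k⟫_[ℝ, π] :=
  antitone_nat_of_succ_le fun k => by
    simp only [hφ]
    exact h.wInner_mulVec_le _

include hδ

include hδ0 in
lemma antitone_dirichlet_orbit : Antitone fun k => dirichlet K π (φ k) :=
  antitone_nat_of_succ_le fun k => by
    have decrement := h.two_mul_wInner_sub_le hδ (φ k)
    rw [← hφ] at decrement
    nlinarith [wInner_self_nonneg h.weight_nonneg (φ k - φ (k + 1))]

lemma two_mul_sum_dirichlet_le (m : ℕ) :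
    2 * δ * ∑ k ∈ Finset.range m, dirichlet K π (φ k) ≤ ⟪φ 0, φ 0⟫_[ℝ, π] := by
  calc 2 * δ * ∑ k ∈ Finset.range m, dirichlet K π (φ k)
      ≤ ∑ k ∈ Finset.range m, (⟪φ k, φ k⟫_[ℝ, π] - ⟪φ (k + 1), φ (k + 1)⟫_[ℝ, π]) := by
        rw [Finset.mul_sum]
        exact Finset.sum_le_sum fun k _ => hφ k ▸ h.two_mul_dirichlet_le hδ (φ k)
    _ = ⟪φ 0, φ 0⟫_[ℝ, π] - ⟪φ m, φ m⟫_[ℝ, π] :=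
        Finset.sum_range_sub' (fun k => ⟪φ k, φ k⟫_[ℝ, π]) m
    _ ≤ ⟪φ 0, φ 0⟫_[ℝ, π] := sub_le_self _ (wInner_self_nonneg h.weight_nonneg _)

lemma two_mul_sum_wInner_sub_le {s m : ℕ} (hsm : s ≤ m) :
    2 * δ * ∑ k ∈ Finset.Ico s m, ⟪φ k - φ (k + 1), φ k - φ (k + 1)⟫_[ℝ, π] ≤
      dirichlet K π (φ s) := by
  calc 2 * δ * ∑ k ∈ Finset.Ico s m, ⟪φ k - φ (k + 1), φ k - φ (k + 1)⟫_[ℝ, π]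
      ≤ ∑ k ∈ Finset.Ico s m, (dirichlet K π (φ k) - dirichlet K π (φ (k + 1))) := by
        rw [Finset.mul_sum]
        exact Finset.sum_le_sum fun k _ => hφ k ▸ h.two_mul_wInner_sub_le hδ (φ k)
    _ = dirichlet K π (φ s) - dirichlet K π (φ m) :=
        sum_Ico_sub_succ (fun k => dirichlet K π (φ k)) hsm
    _ ≤ dirichlet K π (φ s) := sub_le_self _ (h.dirichlet_nonneg _)

include hδ0 in
lemma mul_sum_wInner_sub_le {s m : ℕ} (hsm : s ≤ m) :
    s * ∑ k ∈ Finset.Ico s m, ⟪φ k - φ (k + 1), φ k - φ (k + 1)⟫_[ℝ, π] ≤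
      ⟪φ 0, φ 0⟫_[ℝ, π] / (4 * δ ^ 2) := by
  have increments := h.two_mul_sum_wInner_sub_le hδ hφ hsm
  have average : s * dirichlet K π (φ s) ≤ ∑ k ∈ Finset.range s, dirichlet K π (φ k) := by
    simpa using Finset.card_nsmul_le_sum (Finset.range s) (fun k => dirichlet K π (φ k)) _
      fun k hk => h.antitone_dirichlet_orbit hδ0 hδ hφ (Finset.mem_range.1 hk).le
  rw [le_div_iff₀ (by positivity)]
  calc s * (∑ k ∈ Finset.Ico s m, ⟪φ k - φ (k + 1), φ k - φ (k + 1)⟫_[ℝ, π]) * (4 * δ ^ 2)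
      = 2 * δ * (s * (2 * δ *
          ∑ k ∈ Finset.Ico s m, ⟪φ k - φ (k + 1), φ k - φ (k + 1)⟫_[ℝ, π])) := by ring
    _ ≤ 2 * δ * (s * dirichlet K π (φ s)) := by gcongr
    _ ≤ 2 * δ * ∑ k ∈ Finset.range s, dirichlet K π (φ k) := by gcongr
    _ ≤ ⟪φ 0, φ 0⟫_[ℝ, π] := h.two_mul_sum_dirichlet_le hδ hφ s

variable {lam : ℝ} (hlam : 0 < lam) (hP : Poincare K π lam) (h0 : ∑ x, π x * φ 0 x = 0)
include hδ0 hlam hP h0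

lemma sum_wInner_orbit_le (m : ℕ) :
    ∑ k ∈ Finset.range m, ⟪φ k, φ k⟫_[ℝ, π] ≤ ⟪φ 0, φ 0⟫_[ℝ, π] / (2 * δ * lam) := by
  rw [le_div_iff₀ (by positivity)]
  calc (∑ k ∈ Finset.range m, ⟪φ k, φ k⟫_[ℝ, π]) * (2 * δ * lam)
      = 2 * δ * ∑ k ∈ Finset.range m, lam * ⟪φ k, φ k⟫_[ℝ, π] := by
        rw [← Finset.mul_sum]; ring
    _ ≤ 2 * δ * ∑ k ∈ Finset.range m, dirichlet K π (φ k) := by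
        gcongr with k
        exact hP (φ k) (h.sum_mul_orbit hφ h0 k)
    _ ≤ ⟪φ 0, φ 0⟫_[ℝ, π] := h.two_mul_sum_dirichlet_le hδ hφ m

lemma mul_wInner_orbit_le {s m : ℕ} (hsm : s ≤ m) :
    s * ⟪φ m, φ m⟫_[ℝ, π] ≤ ⟪φ 0, φ 0⟫_[ℝ, π] / (2 * δ * lam) := by
  refine le_trans ?_ (h.sum_wInner_orbit_le hδ0 hδ hφ hlam hP h0 s)
  simpa using Finset.card_nsmul_le_sum (Finset.range s) (fun k => ⟪φ k, φ k⟫_[ℝ, π]) _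
    fun k hk => h.antitone_wInner_orbit hφ ((Finset.mem_range.1 hk).le.trans hsm)

lemma sum_wInner_orbit_pair_le (s m : ℕ) :
    ∑ k ∈ Finset.Ico s m, (⟪φ k, φ k⟫_[ℝ, π] + ⟪φ (k + 1), φ (k + 1)⟫_[ℝ, π]) ≤
      ⟪φ 0, φ 0⟫_[ℝ, π] / (δ * lam) := by
  calc ∑ k ∈ Finset.Ico s m, (⟪φ k, φ k⟫_[ℝ, π] + ⟪φ (k + 1), φ (k + 1)⟫_[ℝ, π])
      ≤ ∑ k ∈ Finset.Ico s m, 2 * ⟪φ k, φ k⟫_[ℝ, π] :=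
        Finset.sum_le_sum fun k _ => by linarith [h.antitone_wInner_orbit hφ k.le_succ]
    _ ≤ ∑ k ∈ Finset.range m, 2 * ⟪φ k, φ k⟫_[ℝ, π] := by
        rw [Finset.range_eq_Ico]
        exact Finset.sum_le_sum_of_subset_of_nonneg (Finset.Ico_subset_Ico_left s.zero_le)
          fun k _ _ => mul_nonneg zero_le_two (wInner_self_nonneg h.weight_nonneg _)
    _ ≤ 2 * (⟪φ 0, φ 0⟫_[ℝ, π] / (2 * δ * lam)) := by
        rw [← Finset.mul_sum]
        gcongr
        exact h.sum_wInner_orbit_le hδ0 hδ hφ hlam hP h0 m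
    _ = ⟪φ 0, φ 0⟫_[ℝ, π] / (δ * lam) := by field_simp

end Orbit

end IsReversible

/-- A pointwise bound for `φ k ^ 2`, `s ≤ k ≤ m`: it comes from telescoping `φ k ^ 2 - φ m ^ 2` and
applying AM-GM with weight `w` to each increment. -/
def envelope (φ : ℕ → ι → ℝ) (w : ℝ) (s m : ℕ) (x : ι) : ℝ :=
  φ m x ^ 2 + ∑ k ∈ Finset.Ico s m,
    (w * (φ k x - φ (k + 1) x) ^ 2 + (φ k x ^ 2 + φ (k + 1) x ^ 2) / (2 * w))

lemma sq_sub_sq_le_mul_sq_add_div {w : ℝ} (hw : 0 < w) (a b : ℝ) :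
    a ^ 2 - b ^ 2 ≤ w * (a - b) ^ 2 + (a ^ 2 + b ^ 2) / (2 * w) := by
  have gap : w * (a - b) ^ 2 + (a ^ 2 + b ^ 2) / (2 * w) - (a ^ 2 - b ^ 2) =
      ((2 * w * (a - b) - (a + b)) ^ 2 + (a - b) ^ 2) / (4 * w) := by
    field_simp; ring
  exact sub_nonneg.1 (gap ▸ by positivity)

omit [Fintype ι] in
lemma sq_le_envelope (φ : ℕ → ι → ℝ) {w : ℝ} (hw : 0 < w) {s k m : ℕ} (hsk : s ≤ k) (hkm : k ≤ m)
    (x : ι) : φ k x ^ 2 ≤ envelope φ w s m x := by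
  have telescope : φ k x ^ 2 - φ m x ^ 2 =
      ∑ i ∈ Finset.Ico k m, (φ i x ^ 2 - φ (i + 1) x ^ 2) :=
    (sum_Ico_sub_succ (fun i => φ i x ^ 2) hkm).symm
  rw [envelope, ← sub_le_iff_le_add', telescope]
  refine (Finset.sum_le_sum fun i _ => sq_sub_sq_le_mul_sq_add_div hw _ _).trans ?_
  exact Finset.sum_le_sum_of_subset_of_nonneg (Finset.Ico_subset_Ico_left hsk)
    fun i _ _ => by positivity

lemma sum_mul_envelope (π : ι → ℝ) (φ : ℕ → ι → ℝ) (w : ℝ) (s m : ℕ) :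
    ∑ x, π x * envelope φ w s m x =
      ⟪φ m, φ m⟫_[ℝ, π] +
        (w * ∑ k ∈ Finset.Ico s m, ⟪φ k - φ (k + 1), φ k - φ (k + 1)⟫_[ℝ, π] +
        (∑ k ∈ Finset.Ico s m, (⟪φ k, φ k⟫_[ℝ, π] + ⟪φ (k + 1), φ (k + 1)⟫_[ℝ, π])) /
          (2 * w)) := by
  simp only [envelope, wInner_self_eq_sum_sq, Pi.sub_apply, Finset.mul_sum, Finset.sum_div,
    ← Finset.sum_add_distrib, mul_add]
  rw [Finset.sum_add_distrib, Finset.sum_comm (s := Finset.Ico s m)]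
  simp only [← Finset.sum_add_distrib]
  exact Finset.sum_congr rfl fun _ _ => congrArg _ <| Finset.sum_congr rfl fun _ _ => by ring

/-- The constant of the maximal inequality for a `δ`-lazy chain from time `A / lam` on, `lam` being
a Poincaré constant. -/
def maximalConst (δ A : ℝ) : ℝ := 1 / (2 * δ * A) + 1 / √A * (1 / (4 * δ ^ 2) + 1 / (2 * δ))

lemma tendsto_maximalConst (δ : ℝ) : Tendsto (maximalConst δ) atTop (𝓝 0) := by
  have inv_sqrt : Tendsto (fun A : ℝ => 1 / √A) atTop (𝓝 0) :=
    tendsto_const_nhds.div_atTop Real.tendsto_sqrt_atTop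
  have inv_linear : Tendsto (fun A : ℝ => 1 / (2 * δ * A)) atTop (𝓝 0) := by
    simpa [mul_comm] using tendsto_inv_atTop_zero.mul_const (1 / (2 * δ))
  have sum := inv_linear.add (inv_sqrt.mul_const (1 / (4 * δ ^ 2) + 1 / (2 * δ)))
  rw [zero_mul, add_zero] at sum
  exact sum

theorem IsReversible.sum_mul_sup_sq_le (h : IsReversible K π) {δ lam A : ℝ} (hδ0 : 0 < δ)
    (hδ : ∀ x, δ ≤ K x x) (hlam : 0 < lam) (hP : Poincare K π lam) (hA : 0 < A)
    {φ : ℕ → ι → ℝ} (hφ : ∀ k, φ (k + 1) = K.mulVec (φ k)) (h0 : ∑ x, π x * φ 0 x = 0)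
    {s m : ℕ} (hsm : s ≤ m) (hs : A ≤ lam * s) :
    ∑ x, π x * (Finset.Icc s m).sup' (Finset.nonempty_Icc.2 hsm) (fun k => φ k x ^ 2) ≤
      maximalConst δ A * ⟪φ 0, φ 0⟫_[ℝ, π] := by
  have hs0 : (0 : ℝ) < s := pos_of_mul_pos_right (hA.trans_le hs) hlam.le
  set E := ⟪φ 0, φ 0⟫_[ℝ, π]
  have hE : 0 ≤ E := wInner_self_nonneg h.weight_nonneg _
  have final : ⟪φ m, φ m⟫_[ℝ, π] ≤ 1 / (2 * δ * A) * E := by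
    have := h.mul_wInner_orbit_le hδ0 hδ hφ hlam hP h0 hsm
    calc ⟪φ m, φ m⟫_[ℝ, π] ≤ E / (2 * δ * lam) / s := by rwa [le_div_iff₀ hs0, mul_comm]
      _ = 1 / (2 * δ * (lam * s)) * E := by field_simp
      _ ≤ 1 / (2 * δ * A) * E := by gcongr
  have increments : s / √A * ∑ k ∈ Finset.Ico s m, ⟪φ k - φ (k + 1), φ k - φ (k + 1)⟫_[ℝ, π] ≤
      1 / √A * (1 / (4 * δ ^ 2)) * E := by
    rw [div_mul_eq_mul_div, mul_assoc, one_div_mul_eq_div, one_div_mul_eq_div]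
    gcongr
    exact h.mul_sum_wInner_sub_le hδ0 hδ hφ hsm
  have pairs : (∑ k ∈ Finset.Ico s m, (⟪φ k, φ k⟫_[ℝ, π] + ⟪φ (k + 1), φ (k + 1)⟫_[ℝ, π])) /
      (2 * (s / √A)) ≤ 1 / √A * (1 / (2 * δ)) * E := by
    calc _ ≤ E / (δ * lam) / (2 * (s / √A)) := by
          gcongr
          exact h.sum_wInner_orbit_pair_le hδ0 hδ hφ hlam hP h0 s m
      _ = √A / (lam * s) * (1 / (2 * δ)) * E := by field_simp
      _ ≤ √A / A * (1 / (2 * δ)) * E := by gcongr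
      _ = 1 / √A * (1 / (2 * δ)) * E := by rw [Real.sqrt_div_self']
  calc ∑ x, π x * (Finset.Icc s m).sup' _ (fun k => φ k x ^ 2)
      ≤ ∑ x, π x * envelope φ (s / √A) s m x := by
        gcongr with x
        · exact h.weight_nonneg x
        · exact Finset.sup'_le _ _ fun k hk =>
            sq_le_envelope φ (by positivity) (Finset.mem_Icc.1 hk).1 (Finset.mem_Icc.1 hk).2 x
    _ ≤ maximalConst δ A * E := by
        rw [sum_mul_envelope, maximalConst]
        linarith

end Maximal

/-! ### Birth and death chains in coordinates -/

section Coordinates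

variable {n : ℕ}

/-- `K` is a birth and death matrix with positive birth rates, reversible with respect to `π`. -/
structure IsBD (K : Matrix (Fin (n + 1)) (Fin (n + 1)) ℝ) (π : Fin (n + 1) → ℝ) : Prop
    extends IsReversible K π where
  weight_pos : ∀ x, 0 < π x
  nearest : ∀ i j : Fin (n + 1), (i : ℕ) + 1 < j ∨ (j : ℕ) + 1 < i → K i j = 0
  succ_pos : ∀ i : Fin n, 0 < K i.castSucc i.succ

/-- The birth rate at `k`. -/
def up (K : Matrix (Fin (n + 1)) (Fin (n + 1)) ℝ) (k : ℕ) : ℝ :=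
  if h : k < n then K ⟨k, by omega⟩ ⟨k + 1, by omega⟩ else 0

/-- The death rate at `k + 1`. -/
def down (K : Matrix (Fin (n + 1)) (Fin (n + 1)) ℝ) (k : ℕ) : ℝ :=
  if h : k < n then K ⟨k + 1, by omega⟩ ⟨k, by omega⟩ else 0

/-- The weights, extended by zero to `ℕ`. -/
def wt (π : Fin (n + 1) → ℝ) (k : ℕ) : ℝ := if h : k < n + 1 then π ⟨k, h⟩ else 0

/-- The conductance of the edge `{k, k + 1}`. -/
def cond (K : Matrix (Fin (n + 1)) (Fin (n + 1)) ℝ) (π : Fin (n + 1) → ℝ) (k : ℕ) : ℝ :=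
  wt π k * up K k

/-- The weight of `[0, k]`. -/
def cum (π : Fin (n + 1) → ℝ) (k : ℕ) : ℝ := ∑ i ∈ Finset.range (k + 1), wt π i

/-- The mean passage time from `k` to `k + 1`. -/
def passMean (K : Matrix (Fin (n + 1)) (Fin (n + 1)) ℝ) (π : Fin (n + 1) → ℝ) (k : ℕ) : ℝ :=
  cum π k / cond K π k

/-- The variance of the passage time from `k` to `k + 1` of the continuous time chain. -/
def passVar (K : Matrix (Fin (n + 1)) (Fin (n + 1)) ℝ) (π : Fin (n + 1) → ℝ) (k : ℕ) : ℝ :=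
  (cond K π k * passMean K π k ^ 2 +
    2 * ∑ y ∈ Finset.range k, cond K π y * passMean K π y ^ 2) / cond K π k

/-- The mean hitting time of `z` from `k ≤ z`. -/
def upMean (K : Matrix (Fin (n + 1)) (Fin (n + 1)) ℝ) (π : Fin (n + 1) → ℝ) (z k : ℕ) : ℝ :=
  ∑ i ∈ Finset.Ico k z, passMean K π i

/-- The variance of the hitting time of `z` from `k ≤ z` of the continuous time chain. -/
def upVar (K : Matrix (Fin (n + 1)) (Fin (n + 1)) ℝ) (π : Fin (n + 1) → ℝ) (z k : ℕ) : ℝ :=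
  ∑ i ∈ Finset.Ico k z, passVar K π i

variable {K : Matrix (Fin (n + 1)) (Fin (n + 1)) ℝ} {π : Fin (n + 1) → ℝ}

lemma wt_coe (x : Fin (n + 1)) : wt π x = π x := by
  rw [wt, dif_pos x.2]

lemma sum_range_wt (f : ℕ → ℝ) :
    ∑ i ∈ Finset.range (n + 1), wt π i * f i = ∑ x : Fin (n + 1), π x * f x := by
  rw [← Fin.sum_univ_eq_sum_range (fun i => wt π i * f i)]
  simp [wt_coe]

lemma cum_succ (k : ℕ) : cum π (k + 1) = cum π k + wt π (k + 1) := Finset.sum_range_succ _ _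

lemma upMean_self (z : ℕ) : upMean K π z z = 0 := by simp [upMean]

lemma upVar_self (z : ℕ) : upVar K π z z = 0 := by simp [upVar]

lemma upMean_eq_add {z k : ℕ} (hk : k < z) :
    upMean K π z k = passMean K π k + upMean K π z (k + 1) := Finset.sum_eq_sum_Ico_succ_bot hk _

lemma upVar_eq_add {z k : ℕ} (hk : k < z) :
    upVar K π z k = passVar K π k + upVar K π z (k + 1) := Finset.sum_eq_sum_Ico_succ_bot hk _

lemma upMean_add {a b c : ℕ} (hab : a ≤ b) (hbc : b ≤ c) :
    upMean K π b a + upMean K π c b = upMean K π c a := Finset.sum_Ico_consecutive _ hab hbc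

namespace IsBD

variable (h : IsBD K π)
include h

lemma up_pos {k : ℕ} (hk : k < n) : 0 < up K k := by
  simpa [up, hk] using h.succ_pos ⟨k, hk⟩

lemma wt_pos {k : ℕ} (hk : k ≤ n) : 0 < wt π k := by
  simpa [wt, Nat.lt_succ_of_le hk] using h.weight_pos ⟨k, by omega⟩

lemma wt_nonneg (k : ℕ) : 0 ≤ wt π k := by
  unfold wt; split_ifs
  · exact h.weight_nonneg _
  · exact le_rfl

lemma up_nonneg (k : ℕ) : 0 ≤ up K k := by
  unfold up; split_ifs
  · exact h.nonneg _ _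
  · exact le_rfl

lemma cond_eq (k : ℕ) : cond K π k = wt π (k + 1) * down K k := by
  unfold cond up down
  split_ifs with hk
  · have := h.balance ⟨k, by omega⟩ ⟨k + 1, by omega⟩
    simpa [wt, hk, Nat.lt_succ_of_lt hk] using this
  · simp

lemma cond_pos {k : ℕ} (hk : k < n) : 0 < cond K π k :=
  mul_pos (h.wt_pos hk.le) (h.up_pos hk)

lemma cond_nonneg (k : ℕ) : 0 ≤ cond K π k := mul_nonneg (h.wt_nonneg k) (h.up_nonneg k)

lemma down_pos {k : ℕ} (hk : k < n) : 0 < down K k := by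
  have cond_pos := h.cond_pos hk
  rw [h.cond_eq] at cond_pos
  exact pos_of_mul_pos_right cond_pos (h.wt_nonneg _)

lemma cum_nonneg (k : ℕ) : 0 ≤ cum π k := Finset.sum_nonneg fun i _ => h.wt_nonneg i

lemma wt_le_cum (k : ℕ) : wt π k ≤ cum π k :=
  Finset.single_le_sum (fun i _ => h.wt_nonneg i) (Finset.self_mem_range_succ k)

lemma cum_last : cum π n = 1 := by
  simpa only [cum, mul_one, h.weight_sum] using sum_range_wt (π := π) fun _ => 1

lemma monotone_cum : Monotone (cum π) := monotone_nat_of_le_succ fun k => by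
  rw [cum_succ]; linarith [h.wt_nonneg (k + 1)]

lemma cum_le_one {k : ℕ} (hk : k ≤ n) : cum π k ≤ 1 := h.cum_last ▸ h.monotone_cum hk

lemma passMean_nonneg (k : ℕ) : 0 ≤ passMean K π k :=
  div_nonneg (h.cum_nonneg k) (h.cond_nonneg k)

lemma passVar_nonneg (k : ℕ) : 0 ≤ passVar K π k :=
  div_nonneg (add_nonneg (mul_nonneg (h.cond_nonneg k) (sq_nonneg _))
    (mul_nonneg zero_le_two (Finset.sum_nonneg fun y _ =>
      mul_nonneg (h.cond_nonneg y) (sq_nonneg _)))) (h.cond_nonneg k)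

lemma upMean_nonneg (z k : ℕ) : 0 ≤ upMean K π z k :=
  Finset.sum_nonneg fun i _ => h.passMean_nonneg i

lemma upVar_nonneg (z k : ℕ) : 0 ≤ upVar K π z k :=
  Finset.sum_nonneg fun i _ => h.passVar_nonneg i

lemma one_le_mul_passMean {k : ℕ} (hk : k < n) : 1 ≤ up K k * passMean K π k := by
  rw [passMean, ← mul_div_assoc, one_le_div (h.cond_pos hk), cond, mul_comm]
  exact mul_le_mul_of_nonneg_left (h.wt_le_cum k) (h.up_nonneg k)

lemma up_add_le (k : ℕ) (hk : k < n) : up K k + K ⟨k, by omega⟩ ⟨k, by omega⟩ ≤ 1 := by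
  rw [← h.row_sum ⟨k, by omega⟩]
  have := Finset.sum_le_sum_of_subset_of_nonneg
    (Finset.subset_univ {(⟨k + 1, by omega⟩ : Fin (n + 1)), ⟨k, by omega⟩})
    fun j _ _ => h.nonneg ⟨k, by omega⟩ j
  rw [Finset.sum_pair (by simp)] at this
  simpa [up, hk] using this

lemma one_le_passMean {k : ℕ} (hk : k < n) : 1 ≤ passMean K π k := by
  have up_le : up K k ≤ 1 :=
    (le_add_of_nonneg_right (h.nonneg _ _)).trans (h.up_add_le k hk)
  exact (h.one_le_mul_passMean hk).trans (mul_le_of_le_one_left (h.passMean_nonneg k) up_le)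

/-- The row `x` of `K`, as an operator on increments, only sees the two neighbours of `x`. -/
lemma mul_sub_eq (f : ℕ → ℝ) (x j : Fin (n + 1)) :
    K x j * (f j - f x) = (if (j : ℕ) = x + 1 then up K x * (f (x + 1) - f x) else 0) +
      if (j : ℕ) + 1 = x then down K (x - 1) * (f (x - 1) - f x) else 0 := by
  rcases lt_trichotomy (j : ℕ) x with hlt | heq | hgt
  · rw [if_neg (by omega), zero_add]
    split_ifs with hj
    · have : (x : ℕ) - 1 = j := by omega
      simp only [down, this, hj, show (j : ℕ) < n by omega, dif_pos]
    · rw [h.nearest x j (Or.inr (by omega)), zero_mul]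
  · simp [Fin.ext heq]
  · rw [if_neg (by omega : ¬(j : ℕ) + 1 = x), add_zero]
    split_ifs with hj
    · simp only [up, ← hj, show (x : ℕ) < n by omega, dif_pos]
    · rw [h.nearest x j (Or.inl (by omega)), zero_mul]

lemma sum_mul_eq (f : ℕ → ℝ) (x : Fin (n + 1)) :
    ∑ j, K x j * f j = f x + up K x * (f (x + 1) - f x) +
      if (x : ℕ) = 0 then 0 else down K (x - 1) * (f (x - 1) - f x) := by
  have increments : ∑ j, K x j * f j = f x + ∑ j, K x j * (f j - f x) := by
    simp only [mul_sub, Finset.sum_sub_distrib, ← Finset.sum_mul, h.row_sum]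
    ring
  rw [increments, add_assoc, Finset.sum_congr rfl fun j _ => h.mul_sub_eq f x j,
    Finset.sum_add_distrib]
  congr 2
  · rw [Fin.sum_univ_eq_sum_range
      fun j => if j = (x : ℕ) + 1 then up K x * (f (x + 1) - f x) else 0, Finset.sum_ite_eq']
    split_ifs with hx
    · rfl
    · rw [up, dif_neg (by simpa using hx), zero_mul]
  · rw [Fin.sum_univ_eq_sum_range
      fun j => if j + 1 = (x : ℕ) then down K (x - 1) * (f (x - 1) - f x) else 0]
    rcases (x : ℕ).eq_zero_or_pos with hx | hx
    · rw [if_pos hx]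
      exact Finset.sum_eq_zero fun j _ => if_neg (by omega)
    · rw [if_neg hx.ne', Finset.sum_eq_single_of_mem (x - 1 : ℕ)
        (Finset.mem_range.2 (by omega)) fun j _ hj => if_neg (by omega), if_pos (by omega)]

lemma passMean_zero (hn : 0 < n) : up K 0 * passMean K π 0 = 1 := by
  have wt_pos := h.wt_pos n.zero_le
  have up_pos := h.up_pos hn
  rw [passMean, cond, cum, zero_add, Finset.sum_range_one]
  field_simp

lemma passMean_succ {k : ℕ} (hk : k + 1 < n) :
    up K (k + 1) * passMean K π (k + 1) = 1 + down K k * passMean K π k := by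
  have wt_pos := h.wt_pos hk.le
  have up_pos := h.up_pos hk
  have down_pos := h.down_pos (by omega : k < n)
  rw [passMean, passMean, h.cond_eq k, cond, cum_succ]
  field_simp
  ring

lemma passVar_zero (hn : 0 < n) : up K 0 * passVar K π 0 = up K 0 * passMean K π 0 ^ 2 := by
  have cond_pos := h.cond_pos hn
  rw [passVar, Finset.sum_range_zero, mul_zero, add_zero, mul_div_cancel_left₀ _ cond_pos.ne']

lemma passVar_succ {k : ℕ} (hk : k + 1 < n) :
    up K (k + 1) * passVar K π (k + 1) = down K k * passVar K π k +
      up K (k + 1) * passMean K π (k + 1) ^ 2 + down K k * passMean K π k ^ 2 := by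
  have wt_pos := h.wt_pos hk.le
  have up_pos := h.up_pos hk
  have down_pos := h.down_pos (by omega : k < n)
  have cond_succ : cond K π (k + 1) = wt π (k + 1) * up K (k + 1) := rfl
  rw [passVar, passVar, Finset.sum_range_succ, cond_succ, h.cond_eq k]
  field_simp
  ring

lemma antitone_upMean (z : ℕ) : Antitone (upMean K π z) := fun _ _ hab =>
  Finset.sum_le_sum_of_subset_of_nonneg (Finset.Ico_subset_Ico_left hab)
    fun i _ _ => h.passMean_nonneg i

lemma upMean_mono {z z' : ℕ} (hz : z ≤ z') (k : ℕ) : upMean K π z k ≤ upMean K π z' k :=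
  Finset.sum_le_sum_of_subset_of_nonneg (Finset.Ico_subset_Ico_right hz)
    fun i _ _ => h.passMean_nonneg i

lemma upVar_mono {z z' : ℕ} (hz : z ≤ z') (k : ℕ) : upVar K π z k ≤ upVar K π z' k :=
  Finset.sum_le_sum_of_subset_of_nonneg (Finset.Ico_subset_Ico_right hz)
    fun i _ _ => h.passVar_nonneg i

lemma antitone_upVar (z : ℕ) : Antitone (upVar K π z) := fun _ _ hab =>
  Finset.sum_le_sum_of_subset_of_nonneg (Finset.Ico_subset_Ico_left hab)
    fun i _ _ => h.passVar_nonneg i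

lemma sub_le_upMean {z k : ℕ} (hz : z ≤ n) (hk : k ≤ z) : (z : ℝ) - k ≤ upMean K π z k := by
  have := Finset.card_nsmul_le_sum (Finset.Ico k z) (passMean K π) 1 fun i hi =>
    h.one_le_passMean ((Finset.mem_Ico.1 hi).2.trans_le hz)
  simpa [Nat.cast_sub hk, upMean] using this

lemma one_le_upMean {z k : ℕ} (hz : z ≤ n) (hk : k < z) : 1 ≤ upMean K π z k := by
  have := h.sub_le_upMean hz hk.le
  have : (k : ℝ) + 1 ≤ z := by exact_mod_cast hk
  linarith

lemma sum_mul_upMean {z : ℕ} (hz : z ≤ n) {x : Fin (n + 1)} (hx : (x : ℕ) < z) :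
    ∑ j, K x j * upMean K π z j = upMean K π z x - 1 := by
  rw [h.sum_mul_eq]
  obtain ⟨_ | k, hxn⟩ := x
  · rw [if_pos rfl, upMean_eq_add hx]
    linear_combination -h.passMean_zero (by omega)
  · change k + 1 < z at hx
    have hk : k < z := k.lt_succ_self.trans hx
    rw [if_neg k.succ_ne_zero, Nat.add_sub_cancel, upMean_eq_add hk, upMean_eq_add hx]
    linear_combination -h.passMean_succ (by omega : k + 1 < n)

/-- The function `upVar + (upMean - t) ^ 2` is the second moment around `t` of the hitting time of
`z`, up to the mean, which accounts for the term `-1`. -/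
lemma sum_mul_upVar_add {z : ℕ} (hz : z ≤ n) {x : Fin (n + 1)} (hx : (x : ℕ) < z) (t : ℝ) :
    ∑ j, K x j * (upVar K π z j + (upMean K π z j - (t - 1)) ^ 2) =
      upVar K π z x + (upMean K π z x - t) ^ 2 - 1 := by
  rw [h.sum_mul_eq fun j => upVar K π z j + (upMean K π z j - (t - 1)) ^ 2]
  obtain ⟨_ | k, hxn⟩ := x
  · rw [if_pos rfl, upMean_eq_add hx, upVar_eq_add hx]
    linear_combination -h.passVar_zero (by omega) -
      (2 * (passMean K π 0 + upMean K π z (0 + 1) - t + 1)) * h.passMean_zero (by omega)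
  · change k + 1 < z at hx
    have hk : k < z := k.lt_succ_self.trans hx
    rw [if_neg k.succ_ne_zero, Nat.add_sub_cancel, upMean_eq_add hk, upVar_eq_add hk,
      upMean_eq_add hx, upVar_eq_add hx]
    linear_combination -h.passVar_succ (by omega : k + 1 < n) -
      (2 * (passMean K π (k + 1) + upMean K π z (k + 1 + 1) - t + 1)) *
        h.passMean_succ (by omega : k + 1 < n)

end IsBD

end Coordinates

/-! ### Survival probabilities -/

section Survival

variable {ι : Type*} [Fintype ι] {K : Matrix ι ι ℝ} {π : ι → ℝ} {z : ι}

/-- The minimum principle for the parabolic inequality `K g_j ≤ g_{j+1}` on a set of states which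
the chain can only leave through `z`. -/
lemma nonneg_of_supersolution (hK : ∀ x y, 0 ≤ K x y) {S : Set ι}
    (hS : ∀ x ∈ S, x ≠ z → ∀ y ∉ S, K x y = 0) {g : ℕ → ι → ℝ} {m : ℕ}
    (zero : ∀ x ∈ S, x ≠ z → 0 ≤ g 0 x) (boundary : ∀ j ≤ m, 0 ≤ g j z)
    (step : ∀ j < m, ∀ x ∈ S, x ≠ z → ∑ y, K x y * g j y ≤ g (j + 1) x)
    {x : ι} (hx : x ∈ S) : 0 ≤ g m x := by
  suffices ∀ j ≤ m, ∀ x ∈ S, 0 ≤ g j x from this m le_rfl x hx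
  intro j
  induction j with
  | zero =>
    intro hj x hx
    rcases eq_or_ne x z with rfl | hxz
    · exact boundary 0 hj
    · exact zero x hx hxz
  | succ j ih =>
    intro hj x hx
    rcases eq_or_ne x z with rfl | hxz
    · exact boundary _ hj
    · refine (Finset.sum_nonneg fun y _ => ?_).trans (step j hj x hx hxz)
      by_cases hy : y ∈ S
      · exact mul_nonneg (hK x y) (ih (by omega) y hy)
      · rw [hS x hx hxz y hy, zero_mul]

lemma IsReversible.sum_mul_sub_const (h : IsReversible K π) (x : ι) (c : ℝ) (f : ι → ℝ) :
    ∑ y, K x y * (c - f y) = c - ∑ y, K x y * f y := by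
  simp only [mul_sub, Finset.sum_sub_distrib, ← Finset.sum_mul, h.row_sum, one_mul]

lemma IsReversible.orbit_le_one (h : IsReversible K π) {φ : ℕ → ι → ℝ}
    (hφ : ∀ k, φ (k + 1) = K.mulVec (φ k)) (hle : ∀ x, φ 0 x ≤ 1) (k : ℕ) (x : ι) : φ k x ≤ 1 := by
  induction k generalizing x with
  | zero => exact hle x
  | succ k ih =>
    rw [hφ, ← h.row_sum x]
    exact Finset.sum_le_sum fun y _ => mul_le_of_le_one_right (h.nonneg x y) (ih y)

variable [DecidableEq ι]

/-- The expectation of `f` at time `m` on the event that `z` has not been visited, for the chain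
started at `x`. -/
def killed (K : Matrix ι ι ℝ) (z : ι) (f : ι → ℝ) : ℕ → ι → ℝ
  | 0, x => if x = z then 0 else f x
  | m + 1, x => if x = z then 0 else ∑ y, K x y * killed K z f m y

/-- The probability that the chain started at `x` does not visit `z` up to time `m`. -/
def surv (K : Matrix ι ι ℝ) (z : ι) (m : ℕ) (x : ι) : ℝ := killed K z (fun _ => 1) m x

@[simp] lemma surv_self (m : ℕ) : surv K z m z = 0 := by
  cases m <;> exact if_pos rfl

lemma surv_zero {x : ι} (hx : x ≠ z) : surv K z 0 x = 1 := if_neg hx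

lemma surv_succ {x : ι} (hx : x ≠ z) (m : ℕ) :
    surv K z (m + 1) x = ∑ y, K x y * surv K z m y := if_neg hx

lemma surv_nonneg (hK : ∀ x y, 0 ≤ K x y) (m : ℕ) (x : ι) : 0 ≤ surv K z m x :=
  nonneg_of_supersolution (S := Set.univ) (z := z) hK (by simp)
    (fun _ _ hx => (surv_zero hx).symm ▸ zero_le_one) (fun j _ => (surv_self j).ge)
    (fun j _ _ _ hx => (surv_succ hx j).ge) (Set.mem_univ x)

namespace IsReversible

variable (h : IsReversible K π)
include h

lemma surv_le_one (m : ℕ) (x : ι) : surv K z m x ≤ 1 := by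
  refine sub_nonneg.1 <| nonneg_of_supersolution (S := Set.univ) (z := z)
    (g := fun j x => 1 - surv K z j x) h.nonneg (by simp) (fun x _ hx => ?_)
    (fun j _ => ?_) (fun j _ x _ hx => ?_) (Set.mem_univ x)
  · simp [surv_zero hx]
  · simp
  · rw [h.sum_mul_sub_const, surv_succ hx]

lemma antitone_surv (x : ι) : Antitone fun m => surv K z m x := by
  refine antitone_nat_of_succ_le fun m => sub_nonneg.1 <|
    nonneg_of_supersolution (S := Set.univ) (z := z)
      (g := fun j x => surv K z j x - surv K z (j + 1) x) h.nonneg (by simp) (fun x _ hx => ?_)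
      (fun j _ => ?_) (fun j _ x _ hx => ?_) (Set.mem_univ x)
  · simpa [surv_zero hx] using h.surv_le_one 1 x
  · simp
  · simp only [mul_sub, Finset.sum_sub_distrib, surv_succ hx, le_refl]

/-- Decomposition of the orbit at the first visit to `z`: during the `a` steps either `z` is not
visited, or the orbit is bounded by its later values at `z`. -/
lemma orbit_le_add_surv {φ : ℕ → ι → ℝ} (hφ : ∀ k, φ (k + 1) = K.mulVec (φ k))
    (hle : ∀ x, φ 0 x ≤ 1) {b : ℝ} (hb : 0 ≤ b) {s a : ℕ}
    (hz : ∀ k, s ≤ k → k ≤ s + a → φ k z ≤ b) (x : ι) : φ (s + a) x ≤ b + surv K z a x := by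
  refine sub_nonneg.1 <| nonneg_of_supersolution (S := Set.univ) (z := z)
    (g := fun j x => b + surv K z j x - φ (s + j) x) h.nonneg (by simp) (fun x _ hx => ?_)
    (fun j hj => ?_) (fun j _ x _ hx => ?_) (Set.mem_univ x)
  · rw [surv_zero hx]
    linarith [h.orbit_le_one hφ hle (s + 0) x]
  · simpa using hz (s + j) (by omega) (by omega)
  · simp only [add_sub_assoc, mul_add, mul_sub, Finset.sum_add_distrib, Finset.sum_sub_distrib,
      ← Finset.sum_mul, h.row_sum, one_mul, surv_succ hx, ← add_assoc, hφ]
    exact le_rfl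

end IsReversible

end Survival

section HittingTimes

variable {n : ℕ} {K : Matrix (Fin (n + 1)) (Fin (n + 1)) ℝ} {π : Fin (n + 1) → ℝ}
  {z : Fin (n + 1)}

/-- The matrix of the reflected chain. -/
def revK (K : Matrix (Fin (n + 1)) (Fin (n + 1)) ℝ) : Matrix (Fin (n + 1)) (Fin (n + 1)) ℝ :=
  K.submatrix Fin.rev Fin.rev

lemma revK_apply (x y : Fin (n + 1)) : revK K x y = K x.rev y.rev := rfl

lemma killed_rev (f : Fin (n + 1) → ℝ) (m : ℕ) (x : Fin (n + 1)) :
    killed (revK K) z.rev (f ∘ Fin.rev) m x.rev = killed K z f m x := by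
  induction m generalizing x with
  | zero => simp only [killed, Fin.rev_inj, Function.comp_apply, Fin.rev_rev]
  | succ m ih =>
    simp only [killed, Fin.rev_inj, revK_apply, Fin.rev_rev]
    congr 1
    rw [← Equiv.sum_comp Fin.revPerm]
    simp only [Fin.revPerm_apply, Fin.rev_rev, ih]

lemma surv_rev (m : ℕ) (x : Fin (n + 1)) :
    surv (revK K) z.rev m x.rev = surv K z m x :=
  killed_rev (fun _ => 1) m x

namespace IsBD

variable (h : IsBD K π)
include h

lemma nonneg_of_supersolution {g : ℕ → Fin (n + 1) → ℝ} {m : ℕ}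
    (zero : ∀ x < z, 0 ≤ g 0 x) (boundary : ∀ j ≤ m, 0 ≤ g j z)
    (step : ∀ j < m, ∀ x < z, ∑ y, K x y * g j y ≤ g (j + 1) x)
    {x : Fin (n + 1)} (hx : x ≤ z) : 0 ≤ g m x :=
  BDCutoff.nonneg_of_supersolution (S := Set.Iic z) h.nonneg
    (fun x hx hxz y hy => h.nearest x y (.inl (by
      have := lt_of_le_of_ne hx hxz
      simp only [Set.mem_Iic, not_le] at hy
      omega)))
    (fun x hx hxz => zero x (lt_of_le_of_ne hx hxz)) boundary
    (fun j hj x hx hxz => step j hj x (lt_of_le_of_ne hx hxz)) hx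

lemma surv_mul_sq_le {r : ℝ} (hr : 0 ≤ r) (a : ℕ) {x : Fin (n + 1)} (hx : x ≤ z) :
    surv K z a x * r ^ 2 ≤ upVar K π z x + (upMean K π z x - (a + 1 - r)) ^ 2 := by
  refine sub_nonneg.1 <| h.nonneg_of_supersolution
    (g := fun j x => upVar K π z x + (upMean K π z x - (j + 1 - r)) ^ 2 - surv K z j x * r ^ 2)
    (fun x hx => ?_) (fun j _ => ?_) (fun j _ x hx => ?_) hx
  · have one_le := h.one_le_upMean z.is_le hx
    have upVar_nonneg := h.upVar_nonneg z x
    rw [surv_zero hx.ne]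
    push_cast
    nlinarith
  · rw [surv_self, upVar_self, zero_mul, zero_add, sub_zero]
    exact sq_nonneg _
  · have second_moment := h.sum_mul_upVar_add z.is_le hx ((j + 1 : ℕ) + 1 - r)
    rw [show ((j + 1 : ℕ) : ℝ) + 1 - r - 1 = j + 1 - r by push_cast; ring] at second_moment
    have survival : ∑ y, K x y * (surv K z j y * r ^ 2) = surv K z (j + 1) x * r ^ 2 := by
      simp only [← mul_assoc, ← Finset.sum_mul, surv_succ hx.ne]
    simp only [mul_sub (K x _) (_ + _) _, Finset.sum_sub_distrib, survival]
    linarith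

lemma one_sub_surv_mul_sq_le {r : ℝ} (hr : 0 ≤ r) (a : ℕ) {x : Fin (n + 1)} (hx : x ≤ z) :
    (1 - surv K z a x) * r ^ 2 ≤ upVar K π z x + (upMean K π z x - (a + r)) ^ 2 := by
  refine sub_nonneg.1 <| h.nonneg_of_supersolution
    (g := fun j x => upVar K π z x + (upMean K π z x - (j + r)) ^ 2 - (1 - surv K z j x) * r ^ 2)
    (fun x hx => ?_) (fun j _ => ?_) (fun j _ x hx => ?_) hx
  · have upVar_nonneg := h.upVar_nonneg z x
    rw [surv_zero hx.ne, sub_self, zero_mul, sub_zero]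
    positivity
  · rw [surv_self, upVar_self, upMean_self]
    nlinarith [mul_nonneg (j.cast_nonneg : (0 : ℝ) ≤ j) hr]
  · have second_moment := h.sum_mul_upVar_add z.is_le hx ((j + 1 : ℕ) + r)
    have survival : ∑ y, K x y * ((1 - surv K z j y) * r ^ 2) =
        (1 - surv K z (j + 1) x) * r ^ 2 := by
      simp only [← mul_assoc, ← Finset.sum_mul, h.sum_mul_sub_const, surv_succ hx.ne]
    rw [show ((j + 1 : ℕ) : ℝ) + r - 1 = j + r by push_cast; ring] at second_moment
    simp only [mul_sub (K x _) (_ + _) _, Finset.sum_sub_distrib, survival]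
    linarith

lemma surv_add_le {w : Fin (n + 1)} (hzw : z ≤ w) (a b : ℕ) {x : Fin (n + 1)} (hx : x ≤ z) :
    surv K w (a + b) x ≤ surv K z a x + surv K w b z := by
  refine sub_nonneg.1 <| h.nonneg_of_supersolution
    (g := fun j x => surv K z j x + surv K w b z - surv K w (j + b) x)
    (fun x hx => ?_) (fun j _ => ?_) (fun j _ x hx => ?_) hx
  · rw [surv_zero hx.ne]
    linarith [h.surv_le_one (z := w) (0 + b) x, surv_nonneg h.nonneg (z := w) b z]
  · rw [surv_self, zero_add, sub_nonneg]
    exact h.antitone_surv z (Nat.le_add_left b j)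
  · rw [surv_succ hx.ne, add_right_comm, surv_succ (hx.trans_le hzw).ne]
    simp only [mul_add, mul_sub, Finset.sum_add_distrib, Finset.sum_sub_distrib, ← Finset.sum_mul,
      h.row_sum, one_mul, le_refl]

lemma orbit_add_surv_le_one {φ : ℕ → Fin (n + 1) → ℝ} (hφ : ∀ k, φ (k + 1) = K.mulVec (φ k))
    (hle : ∀ x, φ 0 x ≤ 1) (hzero : ∀ x < z, φ 0 x ≤ 0) (a : ℕ) {x : Fin (n + 1)} (hx : x ≤ z) :
    φ a x + surv K z a x ≤ 1 := by
  refine sub_nonneg.1 <| h.nonneg_of_supersolution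
    (g := fun j x => 1 - (φ j x + surv K z j x)) (fun x hx => ?_) (fun j _ => ?_)
    (fun j _ x hx => ?_) hx
  · rw [surv_zero hx.ne]
    linarith [hzero x hx]
  · simpa using h.orbit_le_one hφ hle j z
  · rw [h.sum_mul_sub_const, surv_succ hx.ne, hφ]
    simp only [mul_add, Finset.sum_add_distrib]
    exact le_rfl

/-- Remainder of the expansion of `u` along the killed chain, `c` being a running reward. -/
lemma sub_sum_surv_mem_Icc {c : ℕ → ℝ} {u : ℕ → Fin (n + 1) → ℝ} {D : ℝ} (hz : ∀ i, u i z = 0)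
    (hu : ∀ i, ∀ x < z, u i x = c i + ∑ y, K x y * u (i + 1) y)
    (hD : ∀ i, ∀ y ≤ z, u i y ∈ Set.Icc 0 (D * c i)) (a : ℕ) {x : Fin (n + 1)} (hx : x ≤ z) :
    u 0 x - ∑ k ∈ Finset.range a, c k * surv K z k x ∈ Set.Icc 0 (D * (c a * surv K z a x)) := by
  set R : ℕ → Fin (n + 1) → ℝ := fun j x =>
    u (a - j) x - ∑ k ∈ Finset.range j, c (a - j + k) * surv K z k x with hR
  have R_zero (x) : R 0 x = u a x := by simp [hR]
  have R_self (j) : R j z = 0 := by simp [hR, hz]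
  have R_succ {j} (hj : j < a) {x} (hx : x < z) : R (j + 1) x = ∑ y, K x y * R j y := by
    have index (k) : a - (j + 1) + (k + 1) = a - j + k := by omega
    have tail : ∑ y, K x y * ∑ k ∈ Finset.range j, c (a - j + k) * surv K z k y =
        ∑ k ∈ Finset.range j, c (a - j + k) * surv K z (k + 1) x := by
      simp only [surv_succ hx.ne, Finset.mul_sum]
      rw [Finset.sum_comm]
      exact Finset.sum_congr rfl fun _ _ => Finset.sum_congr rfl fun _ _ => mul_left_comm _ _ _
    simp only [hR, mul_sub, Finset.sum_sub_distrib, tail, Finset.sum_range_succ', surv_zero hx.ne,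
      hu _ x hx, index, add_zero]
    ring
  have at_a : R a x = u 0 x - ∑ k ∈ Finset.range a, c k * surv K z k x := by simp [hR]
  rw [← at_a]
  constructor
  · exact h.nonneg_of_supersolution (fun x hx => (R_zero x).symm ▸ (hD a x hx.le).1)
      (fun j _ => (R_self j).ge) (fun j hj x hx => (R_succ hj hx).ge) hx
  · refine sub_nonneg.1 <| h.nonneg_of_supersolution
      (g := fun j x => D * (c a * surv K z j x) - R j x) (fun x hx => ?_) (fun j _ => ?_)
      (fun j hj x hx => ?_) hx
    · rw [R_zero, surv_zero hx.ne, mul_one, sub_nonneg]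
      exact (hD a x hx.le).2
    · simp [R_self]
    · rw [R_succ hj hx, surv_succ hx.ne]
      simp only [mul_sub, Finset.sum_sub_distrib, Finset.mul_sum, mul_left_comm, le_refl]

lemma hasSum_surv {c : ℕ → ℝ} {u : ℕ → Fin (n + 1) → ℝ} {D : ℝ} (hc : ∀ i, 0 ≤ c i)
    (hz : ∀ i, u i z = 0) (hu : ∀ i, ∀ x < z, u i x = c i + ∑ y, K x y * u (i + 1) y)
    (hD : ∀ i, ∀ y ≤ z, u i y ∈ Set.Icc 0 (D * c i)) {x : Fin (n + 1)} (hx : x ≤ z) :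
    HasSum (fun k => c k * surv K z k x) (u 0 x) := by
  have remainder := fun a => h.sub_sum_surv_mem_Icc hz hu hD a hx
  have summable : Summable fun k => c k * surv K z k x :=
    summable_of_sum_range_le (c := u 0 x) (fun k => mul_nonneg (hc k) (surv_nonneg h.nonneg k x))
      fun a => sub_nonneg.1 (remainder a).1
  have bound := summable.tendsto_atTop_zero.const_mul D
  rw [mul_zero] at bound
  rw [summable.hasSum_iff_tendsto_nat]
  simpa using (tendsto_const_nhds (x := u 0 x)).sub
    (squeeze_zero (fun a => (remainder a).1) (fun a => (remainder a).2) bound)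

lemma hasSum_surv_upMean {x : Fin (n + 1)} (hx : x ≤ z) :
    HasSum (fun k => surv K z k x) (upMean K π z x) := by
  simpa using h.hasSum_surv (z := z) (c := fun _ => 1) (u := fun _ y => upMean K π z y)
    (D := upMean K π z 0) (fun _ => zero_le_one) (fun _ => upMean_self _)
    (fun _ x hx => by rw [h.sum_mul_upMean z.is_le hx]; ring)
    (fun _ y _ => ⟨h.upMean_nonneg _ _, (mul_one (upMean K π z 0)).symm ▸
      h.antitone_upMean z (Nat.zero_le y)⟩) hx

lemma upMean_le_sq {x : Fin (n + 1)} (hx : x ≤ z) : upMean K π z x ≤ upMean K π z x ^ 2 := by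
  rcases eq_or_lt_of_le hx with rfl | hx
  · simp [upMean_self]
  · exact le_self_pow₀ (h.one_le_upMean z.is_le hx) two_ne_zero

lemma sum_mul_upVar_add_linear {x : Fin (n + 1)} (hx : x < z) (i : ℝ) :
    ∑ y, K x y * (upVar K π z y - upMean K π z y + upMean K π z y ^ 2 +
        2 * (i + 1) * upMean K π z y) + (2 * i + 1) =
      upVar K π z x - upMean K π z x + upMean K π z x ^ 2 + 2 * i * upMean K π z x := by
  have mean := h.sum_mul_upMean z.is_le hx
  have second_moment := h.sum_mul_upVar_add z.is_le hx 1
  have split : ∑ y, K x y * (upVar K π z y - upMean K π z y + upMean K π z y ^ 2 +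
        2 * (i + 1) * upMean K π z y) =
      ∑ y, K x y * (upVar K π z y + (upMean K π z y - (1 - 1)) ^ 2) +
        (2 * i + 1) * ∑ y, K x y * upMean K π z y := by
    rw [Finset.mul_sum, ← Finset.sum_add_distrib]
    exact Finset.sum_congr rfl fun _ _ => by ring
  rw [split, mean, second_moment]
  ring

lemma hasSum_surv_upVar {x : Fin (n + 1)} (hx : x ≤ z) :
    HasSum (fun k : ℕ => (2 * k + 1 : ℝ) * surv K z k x)
      (upVar K π z x - upMean K π z x + upMean K π z x ^ 2) := by
  have expansion := h.hasSum_surv (z := z) (c := fun k => 2 * k + 1)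
    (u := fun k y => upVar K π z y - upMean K π z y + upMean K π z y ^ 2 + 2 * k * upMean K π z y)
    (D := upVar K π z 0 + upMean K π z 0 ^ 2 + upMean K π z 0) (fun _ => by positivity)
    (fun _ => by simp [upMean_self, upVar_self])
    (fun i x hx => by rw [← h.sum_mul_upVar_add_linear hx, add_comm]; push_cast; rfl)
    (fun i y hy => ?_) hx
  · simpa using expansion
  · have hi : (0 : ℝ) ≤ i := i.cast_nonneg
    have mean_nonneg := h.upMean_nonneg z y
    have mean_le_sq := h.upMean_le_sq hy
    have var_nonneg := h.upVar_nonneg z y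
    have mean_le : upMean K π z y ≤ upMean K π z 0 := h.antitone_upMean _ (Nat.zero_le _)
    have var_le : upVar K π z y ≤ upVar K π z 0 := h.antitone_upVar _ (Nat.zero_le _)
    constructor
    · have : 0 ≤ 2 * (i : ℝ) * upMean K π z y := by positivity
      linarith
    · calc _ ≤ upVar K π z 0 + upMean K π z 0 ^ 2 + 2 * i * upMean K π z 0 := by
            have : upMean K π z y ^ 2 ≤ upMean K π z 0 ^ 2 := by gcongr
            have : 2 * (i : ℝ) * upMean K π z y ≤ 2 * i * upMean K π z 0 := by gcongr
            linarith
        _ ≤ _ := by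
            have := h.upVar_nonneg z 0
            have := h.upMean_nonneg z 0
            nlinarith [mul_nonneg hi (h.upVar_nonneg z 0),
              mul_nonneg hi (sq_nonneg (upMean K π z 0))]

lemma mul_surv_le_upMean (a : ℕ) {x : Fin (n + 1)} (hx : x ≤ z) :
    a * surv K z a x ≤ upMean K π z x := by
  calc a * surv K z a x = ∑ _k ∈ Finset.range a, surv K z a x := by simp
    _ ≤ ∑ k ∈ Finset.range a, surv K z k x :=
      Finset.sum_le_sum fun k hk => h.antitone_surv x (Finset.mem_range.1 hk).le
    _ ≤ upMean K π z x :=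
      sum_le_hasSum _ (fun k _ => surv_nonneg h.nonneg k x) (h.hasSum_surv_upMean hx)

end IsBD

end HittingTimes

/-! ### Spectral gap and Poincaré inequality -/

section Spectral

variable {ι : Type*} [Fintype ι] {K : Matrix ι ι ℝ} {π : ι → ℝ}

lemma wInner_self_pos (hπ : ∀ x, 0 < π x) {f : ι → ℝ} (hf : f ≠ 0) : 0 < ⟪f, f⟫_[ℝ, π] := by
  obtain ⟨x, hx⟩ := Function.ne_iff.1 hf
  rw [wInner_self_eq_sum_sq]
  exact Finset.sum_pos' (fun y _ => mul_nonneg (hπ y).le (sq_nonneg _))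
    ⟨x, Finset.mem_univ x, mul_pos (hπ x) (sq_pos_of_ne_zero hx)⟩

lemma dirichlet_of_mulVec {f : ι → ℝ} {μ : ℝ} (hf : K.mulVec f = (1 - μ) • f) :
    dirichlet K π f = μ * ⟪f, f⟫_[ℝ, π] := by
  rw [dirichlet, hf, sub_smul, one_smul, sub_sub_cancel, wInner_smul_left, star_trivial,
    smul_eq_mul]

/-- The embedding `f ↦ √π f` of `L²(π)` into Euclidean space; it is isometric by
`inner_toEuclidean`. -/
def toEuclidean (π f : ι → ℝ) : EuclideanSpace ℝ ι := WithLp.toLp 2 fun x => √(π x) * f x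

/-- The matrix `√π K / √π`, which is conjugate to `K`, and symmetric if `K` is reversible. -/
def symmetrized (K : Matrix ι ι ℝ) (π : ι → ℝ) : Matrix ι ι ℝ :=
  Matrix.of fun x y => √(π x) * K x y / √(π y)

lemma inner_toEuclidean (hπ : ∀ x, 0 ≤ π x) (f g : ι → ℝ) :
    inner ℝ (toEuclidean π f) (toEuclidean π g) = ⟪f, g⟫_[ℝ, π] := by
  rw [wInner_eq_sum, PiLp.inner_apply]
  refine Finset.sum_congr rfl fun x _ => ?_
  simp only [toEuclidean, inner_apply, conj_trivial]
  linear_combination (f x * g x) * Real.mul_self_sqrt (hπ x)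

lemma symmetrized_mulVec_toEuclidean (hπ : ∀ x, 0 < π x) (f : ι → ℝ) :
    (symmetrized K π).mulVec (toEuclidean π f) = toEuclidean π (K.mulVec f) := by
  ext x
  simp only [Matrix.mulVec, dotProduct, symmetrized, toEuclidean, Matrix.of_apply, Finset.mul_sum]
  refine Finset.sum_congr rfl fun y _ => ?_
  field_simp [(Real.sqrt_pos.2 (hπ y)).ne']

namespace IsReversible

variable (h : IsReversible K π)
include h

lemma isHermitian_symmetrized (hπ : ∀ x, 0 < π x) : (symmetrized K π).IsHermitian := by
  ext x y
  simp only [symmetrized, Matrix.conjTranspose_apply, Matrix.of_apply, star_trivial]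
  rw [div_eq_div_iff (Real.sqrt_pos.2 (hπ x)).ne' (Real.sqrt_pos.2 (hπ y)).ne']
  linear_combination K y x * Real.mul_self_sqrt (hπ y).le -
    K x y * Real.mul_self_sqrt (hπ x).le - h.balance x y

lemma exists_eigenbasis (hπ : ∀ x, 0 < π x) :
    ∃ (μ : ι → ℝ) (b : ι → ι → ℝ), (∀ i, b i ≠ 0) ∧ (∀ i, K.mulVec (b i) = (1 - μ i) • b i) ∧
      ∀ f g, ⟪f, g⟫_[ℝ, π] = ∑ i, ⟪b i, f⟫_[ℝ, π] * ⟪b i, g⟫_[ℝ, π] := by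
  classical
  have hA := h.isHermitian_symmetrized hπ
  set v := hA.eigenvectorBasis
  set b : ι → ι → ℝ := fun i x => v i x / √(π x)
  have hsqrt (x : ι) : √(π x) ≠ 0 := (Real.sqrt_pos.2 (hπ x)).ne'
  have hb (i : ι) : toEuclidean π (b i) = v i := by
    ext x
    exact mul_div_cancel₀ _ (hsqrt x)
  refine ⟨fun i => 1 - hA.eigenvalues i, b, fun i hi => ?_, fun i => ?_, fun f g => ?_⟩
  · refine v.toBasis.ne_zero i ?_
    rw [v.coe_toBasis, ← hb i, hi]
    ext x
    exact mul_zero _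
  · have hv := hA.mulVec_eigenvectorBasis i
    rw [← hb i, symmetrized_mulVec_toEuclidean hπ] at hv
    ext x
    refine mul_left_cancel₀ (hsqrt x) ((congrFun hv x).trans ?_)
    simp only [toEuclidean, Pi.smul_apply, smul_eq_mul, sub_sub_cancel]
    ring
  · simp only [← inner_toEuclidean fun x => (hπ x).le, hb]
    rw [← v.sum_inner_mul_inner]
    simp only [real_inner_comm]

lemma dirichlet_eq_sum_eigenbasis {μ : ι → ℝ} {b : ι → ι → ℝ}
    (hb : ∀ i, K.mulVec (b i) = (1 - μ i) • b i)
    (hparseval : ∀ f g, ⟪f, g⟫_[ℝ, π] = ∑ i, ⟪b i, f⟫_[ℝ, π] * ⟪b i, g⟫_[ℝ, π]) (f : ι → ℝ) :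
    dirichlet K π f = ∑ i, μ i * ⟪b i, f⟫_[ℝ, π] ^ 2 := by
  rw [dirichlet, hparseval]
  refine Finset.sum_congr rfl fun i _ => ?_
  rw [wInner_sub_right, ← h.wInner_mulVec_left, hb, wInner_smul_left, star_trivial, smul_eq_mul]
  ring

lemma sum_mul_eq_zero_of_mulVec {f : ι → ℝ} {μ : ℝ} (hμ : μ ≠ 0)
    (hf : K.mulVec f = (1 - μ) • f) : ∑ x, π x * f x = 0 := by
  have hinv := h.sum_mulVec f
  simp only [hf, Pi.smul_apply, smul_eq_mul, mul_left_comm (π _), ← Finset.mul_sum] at hinv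
  refine (mul_eq_zero.1 ?_).resolve_left hμ
  linarith only [hinv]

lemma nonneg_of_mulVec (hπ : ∀ x, 0 < π x) {f : ι → ℝ} {μ : ℝ} (hf0 : f ≠ 0)
    (hf : K.mulVec f = (1 - μ) • f) : 0 ≤ μ :=
  nonneg_of_mul_nonneg_left (dirichlet_of_mulVec (π := π) hf ▸ h.dirichlet_nonneg f)
    (wInner_self_pos hπ hf0)

lemma dirichlet_sub_const (f : ι → ℝ) (a : ℝ) :
    dirichlet K π (fun x => f x - a) = dirichlet K π f := by
  simp only [h.dirichlet_eq, sub_sub_sub_cancel_right]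

lemma exists_mul_sum_sub_sq_le {lam : ℝ} (hP : Poincare K π lam) (f : ι → ℝ) :
    ∃ a : ℝ, lam * ∑ x, π x * (f x - a) ^ 2 ≤ dirichlet K π f := by
  have hvar := hP (fun x => f x - ∑ y, π y * f y) (by
    simp only [mul_sub, Finset.sum_sub_distrib, ← Finset.sum_mul, h.weight_sum]; ring)
  rw [h.dirichlet_sub_const, wInner_self_eq_sum_sq] at hvar
  exact ⟨_, hvar⟩

end IsReversible

section Eigenvalues

variable [DecidableEq ι]

lemma hasEigenvalue_of_mulVec {f : ι → ℝ} {μ : ℝ} (hf0 : f ≠ 0)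
    (hf : K.mulVec f = (1 - μ) • f) : Module.End.HasEigenvalue (Matrix.toLin' (1 - K)) μ := by
  refine Module.End.hasEigenvalue_of_hasEigenvector (x := f) ⟨?_, hf0⟩
  rw [Module.End.mem_eigenspace_iff, Matrix.toLin'_apply, Matrix.sub_mulVec, Matrix.one_mulVec,
    hf, sub_smul, one_smul, sub_sub_cancel]

lemma exists_mulVec_of_hasEigenvalue {μ : ℝ}
    (hμ : Module.End.HasEigenvalue (Matrix.toLin' (1 - K)) μ) :
    ∃ f : ι → ℝ, f ≠ 0 ∧ K.mulVec f = (1 - μ) • f := by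
  obtain ⟨f, hf, hf0⟩ := hμ.exists_hasEigenvector
  rw [Module.End.mem_eigenspace_iff, Matrix.toLin'_apply, Matrix.sub_mulVec,
    Matrix.one_mulVec] at hf
  exact ⟨f, hf0, by rw [sub_smul, one_smul, ← hf, sub_sub_cancel]⟩

end Eigenvalues

variable {n : ℕ} {K : Matrix (Fin (n + 1)) (Fin (n + 1)) ℝ} {π : Fin (n + 1) → ℝ}

lemma finite_eigenvalues (K : Matrix (Fin (n + 1)) (Fin (n + 1)) ℝ) :
    {μ : ℝ | μ ≠ 0 ∧ Module.End.HasEigenvalue (Matrix.toLin' (1 - K)) μ}.Finite := by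
  have hfin : Set.Finite (Module.End.HasEigenvalue (Matrix.toLin' (1 - K))) :=
    Module.End.finite_hasEigenvalue _
  refine hfin.subset fun μ hμ => ?_
  rw [Set.mem_ofPred_eq] at hμ
  exact hμ.2

lemma spectralGap_mem
    (hne : ∃ μ : ℝ, μ ≠ 0 ∧ Module.End.HasEigenvalue (Matrix.toLin' (1 - K)) μ) :
    spectralGap K ≠ 0 ∧ Module.End.HasEigenvalue (Matrix.toLin' (1 - K)) (spectralGap K) :=
  Set.Nonempty.csInf_mem hne (finite_eigenvalues K)

lemma spectralGap_le {μ : ℝ} (hμ0 : μ ≠ 0)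
    (hμ : Module.End.HasEigenvalue (Matrix.toLin' (1 - K)) μ) : spectralGap K ≤ μ :=
  csInf_le (finite_eigenvalues K).bddBelow ⟨hμ0, hμ⟩

namespace IsBD

variable (h : IsBD K π)
include h

lemma dirichlet_comp_val (f : ℕ → ℝ) :
    dirichlet K π (fun x => f x) =
      ∑ k ∈ Finset.range n, cond K π k * (f k - f (k + 1)) ^ 2 := by
  have hgen (x : Fin (n + 1)) : π x * ((f x - ∑ j, K x j * f j) * f x) =
      π x * (f x * (up K x * (f x - f (x + 1)) +
        if (x : ℕ) = 0 then 0 else down K (x - 1) * (f x - f (x - 1)))) := by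
    rw [h.sum_mul_eq]; split_ifs <;> ring
  have hlast : up K n = 0 := by simp [up]
  calc dirichlet K π (fun x => f x)
      = ∑ x : Fin (n + 1), π x * ((f x - ∑ j, K x j * f j) * f x) := wInner_eq_sum ..
    _ = ∑ k ∈ Finset.range (n + 1), (wt π k * (f k * (up K k * (f k - f (k + 1)))) +
          wt π k * (f k * if k = 0 then 0 else down K (k - 1) * (f k - f (k - 1)))) := by
        simp only [hgen, ← mul_add]
        exact (sum_range_wt fun k => f k * (up K k * (f k - f (k + 1)) +
          if k = 0 then 0 else down K (k - 1) * (f k - f (k - 1)))).symm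
    _ = ∑ k ∈ Finset.range n, (wt π k * (f k * (up K k * (f k - f (k + 1)))) +
          wt π (k + 1) * (f (k + 1) * (down K k * (f (k + 1) - f k)))) := by
        rw [Finset.sum_add_distrib, Finset.sum_range_succ, Finset.sum_range_succ']
        simp only [hlast, zero_mul, mul_zero, add_zero, if_true, Nat.add_eq_zero_iff, one_ne_zero,
          and_false, if_false, Nat.add_sub_cancel, Finset.sum_add_distrib]
    _ = ∑ k ∈ Finset.range n, cond K π k * (f k - f (k + 1)) ^ 2 := by
        refine Finset.sum_congr rfl fun k _ => ?_
        have hcond := h.cond_eq k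
        rw [cond] at hcond ⊢
        linear_combination (f (k + 1) * (f k - f (k + 1))) * hcond

lemma dirichlet_eq_sum_cond (f : Fin (n + 1) → ℝ) :
    dirichlet K π f =
      ∑ k ∈ Finset.range n, cond K π k * (wt f k - wt f (k + 1)) ^ 2 := by
  simp only [← h.dirichlet_comp_val, wt_coe]

lemma eq_apply_zero_of_dirichlet_eq_zero {f : Fin (n + 1) → ℝ} (hf : dirichlet K π f = 0)
    (x : Fin (n + 1)) : f x = f 0 := by
  rw [h.dirichlet_eq_sum_cond, Finset.sum_eq_zero_iff_of_nonneg
    fun k _ => mul_nonneg (h.cond_nonneg k) (sq_nonneg _)] at hf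
  have hstep (k : ℕ) (hk : k < n) : wt f (k + 1) = wt f k := by
    have hedge := (mul_eq_zero.1 (hf k (Finset.mem_range.2 hk))).resolve_left (h.cond_pos hk).ne'
    exact (sub_eq_zero.1 (sq_eq_zero_iff.1 hedge)).symm
  have hconst : ∀ k ≤ n, wt f k = wt f 0 := fun k => by
    induction k with
    | zero => exact fun _ => rfl
    | succ k ih => exact fun hk => (hstep k hk).trans (ih (by omega))
  simpa only [wt_coe] using (hconst x x.is_le).trans (wt_coe (π := f) 0)

lemma exists_eigenvalue_ne_zero (hn : 1 ≤ n) :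
    ∃ μ : ℝ, μ ≠ 0 ∧ Module.End.HasEigenvalue (Matrix.toLin' (1 - K)) μ := by
  obtain ⟨μ, b, hb0, hb, hparseval⟩ := h.exists_eigenbasis h.weight_pos
  by_contra! hne
  have hμ (i : Fin (n + 1)) : μ i = 0 := by_contra fun hi =>
    hne _ hi (hasEigenvalue_of_mulVec (hb0 i) (hb i))
  have hconst := h.eq_apply_zero_of_dirichlet_eq_zero (f := Pi.single 0 1)
    (by simp only [h.dirichlet_eq_sum_eigenbasis hb hparseval, hμ, zero_mul, Finset.sum_const_zero])
    (Fin.last n)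
  have hlast : Fin.last n ≠ 0 := fun hl => by
    rw [Fin.ext_iff, Fin.val_last, Fin.val_zero] at hl
    omega
  rw [Pi.single_eq_of_ne hlast, Pi.single_eq_same] at hconst
  exact zero_ne_one hconst

lemma exists_spectralGap_eigenfunction (hn : 1 ≤ n) :
    ∃ f : Fin (n + 1) → ℝ, f ≠ 0 ∧ ∑ x, π x * f x = 0 ∧
      K.mulVec f = (1 - spectralGap K) • f := by
  obtain ⟨hne, hev⟩ := spectralGap_mem (h.exists_eigenvalue_ne_zero hn)
  obtain ⟨f, hf0, hKf⟩ := exists_mulVec_of_hasEigenvalue hev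
  exact ⟨f, hf0, h.sum_mul_eq_zero_of_mulVec hne hKf, hKf⟩

lemma spectralGap_pos (hn : 1 ≤ n) : 0 < spectralGap K := by
  obtain ⟨hne, hev⟩ := spectralGap_mem (h.exists_eigenvalue_ne_zero hn)
  obtain ⟨f, hf0, hKf⟩ := exists_mulVec_of_hasEigenvalue hev
  exact (h.nonneg_of_mulVec h.weight_pos hf0 hKf).lt_of_ne' hne

lemma poincare_spectralGap : Poincare K π (spectralGap K) := fun f hf => by
  obtain ⟨μ, b, hb0, hb, hparseval⟩ := h.exists_eigenbasis h.weight_pos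
  simp only [h.dirichlet_eq_sum_eigenbasis hb hparseval, hparseval f f, Finset.mul_sum, ← sq]
  refine Finset.sum_le_sum fun i _ => ?_
  by_cases hi : μ i = 0
  · have hconst (x : Fin (n + 1)) : b i x = b i 0 := h.eq_apply_zero_of_dirichlet_eq_zero
      (by rw [dirichlet_of_mulVec (hb i), hi, zero_mul]) x
    have horth : ⟪b i, f⟫_[ℝ, π] = 0 := by
      simp only [wInner_eq_sum, hconst, mul_left_comm (π _), ← Finset.mul_sum, hf, mul_zero]
    simp only [horth, zero_pow two_ne_zero, mul_zero, le_refl]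
  · exact mul_le_mul_of_nonneg_right
      (spectralGap_le hi (hasEigenvalue_of_mulVec (hb0 i) (hb i))) (sq_nonneg _)

end IsBD

end Spectral

/-! ### Resistance and Hardy's inequality -/

section Capacity

variable {n : ℕ} {K : Matrix (Fin (n + 1)) (Fin (n + 1)) ℝ} {π : Fin (n + 1) → ℝ}

/-- The weight of `[k, n]`. -/
def tailWt (π : Fin (n + 1) → ℝ) (k : ℕ) : ℝ := ∑ i ∈ Finset.Ico k (n + 1), wt π i

/-- The effective resistance between `a` and `b`; it is `0` for `b ≤ a`. -/
def resist (K : Matrix (Fin (n + 1)) (Fin (n + 1)) ℝ) (π : Fin (n + 1) → ℝ) (a b : ℕ) : ℝ :=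
  ∑ i ∈ Finset.Ico a b, 1 / cond K π i

lemma resist_eq_zero {a b : ℕ} (hab : b ≤ a) : resist K π a b = 0 := by
  rw [resist, Finset.Ico_eq_empty_of_le hab, Finset.sum_empty]

lemma resist_eq_add {a b : ℕ} (hab : a < b) :
    resist K π a b = 1 / cond K π a + resist K π (a + 1) b := Finset.sum_eq_sum_Ico_succ_bot hab _

lemma resist_succ_right {a b : ℕ} (hab : a ≤ b) :
    resist K π a (b + 1) = resist K π a b + 1 / cond K π b := Finset.sum_Ico_succ_top hab _

lemma upVar_zero_succ (M : ℕ) :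
    upVar K π (M + 1) 0 = upVar K π M 0 + passVar K π M :=
  Finset.sum_Ico_succ_top (Nat.zero_le M) _

lemma upVar_zero_eq_sum_resist (M : ℕ) : upVar K π M 0 =
    ∑ y ∈ Finset.range M, cond K π y * passMean K π y ^ 2 *
      (2 * resist K π y M - 1 / cond K π y) := by
  induction M with
  | zero => rw [upVar_self, Finset.sum_range_zero]
  | succ M ih =>
    have hsum : ∑ y ∈ Finset.range (M + 1), cond K π y * passMean K π y ^ 2 *
          (2 * resist K π y (M + 1) - 1 / cond K π y) =
        ∑ y ∈ Finset.range (M + 1), (cond K π y * passMean K π y ^ 2 *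
          (2 * resist K π y M - 1 / cond K π y) +
            2 * (cond K π y * passMean K π y ^ 2) / cond K π M) :=
      Finset.sum_congr rfl fun y hy => by
        rw [resist_succ_right (Nat.lt_succ_iff.1 (Finset.mem_range.1 hy))]; ring
    rw [hsum, Finset.sum_add_distrib, Finset.sum_range_succ, ← ih, resist_eq_zero le_rfl,
      ← Finset.sum_div, ← Finset.mul_sum, Finset.sum_range_succ, upVar_zero_succ, passVar]
    ring

/-- Compares the variance of a function equal to `R` on mass `S` and to `0` on mass `T` with
`S T R ^ 2`. -/
lemma mul_mul_sq_le_add {S T : ℝ} (hS : 0 ≤ S) (hT : 0 ≤ T) (hST : S + T ≤ 1) (R m : ℝ) :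
    S * T * R ^ 2 ≤ S * (R - m) ^ 2 + T * m ^ 2 := by
  nlinarith [sq_nonneg (S * (R - m) - T * m),
    mul_nonneg (sub_nonneg.2 hST) (mul_nonneg hS (sq_nonneg (R - m))),
    mul_nonneg (sub_nonneg.2 hST) (mul_nonneg hT (sq_nonneg m))]

lemma sum_mul_sq_eq_sum_sum_min (w : ℕ → ℝ) {f : ℕ → ℝ} {M : ℕ} (hf : f M = 0) :
    ∑ x ∈ Finset.range M, w x * f x ^ 2 = ∑ k ∈ Finset.range M, ∑ l ∈ Finset.range M,
      (∑ x ∈ Finset.range (min k l + 1), w x) * ((f k - f (k + 1)) * (f l - f (l + 1))) := by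
  have htele (x : ℕ) (hx : x ∈ Finset.range M) :
      f x = ∑ k ∈ Finset.range M, if x ≤ k then f k - f (k + 1) else 0 := by
    have hIco : Finset.filter (fun k => x ≤ k) (Finset.range M) = Finset.Ico x M := by
      ext k
      simp only [Finset.mem_filter, Finset.mem_range, Finset.mem_Ico]
      omega
    rw [← Finset.sum_filter, hIco, sum_Ico_sub_succ _ (Finset.mem_range.1 hx).le, hf, sub_zero]
  have hsq (x : ℕ) (hx : x ∈ Finset.range M) : w x * f x ^ 2 = ∑ k ∈ Finset.range M,
      ∑ l ∈ Finset.range M,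
        if x ≤ min k l then w x * ((f k - f (k + 1)) * (f l - f (l + 1))) else 0 := by
    rw [sq]
    nth_rw 1 2 [htele x hx]
    rw [Finset.sum_mul_sum, Finset.mul_sum]
    refine Finset.sum_congr rfl fun k _ => ?_
    rw [Finset.mul_sum]
    refine Finset.sum_congr rfl fun l _ => ?_
    by_cases hk : x ≤ k <;> by_cases hl : x ≤ l <;> simp [hk, hl]
  rw [Finset.sum_congr rfl hsq, Finset.sum_comm]
  refine Finset.sum_congr rfl fun k hk => ?_
  rw [Finset.sum_comm]
  refine Finset.sum_congr rfl fun l _ => ?_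
  rw [← Finset.sum_filter, ← Finset.sum_mul]
  congr 2
  ext x
  simp only [Finset.mem_filter, Finset.mem_range] at hk ⊢
  omega

namespace IsBD

variable (h : IsBD K π)
include h

lemma tailWt_nonneg (k : ℕ) : 0 ≤ tailWt π k := Finset.sum_nonneg fun i _ => h.wt_nonneg i

lemma cum_add_tailWt_le {a b : ℕ} (hab : a < b) (hb : b ≤ n) : cum π a + tailWt π b ≤ 1 := by
  rw [← h.cum_last, cum, tailWt, cum, ← Finset.sum_range_add_sum_Ico _ (by omega : b ≤ n + 1)]
  gcongr
  · exact fun i _ _ => h.wt_nonneg i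
  · omega

lemma cum_mul_tailWt_mul_sq_le {a b : ℕ} (hab : a < b) (hb : b ≤ n) {f : ℕ → ℝ} {R : ℝ}
    (hfa : ∀ k ≤ a, f k = R) (hfb : ∀ k, b ≤ k → f k = 0) (m : ℝ) :
    cum π a * tailWt π b * R ^ 2 ≤ ∑ x : Fin (n + 1), π x * (f x - m) ^ 2 := by
  have hleft : cum π a * (R - m) ^ 2 ≤ ∑ k ∈ Finset.range b, wt π k * (f k - m) ^ 2 := by
    rw [cum, Finset.sum_mul]
    refine le_trans (le_of_eq (Finset.sum_congr rfl fun k hk => ?_))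
      (Finset.sum_le_sum_of_subset_of_nonneg (Finset.range_mono (by omega : a + 1 ≤ b))
        fun i _ _ => mul_nonneg (h.wt_nonneg i) (sq_nonneg _))
    rw [hfa k (Nat.lt_succ_iff.1 (Finset.mem_range.1 hk))]
  have hright : tailWt π b * m ^ 2 = ∑ k ∈ Finset.Ico b (n + 1), wt π k * (f k - m) ^ 2 := by
    rw [tailWt, Finset.sum_mul]
    exact Finset.sum_congr rfl fun k hk => by rw [hfb k (Finset.mem_Ico.1 hk).1]; ring
  rw [← sum_range_wt (fun k => (f k - m) ^ 2),
    ← Finset.sum_range_add_sum_Ico _ (by omega : b ≤ n + 1), ← hright]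
  exact (mul_mul_sq_le_add (h.cum_nonneg a) (h.tailWt_nonneg b) (h.cum_add_tailWt_le hab hb)
    R m).trans (by gcongr)

lemma dirichlet_resist {a b : ℕ} (hb : b ≤ n) :
    dirichlet K π (fun x => resist K π (max x a) b) = resist K π a b := by
  rw [h.dirichlet_comp_val (fun k => resist K π (max k a) b),
    ← Finset.sum_subset (s₁ := Finset.Ico a b) (s₂ := Finset.range n)]
  · refine Finset.sum_congr rfl fun k hk => ?_
    obtain ⟨hak, hkb⟩ := Finset.mem_Ico.1 hk
    have hc := h.cond_pos (by omega : k < n)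
    rw [max_eq_left hak, max_eq_left (by omega), resist_eq_add hkb, add_sub_cancel_right]
    field_simp
  · exact fun k hk => Finset.mem_range.2 ((Finset.mem_Ico.1 hk).2.trans_le hb)
  · intro k _ hk
    rw [Finset.mem_Ico, not_and, not_lt] at hk
    rcases le_or_gt a k with hak | hak
    · have hbk := hk hak
      rw [resist_eq_zero (hbk.trans (le_max_left _ _)),
        resist_eq_zero (by omega : b ≤ max (k + 1) a)]
      ring
    · rw [max_eq_right hak.le, max_eq_right (by omega)]
      ring

lemma mul_resist_le {lam : ℝ} (hlam : 0 ≤ lam) (hP : Poincare K π lam) {a b : ℕ} (hab : a ≤ b)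
    (hb : b ≤ n) : lam * (cum π a * tailWt π b * resist K π a b) ≤ 1 := by
  rcases hab.eq_or_lt with rfl | hab
  · rw [resist_eq_zero le_rfl, mul_zero, mul_zero]
    exact zero_le_one
  have hR : 0 < resist K π a b := Finset.sum_pos
    (fun i hi => one_div_pos.2 (h.cond_pos ((Finset.mem_Ico.1 hi).2.trans_le hb)))
    (Finset.nonempty_Ico.2 hab)
  obtain ⟨m, hm⟩ := h.exists_mul_sum_sub_sq_le hP fun x => resist K π (max x a) b
  rw [h.dirichlet_resist hb] at hm
  have hvar := h.cum_mul_tailWt_mul_sq_le hab hb (f := fun k => resist K π (max k a) b)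
    (fun k hk => by rw [max_eq_right hk])
    (fun k hk => resist_eq_zero (hk.trans (le_max_left _ _))) m
  refine le_of_mul_le_mul_right ?_ hR
  calc lam * (cum π a * tailWt π b * resist K π a b) * resist K π a b
      = lam * (cum π a * tailWt π b * resist K π a b ^ 2) := by ring
    _ ≤ 1 * resist K π a b := by
        rw [one_mul]
        exact (mul_le_mul_of_nonneg_left hvar hlam).trans hm

lemma mul_upVar_le {lam : ℝ} (hlam : 0 ≤ lam) (hP : Poincare K π lam) {M : ℕ} (hM : M ≤ n) :
    lam * tailWt π M * upVar K π M 0 ≤ 2 * upMean K π M 0 := by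
  rw [upVar_zero_eq_sum_resist, upMean, ← Finset.range_eq_Ico, Finset.mul_sum, Finset.mul_sum]
  refine Finset.sum_le_sum fun y hy => ?_
  have hyM := Finset.mem_range.1 hy
  have hpass := h.passMean_nonneg y
  have hcond := h.cond_pos (hyM.trans_le hM)
  have htail := h.tailWt_nonneg M
  have hcum : cond K π y * passMean K π y = cum π y := mul_div_cancel₀ _ hcond.ne'
  calc lam * tailWt π M * (cond K π y * passMean K π y ^ 2 *
        (2 * resist K π y M - 1 / cond K π y))
      ≤ lam * tailWt π M * (cond K π y * passMean K π y ^ 2 * (2 * resist K π y M)) := by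
        gcongr
        exact sub_le_self _ (one_div_pos.2 hcond).le
    _ = 2 * passMean K π y * (lam * (cum π y * tailWt π M * resist K π y M)) := by
        rw [← hcum]; ring
    _ ≤ 2 * passMean K π y :=
        mul_le_of_le_one_right (by positivity) (h.mul_resist_le hlam hP hyM.le hM)

lemma mul_upMean_le {lam : ℝ} (hlam : 0 ≤ lam) (hP : Poincare K π lam) {a b : ℕ} (hab : a ≤ b)
    (hb : b ≤ n) : lam * cum π a * tailWt π b * upMean K π b a ≤ 1 := by
  have hle : upMean K π b a ≤ resist K π a b := Finset.sum_le_sum fun i hi =>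
    div_le_div_of_nonneg_right (h.cum_le_one ((Finset.mem_Ico.1 hi).2.le.trans hb))
      (h.cond_nonneg i)
  have hcum := h.cum_nonneg a
  have htail := h.tailWt_nonneg b
  calc lam * cum π a * tailWt π b * upMean K π b a
      ≤ lam * cum π a * tailWt π b * resist K π a b := by gcongr
    _ = lam * (cum π a * tailWt π b * resist K π a b) := by ring
    _ ≤ 1 := h.mul_resist_le hlam hP hab hb

lemma passMean_sq_le_passVar {k : ℕ} (hk : k < n) : passMean K π k ^ 2 ≤ passVar K π k := by
  rw [passVar, le_div_iff₀ (h.cond_pos hk), mul_comm]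
  have hsum : 0 ≤ ∑ y ∈ Finset.range k, cond K π y * passMean K π y ^ 2 :=
    Finset.sum_nonneg fun y _ => mul_nonneg (h.cond_nonneg y) (sq_nonneg _)
  linarith

lemma upMean_le_mul_upVar {δ : ℝ} (hδ : ∀ x, δ ≤ K x x) {M : ℕ} (hM : M ≤ n) (k : ℕ) :
    upMean K π M k ≤ (1 - δ) * upVar K π M k := by
  rw [upVar, Finset.mul_sum]
  refine Finset.sum_le_sum fun i hi => ?_
  have hin : i < n := (Finset.mem_Ico.1 hi).2.trans_le hM
  have hup : up K i ≤ 1 - δ := by linarith only [h.up_add_le i hin, hδ ⟨i, by omega⟩]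
  have hmean := h.passMean_nonneg i
  calc passMean K π i
      = 1 * passMean K π i := (one_mul _).symm
    _ ≤ up K i * passMean K π i * passMean K π i := by
        gcongr
        exact h.one_le_mul_passMean hin
    _ = up K i * passMean K π i ^ 2 := by ring
    _ ≤ (1 - δ) * passVar K π i := mul_le_mul hup (h.passMean_sq_le_passVar hin) (sq_nonneg _)
        ((h.up_nonneg i).trans hup)

lemma upMean_le_upVar {M : ℕ} (hM : M ≤ n) (k : ℕ) : upMean K π M k ≤ upVar K π M k := by
  simpa only [sub_zero, one_mul] using h.upMean_le_mul_upVar (fun x => h.nonneg x x) hM k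

lemma sum_sum_cum_min_sq_div {M : ℕ} (hM : M ≤ n) :
    ∑ k ∈ Finset.range M, ∑ l ∈ Finset.range M,
      cum π (min k l) ^ 2 / (cond K π k * cond K π l) = upVar K π M 0 := by
  induction M with
  | zero => rw [upVar_self, Finset.sum_range_zero]
  | succ M ih =>
    have hcondM := h.cond_pos (by omega : M < n)
    have hcol : ∑ k ∈ Finset.range M, cum π (min k M) ^ 2 / (cond K π k * cond K π M) =
        (∑ y ∈ Finset.range M, cond K π y * passMean K π y ^ 2) / cond K π M := by
      rw [Finset.sum_div]
      refine Finset.sum_congr rfl fun k hk => ?_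
      have hkM := Finset.mem_range.1 hk
      have hcond := h.cond_pos (by omega : k < n)
      rw [min_eq_left hkM.le, passMean]
      field_simp
    have hrow : ∑ k ∈ Finset.range M, cum π (min M k) ^ 2 / (cond K π M * cond K π k) =
        (∑ y ∈ Finset.range M, cond K π y * passMean K π y ^ 2) / cond K π M := by
      rw [← hcol]
      exact Finset.sum_congr rfl fun k _ => by rw [min_comm, mul_comm (cond K π M)]
    have hdiag : cum π M ^ 2 / (cond K π M * cond K π M) =
        cond K π M * passMean K π M ^ 2 / cond K π M := by
      rw [passMean]
      field_simp
    rw [Finset.sum_range_succ, Finset.sum_congr rfl fun k _ => Finset.sum_range_succ _ _,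
      Finset.sum_add_distrib, ih (by omega), Finset.sum_range_succ, upVar_zero_succ, hcol, hrow,
      min_self, hdiag, passVar]
    ring

/-- The constant is the squared Hilbert–Schmidt norm of the Green kernel `cum π (min k l)` on the
edges of `[0, M]`, hence the square on both sides. -/
lemma hardy {M : ℕ} (hM : M ≤ n) {f : ℕ → ℝ} (hf : f M = 0) :
    (∑ x ∈ Finset.range M, wt π x * f x ^ 2) ^ 2 ≤ upVar K π M 0 *
      (∑ k ∈ Finset.range M, cond K π k * (f k - f (k + 1)) ^ 2) ^ 2 := by
  rw [sum_mul_sq_eq_sum_sum_min _ hf, ← h.sum_sum_cum_min_sq_div hM,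
    sq (∑ k ∈ Finset.range M, cond K π k * (f k - f (k + 1)) ^ 2), Finset.sum_mul_sum]
  simp only [← Finset.sum_product']
  refine Finset.sum_sq_le_sum_mul_sum_of_sq_le_mul _
    (fun p _ => div_nonneg (sq_nonneg _) (mul_nonneg (h.cond_nonneg _) (h.cond_nonneg _)))
    (fun p _ => mul_nonneg (mul_nonneg (h.cond_nonneg _) (sq_nonneg _))
      (mul_nonneg (h.cond_nonneg _) (sq_nonneg _))) fun p hp => le_of_eq ?_
  rw [Finset.mem_product, Finset.mem_range, Finset.mem_range] at hp
  have hcond₁ := h.cond_pos (hp.1.trans_le hM)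
  have hcond₂ := h.cond_pos (hp.2.trans_le hM)
  rw [← cum]
  field_simp

end IsBD

end Capacity

/-! ### Irreducible, reflected and half-lazy chains -/

section Constructions

variable {n : ℕ} {K : Matrix (Fin (n + 1)) (Fin (n + 1)) ℝ} {π : Fin (n + 1) → ℝ}

namespace BirthDeathChain

variable (C : BirthDeathChain n)

lemma mem_rowStochastic : C.K ∈ Matrix.rowStochastic ℝ (Fin (n + 1)) :=
  Matrix.mem_rowStochastic_iff_sum.2 ⟨C.nonneg, C.row_sum⟩

lemma exists_pow_pos (i j : Fin (n + 1)) : ∃ k, 0 < (C.K ^ k) i j :=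
  have ⟨k, _, hk⟩ := (Matrix.isIrreducible_iff_exists_pow_pos C.nonneg).1 C.irreducible i j
  ⟨k, hk⟩

/-- Without the birth `i → i + 1` the matrix and its powers would be block triangular. -/
lemma succ_pos (i : Fin n) : 0 < C.K i.castSucc i.succ := by
  refine (C.nonneg _ _).lt_of_ne' fun hi => ?_
  have hblock : C.K.BlockTriangular fun x => decide (x ≤ i.castSucc) := fun a b hab => by
    obtain ⟨hb, ha⟩ : i.castSucc < b ∧ a ≤ i.castSucc := by
      simpa only [Bool.lt_iff, decide_eq_false_iff_not, decide_eq_true_eq, not_le] using hab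
    by_cases hedge : a = i.castSucc ∧ b = i.succ
    · rw [hedge.1, hedge.2, hi]
    · refine C.nearest a b (Or.inl ?_)
      simp only [Fin.ext_iff, Fin.le_def, Fin.lt_def, Fin.val_castSucc, Fin.val_succ] at *
      omega
  obtain ⟨k, hk⟩ := C.exists_pow_pos i.castSucc i.succ
  refine hk.ne' (hblock.pow k ?_)
  simp only [le_refl, decide_true, Bool.lt_iff, decide_eq_false_iff_not, not_le,
    Fin.castSucc_lt_succ, and_self]

end BirthDeathChain

lemma IsStationary.vecMul_pow (hπ : IsStationary K π) (k : ℕ) : Matrix.vecMul π (K ^ k) = π := by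
  induction k with
  | zero => rw [pow_zero, Matrix.vecMul_one]
  | succ k ih => rw [pow_succ, ← Matrix.vecMul_vecMul, ih, hπ.stationary]

lemma IsStationary.pos {C : BirthDeathChain n} (hπ : IsStationary C.K π) (x : Fin (n + 1)) :
    0 < π x := by
  obtain ⟨y, hy⟩ : ∃ y, 0 < π y := by
    by_contra! hle
    exact (zero_lt_one.trans_eq hπ.sum_one.symm).not_ge (Finset.sum_nonpos fun y _ => hle y)
  obtain ⟨k, hk⟩ := C.exists_pow_pos y x
  rw [← hπ.vecMul_pow k]
  exact (mul_pos hy hk).trans_le (Finset.single_le_sum (f := fun i => π i * (C.K ^ k) i x)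
    (fun i _ => mul_nonneg (hπ.nonneg i)
      (Matrix.nonneg_of_mem_rowStochastic (pow_mem C.mem_rowStochastic k))) (Finset.mem_univ y))

lemma eq_zero_of_antisymm_of_tridiagonal {J : Fin (n + 1) → Fin (n + 1) → ℝ}
    (hanti : ∀ x y, J y x = -J x y) (hnear : ∀ x y : Fin (n + 1), (x : ℕ) + 1 < y → J x y = 0)
    (hsum : ∀ x, ∑ y, J x y = 0) (x y : Fin (n + 1)) : J x y = 0 := by
  induction x using WellFoundedLT.induction generalizing y with
  | ind x ih =>
  have hother (z : Fin (n + 1)) (hz : (z : ℕ) ≠ x + 1) : J x z = 0 := by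
    rcases lt_trichotomy z x with hzx | rfl | hxz
    · rw [hanti z x, ih z hzx, neg_zero]
    · exact self_eq_neg.1 (hanti z z)
    · exact hnear x z (by rw [Fin.lt_def] at hxz; omega)
  by_cases hy : (y : ℕ) = x + 1
  · rw [← hsum x, Finset.sum_eq_single y]
    · exact fun z _ hzy => hother z fun hz => hzy (Fin.ext (hz.trans hy.symm))
    · exact fun hmem => absurd (Finset.mem_univ y) hmem
  · exact hother y hy

/-- Reversibility: the stationary flux across each edge vanishes. -/
lemma BirthDeathChain.balance (C : BirthDeathChain n) (hπ : IsStationary C.K π)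
    (x y : Fin (n + 1)) : π x * C.K x y = π y * C.K y x := by
  refine sub_eq_zero.1 (eq_zero_of_antisymm_of_tridiagonal
    (J := fun x y => π x * C.K x y - π y * C.K y x) (fun x y => (neg_sub _ _).symm)
    (fun x y hxy => ?_) (fun x => ?_) x y)
  · rw [C.nearest x y (Or.inl hxy), C.nearest y x (Or.inr hxy), mul_zero, mul_zero, sub_zero]
  · have hx : ∑ y, π y * C.K y x = π x := congrFun hπ.stationary x
    rw [Finset.sum_sub_distrib, hx, ← Finset.mul_sum, C.row_sum, mul_one, sub_self]

lemma BirthDeathChain.isBD (C : BirthDeathChain n) (hπ : IsStationary C.K π) : IsBD C.K π where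
  nonneg := C.nonneg
  row_sum := C.row_sum
  weight_nonneg := hπ.nonneg
  weight_sum := hπ.sum_one
  balance := C.balance hπ
  weight_pos := hπ.pos
  nearest := C.nearest
  succ_pos := C.succ_pos

/-- The weights of the reflected chain. -/
def revW (π : Fin (n + 1) → ℝ) : Fin (n + 1) → ℝ := π ∘ Fin.rev

/-- The matrix of the half-lazy chain. -/
def halfK (K : Matrix (Fin (n + 1)) (Fin (n + 1)) ℝ) : Matrix (Fin (n + 1)) (Fin (n + 1)) ℝ :=
  (1 / 2 : ℝ) • (1 + K)

lemma revW_apply (x : Fin (n + 1)) : revW π x = π x.rev := rfl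

lemma revK_revK : revK (revK K) = K := by
  ext x y
  simp only [revK_apply, Fin.rev_rev]

lemma revW_revW : revW (revW π) = π := by
  ext x
  simp only [revW_apply, Fin.rev_rev]

lemma sum_rev (f : Fin (n + 1) → ℝ) : ∑ x : Fin (n + 1), f x.rev = ∑ x, f x :=
  Equiv.sum_comp Fin.revPerm f

lemma revK_pow (m : ℕ) : revK K ^ m = revK (K ^ m) := by
  induction m with
  | zero => exact (Matrix.submatrix_one_equiv Fin.revPerm).symm
  | succ m ih =>
    rw [pow_succ, pow_succ, ih]
    exact Matrix.submatrix_mul_equiv (K ^ m) K Fin.rev Fin.revPerm Fin.rev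

lemma revK_mulVec (f : Fin (n + 1) → ℝ) :
    (revK K).mulVec (f ∘ Fin.rev) = K.mulVec f ∘ Fin.rev := by
  ext x
  exact sum_rev fun y => K x.rev y * f y

lemma wInner_rev (f g : Fin (n + 1) → ℝ) :
    ⟪f ∘ Fin.rev, g ∘ Fin.rev⟫_[ℝ, revW π] = ⟪f, g⟫_[ℝ, π] := by
  rw [wInner_eq_sum, wInner_eq_sum, ← sum_rev fun x => π x * (f x * g x)]
  rfl

lemma dirichlet_rev (f : Fin (n + 1) → ℝ) :
    dirichlet (revK K) (revW π) (f ∘ Fin.rev) = dirichlet K π f := by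
  rw [dirichlet, revK_mulVec]
  exact wInner_rev (f - K.mulVec f) f

lemma Poincare.rev {lam : ℝ} (hP : Poincare K π lam) : Poincare (revK K) (revW π) lam := by
  intro f hf
  obtain ⟨g, rfl⟩ : ∃ g, f = g ∘ Fin.rev := ⟨f ∘ Fin.rev, by ext x; simp⟩
  rw [wInner_rev, dirichlet_rev]
  exact hP g ((sum_rev fun x => π x * g x).symm.trans hf)

lemma wt_rev {k : ℕ} (hk : k ≤ n) : wt (revW π) k = wt π (n - k) := by
  rw [wt, wt, dif_pos (by omega), dif_pos (by omega), revW_apply]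
  congr 1
  ext
  simp only [Fin.val_rev, Nat.add_sub_add_right]

lemma halfK_apply (x y : Fin (n + 1)) :
    halfK K x y = (if x = y then 1 / 2 else 0) + K x y / 2 := by
  rw [halfK, Matrix.smul_apply, Matrix.add_apply, Matrix.one_apply, smul_eq_mul]
  split_ifs <;> ring

lemma halfK_apply_of_ne {x y : Fin (n + 1)} (hxy : x ≠ y) : halfK K x y = K x y / 2 := by
  rw [halfK_apply, if_neg hxy, zero_add]

lemma cond_half (k : ℕ) : cond (halfK K) π k = cond K π k / 2 := by
  rw [cond, cond, up, up]
  split_ifs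
  · rw [halfK_apply_of_ne (by simp [Fin.ext_iff]), mul_div_assoc]
  · rw [mul_zero, zero_div]

lemma passMean_half (k : ℕ) : passMean (halfK K) π k = 2 * passMean K π k := by
  rw [passMean, passMean, cond_half, div_div_eq_mul_div, mul_comm, mul_div_assoc]

lemma passVar_half (k : ℕ) : passVar (halfK K) π k = 4 * passVar K π k := by
  have hterm (y : ℕ) : cond (halfK K) π y * passMean (halfK K) π y ^ 2 =
      2 * (cond K π y * passMean K π y ^ 2) := by rw [passMean_half, cond_half]; ring
  rw [passVar, passVar, hterm, cond_half]
  simp only [hterm, ← Finset.mul_sum]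
  ring

lemma upMean_half (z k : ℕ) : upMean (halfK K) π z k = 2 * upMean K π z k := by
  simp only [upMean, passMean_half, Finset.mul_sum]

lemma upVar_half (z k : ℕ) : upVar (halfK K) π z k = 4 * upVar K π z k := by
  simp only [upVar, passVar_half, Finset.mul_sum]

lemma sum_range_eq_add_reflect (F : ℕ → ℝ) {M m : ℕ} (hM : M ≤ m) :
    ∑ k ∈ Finset.range m, F k =
      ∑ k ∈ Finset.range M, F k + ∑ j ∈ Finset.range (m - M), F (m - 1 - j) := by
  rw [← Finset.sum_range_add_sum_Ico _ hM, Finset.sum_Ico_eq_sum_range,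
    ← Finset.sum_range_reflect (fun k => F (M + k))]
  congr 1
  refine Finset.sum_congr rfl fun j hj => congrArg F ?_
  have := Finset.mem_range.1 hj
  omega

lemma sum_mul_sq_eq_add_rev {M : ℕ} (hM : M ≤ n) {g : ℕ → ℝ} (hg : g M = 0) :
    ∑ x : Fin (n + 1), π x * g x ^ 2 = ∑ k ∈ Finset.range M, wt π k * g k ^ 2 +
      ∑ j ∈ Finset.range (n - M), wt (revW π) j * g (n - j) ^ 2 := by
  rw [← sum_range_wt fun k => g k ^ 2, sum_range_eq_add_reflect _ (hM.trans n.le_succ),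
    Nat.succ_sub hM, Finset.sum_range_succ, Nat.succ_sub_one, Nat.sub_sub_self hM, hg,
    zero_pow two_ne_zero, mul_zero, add_zero]
  congr 1
  refine Finset.sum_congr rfl fun j hj => ?_
  rw [wt_rev ((Finset.mem_range.1 hj).le.trans (Nat.sub_le n M))]

namespace IsBD

variable (h : IsBD K π)
include h

lemma rev : IsBD (revK K) (revW π) where
  nonneg x y := h.nonneg _ _
  row_sum x := (sum_rev fun y => K x.rev y).trans (h.row_sum x.rev)
  weight_nonneg x := h.weight_nonneg _
  weight_sum := (sum_rev π).trans h.weight_sum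
  balance x y := h.balance _ _
  weight_pos x := h.weight_pos _
  nearest i j hij := h.nearest _ _ (by simp only [Fin.val_rev]; omega)
  succ_pos i := by
    rw [revK_apply, Fin.rev_castSucc, Fin.rev_succ]
    have hdown := h.down_pos i.rev.2
    rwa [down, dif_pos i.rev.2] at hdown

lemma half : IsBD (halfK K) π where
  nonneg x y := by
    rw [halfK_apply]
    exact add_nonneg (by split_ifs <;> norm_num) (div_nonneg (h.nonneg x y) zero_le_two)
  row_sum x := by
    simp only [halfK_apply, Finset.sum_add_distrib, ← Finset.sum_div, h.row_sum,
      Finset.sum_ite_eq, Finset.mem_univ, if_true, add_halves]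
  weight_nonneg := h.weight_nonneg
  weight_sum := h.weight_sum
  balance x y := by
    rcases eq_or_ne x y with rfl | hxy
    · rfl
    · rw [halfK_apply_of_ne hxy, halfK_apply_of_ne hxy.symm, ← mul_div_assoc, h.balance x y,
        mul_div_assoc]
  weight_pos := h.weight_pos
  nearest i j hij := by
    rw [halfK_apply_of_ne (by rintro rfl; omega), h.nearest i j hij, zero_div]
  succ_pos i := by
    rw [halfK_apply_of_ne (by simp [Fin.ext_iff])]
    exact half_pos (h.succ_pos i)

lemma half_lazy (x : Fin (n + 1)) : 1 / 2 ≤ halfK K x x := by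
  rw [halfK_apply, if_pos rfl]
  exact le_add_of_nonneg_right (div_nonneg (h.nonneg x x) zero_le_two)

lemma cond_rev {k : ℕ} (hk : k < n) : cond (revK K) (revW π) k = cond K π (n - (k + 1)) := by
  rw [h.rev.cond_eq, wt_rev (by omega), cond, down, up, dif_pos hk, dif_pos (by omega), revK_apply]
  congr 2
  · ext
    simp only [Fin.val_rev]
    omega
  · ext
    simp only [Fin.val_rev]
    omega

lemma dirichlet_comp_val_eq_add_rev {M : ℕ} (hM : M ≤ n) (g : ℕ → ℝ) :
    dirichlet K π (fun x => g x) =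
      ∑ k ∈ Finset.range M, cond K π k * (g k - g (k + 1)) ^ 2 +
      ∑ j ∈ Finset.range (n - M),
        cond (revK K) (revW π) j * (g (n - j) - g (n - (j + 1))) ^ 2 := by
  rw [h.dirichlet_comp_val, sum_range_eq_add_reflect _ hM]
  congr 1
  refine Finset.sum_congr rfl fun j hj => ?_
  have hjM := Finset.mem_range.1 hj
  rw [h.cond_rev (by omega), show n - 1 - j = n - (j + 1) by omega,
    show n - (j + 1) + 1 = n - j by omega, sub_sq_comm]

lemma hardy_le {M : ℕ} (hM : M ≤ n) {f : ℕ → ℝ} (hf : f M = 0) {α : ℝ} (hα : 0 ≤ α)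
    (hV : upVar K π M 0 ≤ α ^ 2) :
    ∑ x ∈ Finset.range M, wt π x * f x ^ 2 ≤
      α * ∑ k ∈ Finset.range M, cond K π k * (f k - f (k + 1)) ^ 2 := by
  have henergy : 0 ≤ ∑ k ∈ Finset.range M, cond K π k * (f k - f (k + 1)) ^ 2 :=
    Finset.sum_nonneg fun k _ => mul_nonneg (h.cond_nonneg k) (sq_nonneg _)
  refine le_of_sq_le_sq ((h.hardy hM hf).trans ?_) (mul_nonneg hα henergy)
  rw [mul_pow]
  gcongr

lemma sum_mul_sub_sq_le_dirichlet {M : ℕ} (hM : M ≤ n) {α : ℝ} (hα : 0 ≤ α)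
    (hL : upVar K π M 0 ≤ α ^ 2) (hR : upVar (revK K) (revW π) (n - M) 0 ≤ α ^ 2)
    (f : Fin (n + 1) → ℝ) : ∑ x, π x * (f x - wt f M) ^ 2 ≤ α * dirichlet K π f := by
  set g : ℕ → ℝ := fun k => wt f k - wt f M
  have hg : g M = 0 := sub_self _
  have hfg (x : Fin (n + 1)) : f x - wt f M = g x := by simp only [g, wt_coe]
  rw [← h.dirichlet_sub_const f (wt f M)]
  simp only [hfg]
  rw [sum_mul_sq_eq_add_rev hM hg, h.dirichlet_comp_val_eq_add_rev hM g, mul_add]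
  exact add_le_add (h.hardy_le hM hg hα hL)
    (h.rev.hardy_le (Nat.sub_le n M) (f := fun j => g (n - j))
      (by rw [Nat.sub_sub_self hM, hg]) hα hR)

lemma sum_mul_sub_sq {f : Fin (n + 1) → ℝ} (hf : ∑ x, π x * f x = 0) (a : ℝ) :
    ∑ x, π x * (f x - a) ^ 2 = ∑ x, π x * f x ^ 2 + a ^ 2 := by
  calc ∑ x, π x * (f x - a) ^ 2
      = ∑ x, (π x * f x ^ 2 - 2 * a * (π x * f x) + a ^ 2 * π x) :=
        Finset.sum_congr rfl fun x _ => by ring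
    _ = ∑ x, π x * f x ^ 2 + a ^ 2 := by
        rw [Finset.sum_add_distrib, Finset.sum_sub_distrib, ← Finset.mul_sum, ← Finset.mul_sum,
          hf, h.weight_sum, mul_zero, sub_zero, mul_one]

lemma poincare_of_upVar {M : ℕ} (hM : M ≤ n) {α : ℝ} (hα : 0 < α) (hL : upVar K π M 0 ≤ α ^ 2)
    (hR : upVar (revK K) (revW π) (n - M) 0 ≤ α ^ 2) : Poincare K π (1 / α) := by
  intro f hf
  rw [one_div, inv_mul_le_iff₀ hα]
  refine le_trans ?_ (h.sum_mul_sub_sq_le_dirichlet hM hα.le hL hR f)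
  rw [wInner_self_eq_sum_sq, h.sum_mul_sub_sq hf]
  exact le_add_of_nonneg_right (sq_nonneg _)

end IsBD

end Constructions

/-! ### Mixing of the orbits around the hitting time of a central state -/

section Central

variable {n : ℕ}

/-- The larger of the mean hitting times of `M` from the two ends. -/
def hitMean (K : Matrix (Fin (n + 1)) (Fin (n + 1)) ℝ) (π : Fin (n + 1) → ℝ)
    (M : Fin (n + 1)) : ℝ :=
  max (upMean K π M 0) (upMean (revK K) (revW π) M.rev 0)

/-- The larger of the variances of the hitting times of `M` from the two ends, for the continuous
time chain. -/
def hitVar (K : Matrix (Fin (n + 1)) (Fin (n + 1)) ℝ) (π : Fin (n + 1) → ℝ)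
    (M : Fin (n + 1)) : ℝ :=
  max (upVar K π M 0) (upVar (revK K) (revW π) M.rev 0)

/-- The state `M` leaves weight at least `c > 0` on each side (both sides containing `M`). -/
structure IsCentral (π : Fin (n + 1) → ℝ) (M : Fin (n + 1)) (c : ℝ) : Prop where
  pos : 0 < c
  le_cum : c ≤ cum π M
  le_tailWt : c ≤ tailWt π M

/-- A scale `α` which dominates both the standard deviation of the time to go up from `0` to `M`
and a relaxation time `1 / lam`. -/
structure IsTimeScale (K : Matrix (Fin (n + 1)) (Fin (n + 1)) ℝ) (π : Fin (n + 1) → ℝ)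
    (M : Fin (n + 1)) (lam α : ℝ) : Prop where
  poincare : Poincare K π lam
  lam_pos : 0 < lam
  upVar_le : upVar K π M 0 ≤ α ^ 2
  one_le : 1 ≤ α
  one_le_mul : 1 ≤ lam * α

variable {K : Matrix (Fin (n + 1)) (Fin (n + 1)) ℝ} {π : Fin (n + 1) → ℝ} {M : Fin (n + 1)}

lemma sum_wt_map (S : Finset (Fin (n + 1))) :
    ∑ k ∈ S.map Fin.valEmbedding, wt π k = ∑ x ∈ S, π x := by
  simp only [Finset.sum_map, Fin.valEmbedding_apply, wt_coe]

lemma cum_eq_sum_Iic (M : Fin (n + 1)) : cum π M = ∑ x ∈ Finset.Iic M, π x := by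
  rw [← sum_wt_map, Fin.map_valEmbedding_Iic, cum, Nat.range_succ_eq_Iic]

lemma tailWt_eq_sum_Ici (M : Fin (n + 1)) : tailWt π M = ∑ x ∈ Finset.Ici M, π x := by
  rw [← sum_wt_map, Fin.map_valEmbedding_Ici, tailWt]

lemma cum_rev (M : Fin (n + 1)) : cum (revW π) M.rev = tailWt π M := by
  rw [cum_eq_sum_Iic, tailWt_eq_sum_Ici]
  refine Finset.sum_equiv Fin.revPerm (fun i => ?_) fun i _ => rfl
  rw [Finset.mem_Iic, Finset.mem_Ici, Fin.revPerm_apply, Fin.le_rev_iff]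

lemma tailWt_rev (M : Fin (n + 1)) : tailWt (revW π) M.rev = cum π M := by
  rw [← cum_rev, revW_revW, Fin.rev_rev]

lemma IsCentral.rev {c : ℝ} (hc : IsCentral π M c) : IsCentral (revW π) M.rev c :=
  ⟨hc.pos, (cum_rev M).symm ▸ hc.le_tailWt, (tailWt_rev M).symm ▸ hc.le_cum⟩

lemma IsCentral.exists_quantile {c : ℝ} (hc : IsCentral π M c) :
    ∃ w : Fin (n + 1), M ≤ w ∧ c / 2 ≤ tailWt π w ∧ c / 2 ≤ ∑ z ∈ Finset.Icc M w, π z := by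
  classical
  have hM : c / 2 ≤ tailWt π M := by linarith [hc.pos, hc.le_tailWt]
  set w := Nat.findGreatest (fun k => c / 2 ≤ tailWt π k) n
  have hMw : (M : ℕ) ≤ w := Nat.le_findGreatest M.is_le hM
  have hw : c / 2 ≤ tailWt π w :=
    Nat.findGreatest_spec (P := fun k => c / 2 ≤ tailWt π k) M.is_le hM
  have hwn : w < n + 1 := Nat.lt_succ_of_le (Nat.findGreatest_le n)
  have hnext : tailWt π (w + 1) ≤ c / 2 := by
    rcases (Nat.lt_succ_iff.1 hwn).eq_or_lt with hn | hn
    · rw [hn, tailWt, Finset.Ico_self, Finset.sum_empty]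
      linarith [hc.pos]
    · exact (not_le.1 (Nat.findGreatest_is_greatest (P := fun k => c / 2 ≤ tailWt π k)
        (Nat.lt_succ_self w) hn)).le
  refine ⟨⟨w, hwn⟩, hMw, hw, ?_⟩
  have hsplit : tailWt π M = ∑ k ∈ Finset.Ico (M : ℕ) (w + 1), wt π k + tailWt π (w + 1) :=
    (Finset.sum_Ico_consecutive _ (by omega) hwn).symm
  rw [← sum_wt_map, Fin.map_valEmbedding_Icc, ← Finset.Ico_add_one_right_eq_Icc]
  linarith [hc.le_tailWt]

lemma exists_first_quantile (π : Fin (n + 1) → ℝ) {η : ℝ} (hη : 0 ≤ η) (hM : η ≤ cum π M) :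
    ∃ z ≤ M, η ≤ cum π z ∧ ∑ x ∈ Finset.Iio z, π x ≤ η := by
  classical
  have hex : ∃ k, η ≤ cum π k := ⟨M, hM⟩
  have hkM : Nat.find hex ≤ M := Nat.find_min' hex hM
  refine ⟨⟨Nat.find hex, by omega⟩, hkM, Nat.find_spec hex, ?_⟩
  rw [← sum_wt_map, Fin.map_valEmbedding_Iio, Nat.Iio_eq_range, Fin.val_mk]
  rcases hk : Nat.find hex with _ | k
  · simpa using hη
  · exact (not_le.1 (Nat.find_min hex (m := k) (by omega))).le

lemma exists_mul_le_of_sum_mul_le {ι : Type*} [Fintype ι] {w B : ι → ℝ} (hw : ∀ x, 0 < w x)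
    (hB : ∀ x, 0 ≤ B x) {C p : ℝ} (hC : ∑ x, w x * B x ≤ C) {S : Finset ι} (hp : 0 < p)
    (hS : p ≤ ∑ x ∈ S, w x) : ∃ x ∈ S, p * B x ≤ C := by
  have hne : S.Nonempty := Finset.nonempty_of_sum_ne_zero (hp.trans_le hS).ne'
  have hsub : ∑ x ∈ S, w x * B x ≤ ∑ x, w x * B x :=
    Finset.sum_le_sum_of_subset_of_nonneg S.subset_univ
      fun x _ _ => mul_nonneg (hw x).le (hB x)
  have hC0 : 0 ≤ C := (Finset.sum_nonneg fun x _ => mul_nonneg (hw x).le (hB x)).trans hC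
  have havg : ∑ x ∈ S, w x * B x ≤ ∑ x ∈ S, w x * (C / p) := by
    rw [← Finset.sum_mul]
    calc ∑ x ∈ S, w x * B x ≤ C := hsub.trans hC
      _ = p * (C / p) := (mul_div_cancel₀ C hp.ne').symm
      _ ≤ (∑ x ∈ S, w x) * (C / p) := by gcongr
  obtain ⟨x, hx, hxB⟩ := Finset.exists_le_of_sum_le hne havg
  refine ⟨x, hx, ?_⟩
  rw [mul_comm, ← le_div_iff₀ hp]
  exact le_of_mul_le_mul_left hxB (hw x)

lemma le_of_mul_sq_le {p r α η : ℝ} (hp : 0 ≤ p) (hα : 0 < α) (hη : 0 < η) (hr : α / √η ≤ r)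
    (h : p * r ^ 2 ≤ α ^ 2) : p ≤ η := by
  have hsq : α ^ 2 / η ≤ r ^ 2 := by
    rw [← Real.sq_sqrt hη.le, ← div_pow]
    gcongr
  have : p * (α ^ 2 / η) ≤ α ^ 2 := (mul_le_mul_of_nonneg_left hsq hp).trans h
  rw [mul_div_assoc', div_le_iff₀ hη, mul_comm] at this
  exact le_of_mul_le_mul_left this (by positivity)

lemma pow_mulVec_succ {ι : Type*} [Fintype ι] [DecidableEq ι] (K : Matrix ι ι ℝ) (g : ι → ℝ)
    (k : ℕ) : (K ^ (k + 1)).mulVec g = K.mulVec ((K ^ k).mulVec g) := by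
  rw [Matrix.mulVec_mulVec, pow_succ']

lemma IsReversible.wInner_self_le_one {ι : Type*} [Fintype ι] {K : Matrix ι ι ℝ} {π g : ι → ℝ}
    (h : IsReversible K π) (hg : ∀ x, |g x| ≤ 1) : ⟪g, g⟫_[ℝ, π] ≤ 1 := by
  rw [wInner_self_eq_sum_sq, ← h.weight_sum]
  exact Finset.sum_le_sum fun x _ => mul_le_of_le_one_right (h.weight_nonneg x)
    ((sq_le_one_iff_abs_le_one _).2 (hg x))

namespace IsBD

variable (h : IsBD K π) {lam α c δ η : ℝ}
include h

lemma surv_le_of_late (hα : 0 < α) (hV : upVar K π M 0 ≤ α ^ 2) (hη : 0 < η) {a : ℕ}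
    (ha : upMean K π M 0 + α / √η ≤ a) {x : Fin (n + 1)} (hx : x ≤ M) : surv K M a x ≤ η := by
  have hmean : upMean K π M x ≤ upMean K π M 0 := h.antitone_upMean _ (Nat.zero_le _)
  have hvar : upVar K π M x ≤ α ^ 2 := (h.antitone_upVar _ (Nat.zero_le _)).trans hV
  have hr : α / √η ≤ a + 1 - upMean K π M x := by linarith
  have hcheb := h.surv_mul_sq_le ((by positivity : 0 ≤ α / √η).trans hr) a hx
  rw [sub_sub_cancel, sub_self, zero_pow two_ne_zero, add_zero] at hcheb
  exact le_of_mul_sq_le (surv_nonneg h.nonneg a x) hα hη hr (hcheb.trans hvar)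

lemma upMean_le_div (hs : IsTimeScale K π M lam α) {a b : ℕ} (hab : a ≤ b) (hb : b ≤ n) {p q : ℝ}
    (hp : 0 < p) (hq : 0 < q) (hpa : p ≤ cum π a) (hqb : q ≤ tailWt π b) :
    upMean K π b a ≤ α / (p * q) := by
  have hmean := h.upMean_nonneg b a
  have hcum := h.cum_nonneg a
  have hlam := hs.lam_pos
  rw [le_div_iff₀ (by positivity)]
  refine le_of_mul_le_mul_left ?_ hlam
  calc lam * (upMean K π b a * (p * q)) = lam * p * q * upMean K π b a := by ring
    _ ≤ lam * cum π a * tailWt π b * upMean K π b a := by gcongr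
    _ ≤ lam * α := (h.mul_upMean_le hlam.le hs.poincare hab hb).trans hs.one_le_mul

lemma surv_le_of_quantile (hs : IsTimeScale K π M lam α) (hc : IsCentral π M c) (hη : 0 < η)
    {z w : Fin (n + 1)} (hMz : M ≤ z) (hzw : z ≤ w) (hw : c / 2 ≤ tailWt π w) {b : ℕ}
    (hb : α * (2 / (c ^ 2 * η)) ≤ b) : surv K z b M ≤ η := by
  have hc0 := hc.pos
  have hα : 0 < α := zero_lt_one.trans_le hs.one_le
  have hb0 : (0 : ℝ) < b := lt_of_lt_of_le (by positivity) hb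
  refine le_of_mul_le_mul_left ?_ hb0
  calc b * surv K z b M ≤ upMean K π z M := h.mul_surv_le_upMean b hMz
    _ ≤ upMean K π w M := h.upMean_mono hzw _
    _ ≤ α / (c * (c / 2)) :=
      h.upMean_le_div hs (hMz.trans hzw) w.is_le hc0 (by positivity) hc.le_cum hw
    _ = α * (2 / (c ^ 2 * η)) * η := by field_simp
    _ ≤ b * η := by gcongr

/-- By the maximal inequality and the pigeonhole principle, a single state of the given mass `p`
works for all times in `[s, m]`. -/
lemma exists_orbit_le (hδ0 : 0 < δ) (hδ : ∀ x, δ ≤ K x x) (hs : IsTimeScale K π M lam α)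
    {A p : ℝ} (hA0 : 0 < A) (hp : 0 < p) (hη : 0 ≤ η) (hA : maximalConst δ A ≤ p * η ^ 2)
    {g : Fin (n + 1) → ℝ} (hg : ∀ x, |g x| ≤ 1) (hg0 : ∑ x, π x * g x = 0)
    {S : Finset (Fin (n + 1))} (hS : p ≤ ∑ x ∈ S, π x) {s m : ℕ} (hsA : A * α ≤ s)
    (hsm : s ≤ m) : ∃ z ∈ S, ∀ k, s ≤ k → k ≤ m → (K ^ k).mulVec g z ≤ η := by
  have hAs : A ≤ lam * s := by
    calc A ≤ A * (lam * α) := le_mul_of_one_le_right hA0.le hs.one_le_mul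
      _ = lam * (A * α) := by ring
      _ ≤ lam * s := mul_le_mul_of_nonneg_left hsA hs.lam_pos.le
  have hsq (k : ℕ) (hk : k ∈ Finset.Icc s m) (z : Fin (n + 1)) : (K ^ k).mulVec g z ^ 2 ≤
      (Finset.Icc s m).sup' (Finset.nonempty_Icc.2 hsm) (fun k => (K ^ k).mulVec g z ^ 2) :=
    Finset.le_sup' (fun k => (K ^ k).mulVec g z ^ 2) hk
  have hmax := h.sum_mul_sup_sq_le hδ0 hδ hs.lam_pos hs.poincare hA0
    (φ := fun k => (K ^ k).mulVec g) (pow_mulVec_succ K g) (by simpa using hg0) hsm hAs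
  rw [pow_zero, Matrix.one_mulVec] at hmax
  have hconst : 0 ≤ maximalConst δ A := by unfold maximalConst; positivity
  have hle : maximalConst δ A * ⟪g, g⟫_[ℝ, π] ≤ p * η ^ 2 :=
    (mul_le_of_le_one_right hconst (h.wInner_self_le_one hg)).trans hA
  obtain ⟨z, hzS, hz⟩ := exists_mul_le_of_sum_mul_le h.weight_pos
    (fun z => (sq_nonneg _).trans (hsq m (Finset.right_mem_Icc.2 hsm) z)) (hmax.trans hle) hp hS
  refine ⟨z, hzS, fun k hk hkm => le_of_abs_le (abs_le_of_sq_le_sq ?_ hη)⟩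
  exact (hsq k (Finset.mem_Icc.2 ⟨hk, hkm⟩) z).trans (le_of_mul_le_mul_left hz hp)

/-- From `x ≤ M` the chain reaches `M`, and then any state `z` between `M` and a quantile, within
the time allowed; `z` is chosen so that the orbit has been small at `z` ever since the time `s`. -/
theorem orbit_le_of_late (hδ0 : 0 < δ) (hδ : ∀ x, δ ≤ K x x) (hs : IsTimeScale K π M lam α)
    (hc : IsCentral π M c) (hη : 0 < η) {A : ℝ} (hA0 : 0 < A)
    (hA : maximalConst δ A ≤ c / 2 * η ^ 2) {m : ℕ}
    (hm : upMean K π M 0 + (A + 1 / √η + 2 / (c ^ 2 * η) + 3) * α ≤ m) {g : Fin (n + 1) → ℝ}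
    (hg : ∀ x, |g x| ≤ 1) (hg0 : ∑ x, π x * g x = 0) {x : Fin (n + 1)} (hx : x ≤ M) :
    (K ^ m).mulVec g x ≤ 3 * η := by
  have hc0 := hc.pos
  have hα := hs.one_le
  have hmean := h.upMean_nonneg M 0
  obtain ⟨w, -, hw, hmass⟩ := hc.exists_quantile
  set a := ⌈upMean K π M 0 + α / √η⌉₊
  set b := ⌈α * (2 / (c ^ 2 * η))⌉₊
  have ha : (a : ℝ) < upMean K π M 0 + α / √η + 1 := Nat.ceil_lt_add_one (by positivity)
  have hb : (b : ℝ) < α * (2 / (c ^ 2 * η)) + 1 := Nat.ceil_lt_add_one (by positivity)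
  have hroom : A * α + (a + b) ≤ m := by
    have : α / √η = 1 / √η * α := by ring
    linarith
  obtain ⟨s, rfl⟩ : ∃ s, m = s + (a + b) := by
    refine ⟨m - (a + b), (Nat.sub_add_cancel ?_).symm⟩
    have : (0 : ℝ) ≤ A * α := by positivity
    exact_mod_cast (by linarith : (a : ℝ) + b ≤ m)
  push_cast at hroom
  obtain ⟨z, hzmem, hz⟩ := h.exists_orbit_le hδ0 hδ hs hA0 (half_pos hc0) hη.le hA hg hg0 hmass
    (by linarith) (Nat.le_add_right s (a + b))
  obtain ⟨hMz, hzw⟩ := Finset.mem_Icc.1 hzmem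
  have hreach : surv K z (a + b) x ≤ η + η :=
    (h.surv_add_le hMz a b hx).trans (add_le_add
      (h.surv_le_of_late (zero_lt_one.trans_le hα) hs.upVar_le hη (Nat.le_ceil _) hx)
      (h.surv_le_of_quantile hs hc hη hMz hzw hw (Nat.le_ceil _)))
  have horbit := h.orbit_le_add_surv (φ := fun k => (K ^ k).mulVec g) (pow_mulVec_succ K g)
    (fun y => by simpa using (abs_le.1 (hg y)).2) hη.le hz x
  linarith

/-- The state `z` is a quantile of `π` of small order: it is below `M`, but the time to go from
`z` to `M` is of order `α`, so the chain started at `0` is still below `z`. -/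
theorem exists_orbit_le_of_early (hs : IsTimeScale K π M lam α) (hc : IsCentral π M c)
    (hη : 0 < η) : ∃ z : Fin (n + 1), ∑ x ∈ Finset.Iio z, π x ≤ η ∧
      ∀ m : ℕ, (m : ℝ) ≤ upMean K π M 0 - (1 / (min c η * c) + 1 / √η) * α →
        (K ^ m).mulVec (fun x => if z ≤ x then 1 else 0) 0 ≤ η := by
  have hc0 := hc.pos
  have hα : 0 < α := zero_lt_one.trans_le hs.one_le
  have hκ : 0 < min c η := lt_min hc0 hη
  obtain ⟨z, hzM, hzcum, hz⟩ := exists_first_quantile π hκ.le ((min_le_left _ _).trans hc.le_cum)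
  refine ⟨z, hz.trans (min_le_right _ _), fun m hm => ?_⟩
  have hzmean : upMean K π M 0 - α / (min c η * c) ≤ upMean K π z 0 := by
    have := upMean_add (K := K) (π := π) (Nat.zero_le z) (Fin.le_iff_val_le_val.1 hzM)
    linarith [h.upMean_le_div hs (Fin.le_iff_val_le_val.1 hzM) M.is_le hκ hc0 hzcum hc.le_tailWt]
  have hr : α / √η ≤ upMean K π z 0 - m := by
    have : (1 / (min c η * c) + 1 / √η) * α = α / (min c η * c) + α / √η := by ring
    linarith
  have hcheb := h.one_sub_surv_mul_sq_le ((by positivity : 0 ≤ α / √η).trans hr) m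
    (Fin.zero_le z)
  rw [Fin.val_zero, add_sub_cancel, sub_self, zero_pow two_ne_zero, add_zero] at hcheb
  have hvar : upVar K π z 0 ≤ α ^ 2 := (h.upVar_mono hzM 0).trans hs.upVar_le
  have hsurv : 1 - surv K z m 0 ≤ η :=
    le_of_mul_sq_le (sub_nonneg.2 (h.surv_le_one m 0)) hα hη hr (hcheb.trans hvar)
  have horbit := h.orbit_add_surv_le_one
    (φ := fun k => (K ^ k).mulVec fun x => if z ≤ x then 1 else 0) (pow_mulVec_succ K _)
    (fun x => by simp only [pow_zero, Matrix.one_mulVec]; split_ifs <;> norm_num)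
    (fun x hx => by simp only [pow_zero, Matrix.one_mulVec, if_neg (not_le.2 hx), le_refl]) m
    (Fin.zero_le z)
  linarith

end IsBD

lemma hitVar_rev : hitVar (revK K) (revW π) M.rev = hitVar K π M := by
  rw [hitVar, hitVar, revK_revK, revW_revW, Fin.rev_rev, max_comm]

lemma revK_halfK : revK (halfK K) = halfK (revK K) := by
  ext x y
  simp only [revK_apply, halfK_apply, Fin.rev_inj]

lemma hitMean_half : hitMean (halfK K) π M = 2 * hitMean K π M := by
  rw [hitMean, hitMean, revK_halfK, upMean_half, upMean_half, mul_max_of_nonneg _ _ zero_le_two]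

lemma hitVar_half : hitVar (halfK K) π M = 4 * hitVar K π M := by
  rw [hitVar, hitVar, revK_halfK, upVar_half, upVar_half, mul_max_of_nonneg _ _ zero_le_four]

namespace IsBD

variable (h : IsBD K π)
include h

lemma half_le_hitMean : (n : ℝ) / 2 ≤ hitMean K π M := by
  have hL : ((M : ℕ) : ℝ) - (0 : ℕ) ≤ hitMean K π M :=
    (h.sub_le_upMean M.is_le (Nat.zero_le _)).trans (le_max_left _ _)
  have hR : ((M.rev : ℕ) : ℝ) - (0 : ℕ) ≤ hitMean K π M :=
    (h.rev.sub_le_upMean M.rev.is_le (Nat.zero_le _)).trans (le_max_right _ _)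
  have hsum : ((M : ℕ) : ℝ) + (M.rev : ℕ) = n := by
    exact_mod_cast (by rw [Fin.val_rev]; omega : (M : ℕ) + M.rev = n)
  rw [Nat.cast_zero, sub_zero] at hL hR
  linarith

lemma one_le_hitMean (hn : 1 ≤ n) : 1 ≤ hitMean K π M := by
  rcases Nat.eq_zero_or_pos (M : ℕ) with h0 | h0
  · refine le_max_of_le_right (h.rev.one_le_upMean M.rev.is_le ?_)
    rw [Fin.val_rev]
    omega
  · exact le_max_of_le_left (h.one_le_upMean M.is_le h0)

lemma hitMean_le_hitVar : hitMean K π M ≤ hitVar K π M :=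
  max_le_max (h.upMean_le_upVar M.is_le 0) (h.rev.upMean_le_upVar M.rev.is_le 0)

lemma one_le_sqrt_hitVar (hn : 1 ≤ n) : 1 ≤ √(hitVar K π M) :=
  Real.one_le_sqrt.2 ((h.one_le_hitMean hn).trans h.hitMean_le_hitVar)

lemma sq_sqrt_hitVar : √(hitVar K π M) ^ 2 = hitVar K π M :=
  Real.sq_sqrt ((h.upVar_nonneg _ _).trans (le_max_left _ _))

lemma poincare_hitVar (hn : 1 ≤ n) : Poincare K π (1 / √(hitVar K π M)) := by
  have hrev : n - (M : ℕ) = (M.rev : ℕ) := by rw [Fin.val_rev]; omega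
  refine h.poincare_of_upVar M.is_le (zero_lt_one.trans_le (h.one_le_sqrt_hitVar hn)) ?_ ?_
  · exact h.sq_sqrt_hitVar.symm ▸ le_max_left _ _
  · exact h.sq_sqrt_hitVar.symm ▸ hrev.symm ▸ le_max_right _ _

lemma one_le_spectralGap_mul (hn : 1 ≤ n) : 1 ≤ spectralGap K * √(hitVar K π M) := by
  obtain ⟨f, hf0, hf, hKf⟩ := h.exists_spectralGap_eigenfunction hn
  have hgap := h.poincare_hitVar (M := M) hn f hf
  rw [dirichlet_of_mulVec hKf] at hgap
  rw [← div_le_iff₀ (zero_lt_one.trans_le (h.one_le_sqrt_hitVar hn))]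
  exact le_of_mul_le_mul_right hgap (wInner_self_pos h.weight_pos hf0)

lemma isTimeScale (hn : 1 ≤ n) : IsTimeScale K π M (spectralGap K) √(hitVar K π M) where
  poincare := h.poincare_spectralGap
  lam_pos := h.spectralGap_pos hn
  upVar_le := h.sq_sqrt_hitVar.symm ▸ le_max_left _ _
  one_le := h.one_le_sqrt_hitVar hn
  one_le_mul := h.one_le_spectralGap_mul hn

lemma isTimeScale_rev (hn : 1 ≤ n) :
    IsTimeScale (revK K) (revW π) M.rev (spectralGap (revK K)) √(hitVar K π M) := by
  simpa only [hitVar_rev] using h.rev.isTimeScale (M := M.rev) hn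

lemma mul_hitVar_le {c lam : ℝ} (hlam : 0 ≤ lam) (hP : Poincare K π lam)
    (hc : IsCentral π M c) : lam * c * hitVar K π M ≤ 2 * hitMean K π M := by
  have hc0 := hc.pos
  rw [hitVar, hitMean, mul_max_of_nonneg _ _ (by positivity), mul_max_of_nonneg _ _ zero_le_two]
  refine max_le_max ?_ ?_
  · refine le_trans ?_ (h.mul_upVar_le hlam hP M.is_le)
    have := h.upVar_nonneg M 0
    gcongr
    exact hc.le_tailWt
  · refine le_trans ?_ (h.rev.mul_upVar_le hlam hP.rev M.rev.is_le)
    have := h.rev.upVar_nonneg M.rev 0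
    gcongr
    exact hc.rev.le_tailWt

end IsBD

end Central

/-! ### Total variation bounds in discrete time -/

section TotalVariation

lemma pow_mulVec_eigen {ι : Type*} [Fintype ι] [DecidableEq ι] {K : Matrix ι ι ℝ} {f : ι → ℝ}
    {b : ℝ} (hf : K.mulVec f = b • f) (m : ℕ) : (K ^ m).mulVec f = b ^ m • f := by
  induction m with
  | zero => rw [pow_zero, pow_zero, Matrix.one_mulVec, one_smul]
  | succ m ih => rw [pow_mulVec_succ, ih, Matrix.mulVec_smul, hf, smul_smul, pow_succ]

lemma mulVec_ite_mem {ι : Type*} [Fintype ι] [DecidableEq ι] (P : Matrix ι ι ℝ) (A : Finset ι)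
    (x : ι) : P.mulVec (fun y => if y ∈ A then 1 else 0) x = ∑ y ∈ A, P x y := by
  simp only [Matrix.mulVec, dotProduct, mul_ite, mul_one, mul_zero, Finset.sum_ite_mem,
    Finset.univ_inter]

namespace IsReversible

variable {ι : Type*} [Fintype ι] {K : Matrix ι ι ℝ} {π : ι → ℝ} (h : IsReversible K π)
include h

lemma sum_weight_mem_Icc (A : Finset ι) : ∑ y ∈ A, π y ∈ Set.Icc 0 1 :=
  ⟨Finset.sum_nonneg fun y _ => h.weight_nonneg y, h.weight_sum ▸
    Finset.sum_le_sum_of_subset_of_nonneg A.subset_univ fun y _ _ => h.weight_nonneg y⟩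

variable [DecidableEq ι]

lemma pow_mem_rowStochastic (m : ℕ) : K ^ m ∈ Matrix.rowStochastic ℝ ι :=
  pow_mem (Matrix.mem_rowStochastic_iff_sum.2 ⟨h.nonneg, h.row_sum⟩) m

lemma pow_row_sum (m : ℕ) (x : ι) : ∑ y, (K ^ m) x y = 1 :=
  Matrix.sum_row_of_mem_rowStochastic (h.pow_mem_rowStochastic m) x

lemma sum_pow_le_one (m : ℕ) (x : ι) (A : Finset ι) : ∑ y ∈ A, (K ^ m) x y ≤ 1 :=
  h.pow_row_sum m x ▸ Finset.sum_le_sum_of_subset_of_nonneg A.subset_univ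
    fun _ _ _ => Matrix.nonneg_of_mem_rowStochastic (h.pow_mem_rowStochastic m)

end IsReversible

variable {n : ℕ} {K : Matrix (Fin (n + 1)) (Fin (n + 1)) ℝ} {π : Fin (n + 1) → ℝ}
  {M : Fin (n + 1)}

lemma revK_pow_mulVec (m : ℕ) (g : Fin (n + 1) → ℝ) (x : Fin (n + 1)) :
    (revK K ^ m).mulVec (g ∘ Fin.rev) x.rev = (K ^ m).mulVec g x := by
  rw [revK_pow, revK_mulVec, Function.comp_apply, Fin.rev_rev]

namespace IsBD

variable (h : IsBD K π) {c δ η : ℝ}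
include h

theorem sum_pow_sub_le_of_late (hn : 1 ≤ n) (hδ0 : 0 < δ) (hδ : ∀ x, δ ≤ K x x)
    (hc : IsCentral π M c) (hη : 0 < η) {A : ℝ} (hA0 : 0 < A)
    (hA : maximalConst δ A ≤ c / 2 * η ^ 2) {m : ℕ}
    (hm : hitMean K π M + (A + 1 / √η + 2 / (c ^ 2 * η) + 3) * √(hitVar K π M) ≤ m)
    (x : Fin (n + 1)) (S : Finset (Fin (n + 1))) :
    ∑ y ∈ S, (K ^ m) x y - ∑ y ∈ S, π y ≤ 3 * η := by
  -- `orbit_le_of_late`, for the centred indicator of `S`, on the side of `M` that contains `x`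
  obtain ⟨hS0, hS1⟩ := h.sum_weight_mem_Icc S
  set a := ∑ y ∈ S, π y with ha
  set g : Fin (n + 1) → ℝ := (fun y => if y ∈ S then 1 else 0) - fun _ => a with hg
  have hg1 (y : Fin (n + 1)) : |g y| ≤ 1 := by
    rw [abs_le, hg, Pi.sub_apply]
    split_ifs <;> constructor <;> linarith
  have hg0 : ∑ y, π y * g y = 0 := by
    simp only [hg, Pi.sub_apply, mul_sub, Finset.sum_sub_distrib, mul_ite, mul_one, mul_zero,
      Finset.sum_ite_mem, Finset.univ_inter, ← Finset.sum_mul, h.weight_sum, one_mul, ← ha,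
      sub_self]
  have hval : (K ^ m).mulVec g x = ∑ y ∈ S, (K ^ m) x y - a := by
    have hconst : (K ^ m).mulVec (fun _ => a) x = a := by
      simp only [Matrix.mulVec, dotProduct, ← Finset.sum_mul, h.pow_row_sum, one_mul]
    rw [hg, Matrix.mulVec_sub, Pi.sub_apply, mulVec_ite_mem, hconst]
  rw [← hval]
  rcases le_total x M with hx | hx
  · exact h.orbit_le_of_late hδ0 hδ (h.isTimeScale hn) hc hη hA0 hA
      (hm.trans' (add_le_add_left (le_max_left _ _) _)) hg1 hg0 hx
  · rw [← revK_pow_mulVec]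
    exact h.rev.orbit_le_of_late hδ0 (fun y => hδ y.rev) (h.isTimeScale_rev hn) hc.rev hη hA0 hA
      (hm.trans' (add_le_add_left (le_max_right _ _) _)) (fun y => hg1 y.rev)
      ((sum_rev fun y => π y * g y).trans hg0) (Fin.rev_le_rev.2 hx)

omit h in
theorem exists_forall_sum_pow_sub_le {c δ ε : ℝ} (hc : 0 < c) (hδ : 0 < δ) (hε : 0 < ε) :
    ∃ D : ℝ, 0 < D ∧ ∀ {n : ℕ} {K : Matrix (Fin (n + 1)) (Fin (n + 1)) ℝ} {π : Fin (n + 1) → ℝ}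
      {M : Fin (n + 1)}, IsBD K π → 1 ≤ n → IsCentral π M c → (∀ x, δ ≤ K x x) → ∀ m : ℕ,
      hitMean K π M + D * √(hitVar K π M) ≤ m → ∀ x A,
        ∑ y ∈ A, (K ^ m) x y - ∑ y ∈ A, π y ≤ ε := by
  obtain ⟨A, hA, hA0⟩ := (((tendsto_maximalConst δ).eventually_le_const
    (show 0 < c / 2 * (ε / 3) ^ 2 by positivity)).and (eventually_gt_atTop 0)).exists
  refine ⟨A + 1 / √(ε / 3) + 2 / (c ^ 2 * (ε / 3)) + 3, by positivity,
    fun h hn hM hK m hm x S => ?_⟩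
  linarith [h.sum_pow_sub_le_of_late hn hδ hK hM (by positivity : 0 < ε / 3) hA0 hA hm x S]

lemma exists_sum_pow_le_of_early_zero {lam α : ℝ} (hs : IsTimeScale K π M lam α)
    (hc : IsCentral π M c) (hη : 0 < η) :
    ∃ B : Finset (Fin (n + 1)), 1 - η ≤ ∑ y ∈ B, π y ∧
      ∀ m : ℕ, (m : ℝ) ≤ upMean K π M 0 - (1 / (min c η * c) + 1 / √η) * α →
        ∑ y ∈ B, (K ^ m) 0 y ≤ η := by
  obtain ⟨z, hz, hearly⟩ := h.exists_orbit_le_of_early hs hc hη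
  refine ⟨Finset.Ici z, ?_, fun m hm => ?_⟩
  · have hcompl : (Finset.Iio z)ᶜ = Finset.Ici z := by
      ext y
      rw [Finset.mem_compl, Finset.mem_Iio, Finset.mem_Ici, not_lt]
    have := Finset.sum_add_sum_compl (Finset.Iio z) π
    rw [hcompl, h.weight_sum] at this
    linarith
  · simpa only [← mulVec_ite_mem, Finset.mem_Ici] using hearly m hm

theorem exists_sum_pow_le_of_early (hn : 1 ≤ n) (hc : IsCentral π M c) (hη : 0 < η) :
    ∃ (x : Fin (n + 1)) (B : Finset (Fin (n + 1))), 1 - η ≤ ∑ y ∈ B, π y ∧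
      ∀ m : ℕ, (m : ℝ) ≤ hitMean K π M - (1 / (min c η * c) + 1 / √η) * √(hitVar K π M) →
        ∑ y ∈ B, (K ^ m) x y ≤ η := by
  rcases le_total (upMean (revK K) (revW π) M.rev 0) (upMean K π M 0) with hle | hle
  · rw [hitMean, max_eq_left hle]
    exact ⟨0, h.exists_sum_pow_le_of_early_zero (h.isTimeScale hn) hc hη⟩
  · rw [hitMean, max_eq_right hle]
    obtain ⟨B, hB, hearly⟩ :=
      h.rev.exists_sum_pow_le_of_early_zero (h.isTimeScale_rev hn) hc.rev hη
    refine ⟨Fin.rev 0, B.map Fin.revPerm.toEmbedding, ?_, fun m hm => ?_⟩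
    · rw [Finset.sum_map]
      exact hB
    · rw [Finset.sum_map]
      simpa only [revK_pow, revK_apply, Equiv.coe_toEmbedding, Fin.revPerm_apply] using hearly m hm

end IsBD

lemma le_tvDist (μ ν : Fin (n + 1) → ℝ) (A : Finset (Fin (n + 1))) :
    ∑ x ∈ A, μ x - ∑ x ∈ A, ν x ≤ tvDist μ ν :=
  le_ciSup (f := fun A : Finset (Fin (n + 1)) => ∑ x ∈ A, μ x - ∑ x ∈ A, ν x)
    (Set.finite_range _).bddAbove A

lemma iSup_tvDist_le {P : Matrix (Fin (n + 1)) (Fin (n + 1)) ℝ} {ε : ℝ}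
    (h : ∀ x A, ∑ y ∈ A, P x y - ∑ y ∈ A, π y ≤ ε) : ⨆ x, tvDist (P x) π ≤ ε :=
  ciSup_le fun x => ciSup_le fun A => h x A

lemma tvDist_le_iSup (P : Matrix (Fin (n + 1)) (Fin (n + 1)) ℝ) (π : Fin (n + 1) → ℝ)
    (x : Fin (n + 1)) : tvDist (P x) π ≤ ⨆ x, tvDist (P x) π :=
  le_ciSup (f := fun x => tvDist (P x) π) (Set.finite_range _).bddAbove x

lemma one_sub_le_iSup_tvDist {P : Matrix (Fin (n + 1)) (Fin (n + 1)) ℝ} {η : ℝ}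
    {x : Fin (n + 1)} {B : Finset (Fin (n + 1))} (hP1 : ∑ y, P x y = 1) (hπ1 : ∑ y, π y = 1)
    (hπ : 1 - η ≤ ∑ y ∈ B, π y) (hP : ∑ y ∈ B, P x y ≤ η) :
    1 - 2 * η ≤ ⨆ x, tvDist (P x) π := by
  have hPB := Finset.sum_add_sum_compl B (P x)
  have hπB := Finset.sum_add_sum_compl B π
  linarith [le_tvDist (P x) π Bᶜ, tvDist_le_iSup P π x]

lemma sum_abs_sub_le_tvDist {μ ν : Fin (n + 1) → ℝ} (h : ∑ x, μ x = ∑ x, ν x) :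
    ∑ x, |μ x - ν x| ≤ 2 * tvDist μ ν := by
  have hpos (x : Fin (n + 1)) : |μ x - ν x| = 2 * (μ x - ν x)⁺ - (μ x - ν x) := by
    linarith [posPart_add_negPart (μ x - ν x), posPart_sub_negPart (μ x - ν x)]
  have hA := le_tvDist μ ν (Finset.univ.filter fun x => 0 ≤ μ x - ν x)
  have hsum : ∑ x, (μ x - ν x)⁺ ≤ tvDist μ ν := by
    refine le_of_eq_of_le ?_ hA
    rw [← Finset.sum_sub_distrib, Finset.sum_filter]
    exact Finset.sum_congr rfl fun x _ => posPart_eq_ite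
  simp only [hpos, Finset.sum_sub_distrib, ← Finset.mul_sum, h, sub_self, sub_zero]
  linarith

lemma abs_le_iSup_tvDist {P : Matrix (Fin (n + 1)) (Fin (n + 1)) ℝ} {f : Fin (n + 1) → ℝ}
    {b : ℝ} (hP : ∀ x, ∑ y, P x y = 1) (hπ : ∑ x, π x = 1) (hf0 : f ≠ 0)
    (hf : ∑ x, π x * f x = 0) (hPf : P.mulVec f = b • f) : |b| ≤ 2 * ⨆ x, tvDist (P x) π := by
  obtain ⟨x, -, hmax⟩ :=
    Finset.exists_max_image Finset.univ (fun x => |f x|) Finset.univ_nonempty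
  have hfx : 0 < |f x| := by
    obtain ⟨y, hy⟩ := Function.ne_iff.1 hf0
    exact (abs_pos.2 hy).trans_le (hmax y (Finset.mem_univ y))
  have hcentred : b * f x = ∑ y, (P x y - π y) * f y := by
    simp only [sub_mul, Finset.sum_sub_distrib, hf, sub_zero]
    exact (congrFun hPf x).symm
  have hbound : |b| * |f x| ≤ (∑ y, |P x y - π y|) * |f x| := by
    rw [← abs_mul, hcentred, Finset.sum_mul]
    refine (Finset.abs_sum_le_sum_abs _ _).trans (Finset.sum_le_sum fun y hy => ?_)
    rw [abs_mul]
    exact mul_le_mul_of_nonneg_left (hmax y hy) (abs_nonneg _)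
  calc |b| ≤ ∑ y, |P x y - π y| := le_of_mul_le_mul_right hbound hfx
    _ ≤ 2 * tvDist (P x) π := sum_abs_sub_le_tvDist (by rw [hP, hπ])
    _ ≤ 2 * ⨆ x, tvDist (P x) π := by gcongr; exact tvDist_le_iSup P π x

lemma IsBD.abs_pow_le_maxTV (h : IsBD K π) (hn : 1 ≤ n) (m : ℕ) :
    |(1 - spectralGap K) ^ m| ≤ 2 * maxTV K π m := by
  obtain ⟨f, hf0, hf, hKf⟩ := h.exists_spectralGap_eigenfunction hn
  exact abs_le_iSup_tvDist (h.pow_row_sum m) h.weight_sum hf0 hf (pow_mulVec_eigen hKf m)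

end TotalVariation

/-! ### Poissonization -/

section Poissonization

/-- The probability that a Poisson variable of mean `t` is equal to `k`. -/
def poissonWt (t : ℝ) (k : ℕ) : ℝ := Real.exp (-t) * (t ^ k / k.factorial)

lemma poissonWt_nonneg {t : ℝ} (ht : 0 ≤ t) (k : ℕ) : 0 ≤ poissonWt t k := by
  unfold poissonWt; positivity

lemma hasSum_poissonWt_mul_pow (t b : ℝ) :
    HasSum (fun k => poissonWt t k * b ^ k) (Real.exp (-(1 - b) * t)) := by
  have hexp : HasSum (fun k : ℕ => (t * b) ^ k / k.factorial) (Real.exp (t * b)) := by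
    rw [Real.exp_eq_exp_ℝ]
    exact NormedSpace.expSeries_div_hasSum_exp (t * b)
  have hmul := hexp.mul_left (Real.exp (-t))
  rw [← Real.exp_add, show -t + t * b = -(1 - b) * t by ring] at hmul
  refine hmul.congr_fun fun k => ?_
  rw [poissonWt, mul_pow]
  ring

lemma hasSum_poissonWt (t : ℝ) : HasSum (poissonWt t) 1 := by
  simpa only [one_pow, mul_one, sub_self, neg_zero, zero_mul, Real.exp_zero] using
    hasSum_poissonWt_mul_pow t 1

lemma succ_mul_poissonWt (t : ℝ) (k : ℕ) :
    ((k + 1 : ℕ) : ℝ) * poissonWt t (k + 1) = t * poissonWt t k := by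
  rw [poissonWt, poissonWt, Nat.factorial_succ]
  push_cast
  field

lemma hasSum_mul_poissonWt (t : ℝ) : HasSum (fun k : ℕ => (k : ℝ) * poissonWt t k) t := by
  rw [← hasSum_nat_add_iff' 1]
  simpa only [succ_mul_poissonWt, Finset.sum_range_one, Nat.cast_zero, zero_mul, sub_zero,
    mul_one] using (hasSum_poissonWt t).mul_left t

lemma hasSum_sq_mul_poissonWt (t : ℝ) :
    HasSum (fun k : ℕ => (k : ℝ) ^ 2 * poissonWt t k) (t ^ 2 + t) := by
  rw [← hasSum_nat_add_iff' 1]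
  have hmul := ((hasSum_mul_poissonWt t).add (hasSum_poissonWt t)).mul_left t
  rw [Finset.sum_range_one, Nat.cast_zero,
    show t ^ 2 + t - 0 ^ 2 * poissonWt t 0 = t * (t + 1) by ring]
  refine hmul.congr_fun fun k => ?_
  rw [sq, mul_assoc, succ_mul_poissonWt]
  push_cast
  ring

lemma hasSum_sub_sq_mul_poissonWt (t : ℝ) :
    HasSum (fun k : ℕ => ((k : ℝ) - t) ^ 2 * poissonWt t k) t := by
  have hsum := ((hasSum_sq_mul_poissonWt t).sub ((hasSum_mul_poissonWt t).mul_left (2 * t))).add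
    ((hasSum_poissonWt t).mul_left (t ^ 2))
  rw [show t ^ 2 + t - 2 * t * t + t ^ 2 * 1 = t by ring] at hsum
  exact hsum.congr_fun fun k => by ring

/-- Chebyshev's inequality for the Poisson law. -/
lemma poisson_average_le {t s b S : ℝ} {a : ℕ → ℝ} (ht : 0 ≤ t) (hs : 0 < s) (hb : 0 ≤ b)
    (ha : ∀ k, a k ≤ 1) (hab : ∀ k : ℕ, |(k : ℝ) - t| < s → a k ≤ b)
    (hS : HasSum (fun k => poissonWt t k * a k) S) : S ≤ b + t / s ^ 2 := by
  have hbound := ((hasSum_poissonWt t).mul_left b).add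
    ((hasSum_sub_sq_mul_poissonWt t).div_const (s ^ 2))
  rw [mul_one] at hbound
  refine hasSum_le (fun k => ?_) hS hbound
  have hak : a k ≤ b + ((k : ℝ) - t) ^ 2 / s ^ 2 := by
    rcases lt_or_ge |(k : ℝ) - t| s with hk | hk
    · exact (hab k hk).trans (le_add_of_nonneg_right (by positivity))
    · have hdev : 1 ≤ ((k : ℝ) - t) ^ 2 / s ^ 2 := by
        rw [one_le_div (by positivity), ← sq_abs ((k : ℝ) - t)]
        gcongr
      linarith [ha k]
  calc poissonWt t k * a k ≤ poissonWt t k * (b + ((k : ℝ) - t) ^ 2 / s ^ 2) :=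
        mul_le_mul_of_nonneg_left hak (poissonWt_nonneg ht k)
    _ = b * poissonWt t k + ((k : ℝ) - t) ^ 2 * poissonWt t k / s ^ 2 := by ring

variable {n : ℕ} {K : Matrix (Fin (n + 1)) (Fin (n + 1)) ℝ} {π : Fin (n + 1) → ℝ}

lemma heat_eq_smul_exp (K : Matrix (Fin (n + 1)) (Fin (n + 1)) ℝ) (t : ℝ) :
    heat K t = Real.exp (-t) • NormedSpace.exp (t • K) := by
  let _ : NormedRing (Matrix (Fin (n + 1)) (Fin (n + 1)) ℝ) := Matrix.linftyOpNormedRing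
  let _ : NormedAlgebra ℝ (Matrix (Fin (n + 1)) (Fin (n + 1)) ℝ) := Matrix.linftyOpNormedAlgebra
  have hscalar : NormedSpace.exp ((-t) • (1 : Matrix (Fin (n + 1)) (Fin (n + 1)) ℝ)) =
      Real.exp (-t) • (1 : Matrix (Fin (n + 1)) (Fin (n + 1)) ℝ) := by
    rw [← Algebra.algebraMap_eq_smul_one, ← Algebra.algebraMap_eq_smul_one, Real.exp_eq_exp_ℝ]
    exact (NormedSpace.algebraMap_exp_comm (𝕂 := ℝ) (-t)).symm
  rw [heat, smul_sub, sub_eq_add_neg, ← neg_smul, neg_neg,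
    Matrix.exp_add_of_commute _ _ ((Commute.one_left _).smul_left _ |>.smul_right _), hscalar,
    smul_mul_assoc, one_mul]

lemma hasSum_heat (K : Matrix (Fin (n + 1)) (Fin (n + 1)) ℝ) (t : ℝ) :
    HasSum (fun k => poissonWt t k • K ^ k) (heat K t) := by
  let _ : NormedRing (Matrix (Fin (n + 1)) (Fin (n + 1)) ℝ) := Matrix.linftyOpNormedRing
  let _ : NormedAlgebra ℝ (Matrix (Fin (n + 1)) (Fin (n + 1)) ℝ) := Matrix.linftyOpNormedAlgebra
  have hexp : HasSum (fun k : ℕ => (k.factorial⁻¹ : ℝ) • (t • K) ^ k)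
      (NormedSpace.exp (t • K)) := NormedSpace.exp_series_hasSum_exp' (𝕂 := ℝ) (t • K)
  rw [heat_eq_smul_exp]
  convert hexp.const_smul (Real.exp (-t)) using 2 with k
  rw [smul_pow, smul_smul, smul_smul, poissonWt, div_eq_inv_mul, mul_assoc]

lemma heat_half (t : ℝ) : heat K t = heat (halfK K) (2 * t) := by
  rw [heat, heat]
  congr 1
  ext x y
  simp only [halfK, Matrix.smul_apply, Matrix.sub_apply, Matrix.add_apply, smul_eq_mul]
  ring

lemma hasSum_heat_mulVec (K : Matrix (Fin (n + 1)) (Fin (n + 1)) ℝ) (t : ℝ)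
    (f : Fin (n + 1) → ℝ) (x : Fin (n + 1)) :
    HasSum (fun k => poissonWt t k * (K ^ k).mulVec f x) ((heat K t).mulVec f x) := by
  have hcont : Continuous fun A : Matrix (Fin (n + 1)) (Fin (n + 1)) ℝ => A.mulVec f x :=
    (continuous_apply x).comp (continuous_id.matrix_mulVec continuous_const)
  have hmap := (hasSum_heat K t).map
    (AddMonoidHom.mk' (fun A : Matrix (Fin (n + 1)) (Fin (n + 1)) ℝ => A.mulVec f x)
      fun A B => congrFun (Matrix.add_mulVec A B f) x) hcont
  simpa only [Function.comp_def, AddMonoidHom.mk'_apply, Matrix.smul_mulVec, Pi.smul_apply,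
    smul_eq_mul] using hmap

lemma hasSum_sum_heat (K : Matrix (Fin (n + 1)) (Fin (n + 1)) ℝ) (t : ℝ) (x : Fin (n + 1))
    (A : Finset (Fin (n + 1))) :
    HasSum (fun k => poissonWt t k * ∑ y ∈ A, (K ^ k) x y) (∑ y ∈ A, heat K t x y) := by
  simpa only [mulVec_ite_mem] using hasSum_heat_mulVec K t (fun y => if y ∈ A then 1 else 0) x

lemma heat_mulVec_eigen {f : Fin (n + 1) → ℝ} {b : ℝ} (hf : K.mulVec f = b • f) (t : ℝ) :
    (heat K t).mulVec f = Real.exp (-(1 - b) * t) • f := by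
  ext x
  refine (hasSum_heat_mulVec K t f x).unique ?_
  simpa only [pow_mulVec_eigen hf, Pi.smul_apply, smul_eq_mul, mul_assoc] using
    (hasSum_poissonWt_mul_pow t b).mul_right (f x)

lemma IsReversible.heat_row_sum (h : IsReversible K π) (t : ℝ) (x : Fin (n + 1)) :
    ∑ y, heat K t x y = 1 := by
  refine (hasSum_sum_heat K t x Finset.univ).unique ?_
  simpa only [h.pow_row_sum, mul_one] using hasSum_poissonWt t

namespace IsBD

/-- The lazy chain `halfK K` run at twice the speed has the same continuous time semigroup, and
its Poisson clock at time `2 * t` deviates from `2 * t` by at most a multiple of the standard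
deviation of the hitting times. -/
theorem exists_sum_heat_sub_le {c ε : ℝ} (hc : 0 < c) (hε : 0 < ε) :
    ∃ D : ℝ, 0 < D ∧ ∀ {n : ℕ} {K : Matrix (Fin (n + 1)) (Fin (n + 1)) ℝ} {π : Fin (n + 1) → ℝ}
      {M : Fin (n + 1)}, IsBD K π → 1 ≤ n → IsCentral π M c → ∀ x A,
      ∑ y ∈ A, heat K (hitMean K π M + D * √(hitVar K π M)) x y - ∑ y ∈ A, π y ≤ ε := by
  obtain ⟨D, hD, hlate⟩ :=
    exists_forall_sum_pow_sub_le hc (one_half_pos (α := ℝ)) (half_pos hε)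
  set E : ℝ := 1 + (2 + D) / ε with hE
  have hE0 : 0 < E := by positivity
  have hEε : (1 + D + E) / E ^ 2 ≤ ε := by
    have hεE : 2 + D ≤ ε * E := by
      rw [hE, mul_add, mul_div_cancel₀ _ hε.ne']
      linarith
    have hE1 : 1 ≤ E := le_add_of_nonneg_right (by positivity)
    rw [div_le_iff₀ (by positivity)]
    nlinarith
  refine ⟨D + E, by positivity, fun {n K π M} h hn hM x A => ?_⟩
  set α := √(hitVar K π M) with hα
  have hα1 : 1 ≤ α := h.one_le_sqrt_hitVar hn
  have hθ0 : 0 ≤ hitMean K π M := zero_le_one.trans (h.one_le_hitMean hn)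
  have hθα : hitMean K π M ≤ α ^ 2 := h.sq_sqrt_hitVar ▸ h.hitMean_le_hitVar
  set t := hitMean K π M + (D + E) * α
  have htα : t ≤ (1 + D + E) * α ^ 2 := by
    have := mul_le_mul_of_nonneg_left (le_self_pow₀ hα1 two_ne_zero) (by positivity : 0 ≤ D + E)
    linarith
  have hα2 : √(hitVar (halfK K) π M) = 2 * α := by
    rw [hitVar_half, Real.sqrt_mul (by norm_num), hα]
    norm_num
  have hsum := (hasSum_sum_heat (halfK K) (2 * t) x A).sub
    ((hasSum_poissonWt (2 * t)).mul_right (∑ y ∈ A, π y))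
  simp only [← mul_sub, one_mul, ← heat_half] at hsum
  calc ∑ y ∈ A, heat K t x y - ∑ y ∈ A, π y ≤ ε / 2 + 2 * t / (2 * E * α) ^ 2 := by
        refine poisson_average_le (by positivity) (by positivity) (by positivity) (fun k => ?_)
          (fun k hk => hlate h.half hn hM h.half_lazy k ?_ x A) hsum
        · linarith [h.half.sum_pow_le_one k x A, (h.sum_weight_mem_Icc A).1]
        · rw [hitMean_half, hα2]
          linarith [(abs_lt.1 hk).1]
    _ ≤ ε / 2 + 2 * ((1 + D + E) * α ^ 2) / (2 * E * α) ^ 2 := by gcongr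
    _ = ε / 2 + (1 + D + E) / E ^ 2 / 2 := by field_simp
    _ ≤ ε / 2 + ε / 2 := by gcongr
    _ = ε := add_halves ε

theorem exists_sum_heat_le_of_early {c η : ℝ} (hc : 0 < c) (hη : 0 < η) :
    ∃ D : ℝ, 0 < D ∧ ∀ {n : ℕ} {K : Matrix (Fin (n + 1)) (Fin (n + 1)) ℝ} {π : Fin (n + 1) → ℝ}
      {M : Fin (n + 1)}, IsBD K π → 1 ≤ n → IsCentral π M c →
      ∃ (x : Fin (n + 1)) (B : Finset (Fin (n + 1))), 1 - η ≤ ∑ y ∈ B, π y ∧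
        ∀ t : ℝ, 0 ≤ t → t ≤ hitMean K π M - D * √(hitVar K π M) →
          ∑ y ∈ B, heat K t x y ≤ η := by
  set D : ℝ := 1 / (min c (η / 2) * c) + 1 / √(η / 2)
  set E : ℝ := 1 + 2 / η
  have hD0 : 0 < D := by positivity
  have hEη : 1 / E ^ 2 ≤ η / 2 := by
    rw [one_div_le (by positivity) (by positivity), one_div_div]
    exact (le_add_of_nonneg_left zero_le_one).trans
      (le_self_pow₀ (le_add_of_nonneg_right (by positivity)) two_ne_zero)
  refine ⟨D + E, add_pos hD0 (by positivity), fun {n K π M} h hn hM => ?_⟩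
  obtain ⟨x, B, hB, hearly⟩ := h.exists_sum_pow_le_of_early hn hM (half_pos hη)
  refine ⟨x, B, by linarith, fun t ht0 ht => ?_⟩
  set α := √(hitVar K π M)
  have hα0 : 0 < α := zero_lt_one.trans_le (h.one_le_sqrt_hitVar hn)
  have htα : t ≤ α ^ 2 := by
    have hθα : hitMean K π M ≤ α ^ 2 := h.sq_sqrt_hitVar ▸ h.hitMean_le_hitVar
    have : 0 ≤ (D + E) * α := by positivity
    linarith
  calc ∑ y ∈ B, heat K t x y ≤ η / 2 + t / (E * α) ^ 2 := by
        refine poisson_average_le ht0 (by positivity) (by positivity)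
          (fun k => h.sum_pow_le_one k x B) (fun k hk => hearly k ?_) (hasSum_sum_heat K t x B)
        linarith [(abs_lt.1 hk).2]
    _ ≤ η / 2 + α ^ 2 / (E * α) ^ 2 := by gcongr
    _ = η / 2 + 1 / E ^ 2 := by field_simp
    _ ≤ η / 2 + η / 2 := by gcongr
    _ = η := add_halves η

lemma exp_le_maxTVc {n : ℕ} {K : Matrix (Fin (n + 1)) (Fin (n + 1)) ℝ} {π : Fin (n + 1) → ℝ}
    (h : IsBD K π) (hn : 1 ≤ n) (t : ℝ) :
    Real.exp (-spectralGap K * t) ≤ 2 * maxTVc K π t := by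
  obtain ⟨f, hf0, hf, hKf⟩ := h.exists_spectralGap_eigenfunction hn
  have hheat := heat_mulVec_eigen hKf t
  rw [sub_sub_cancel] at hheat
  rw [← abs_of_pos (Real.exp_pos (-spectralGap K * t))]
  exact abs_le_iSup_tvDist (h.heat_row_sum t) h.weight_sum hf0 hf hheat

end IsBD

end Poissonization

/-! ### Mixing times -/

section MixingTimes

namespace IsBD

lemma exists_maxTV_le {c δ ε : ℝ} (hc : 0 < c) (hδ : 0 < δ) (hε : 0 < ε) :
    ∃ D, 0 ≤ D ∧ ∀ {n : ℕ} {K : Matrix (Fin (n + 1)) (Fin (n + 1)) ℝ} {π : Fin (n + 1) → ℝ}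
      {M : Fin (n + 1)}, IsBD K π → 1 ≤ n → IsCentral π M c → (∀ x, δ ≤ K x x) →
      maxTV K π ⌈hitMean K π M + D * √(hitVar K π M)⌉₊ ≤ ε := by
  obtain ⟨D, hD, hlate⟩ := exists_forall_sum_pow_sub_le hc hδ hε
  exact ⟨D, by positivity, fun h hn hM hK => iSup_tvDist_le (hlate h hn hM hK _ (Nat.le_ceil _))⟩

lemma exists_maxTVc_le {c ε : ℝ} (hc : 0 < c) (hε : 0 < ε) :
    ∃ D, 0 ≤ D ∧ ∀ {n : ℕ} {K : Matrix (Fin (n + 1)) (Fin (n + 1)) ℝ} {π : Fin (n + 1) → ℝ}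
      {M : Fin (n + 1)}, IsBD K π → 1 ≤ n → IsCentral π M c →
      maxTVc K π (hitMean K π M + D * √(hitVar K π M)) ≤ ε := by
  obtain ⟨D, hD, hlate⟩ := exists_sum_heat_sub_le hc hε
  exact ⟨D, by positivity, fun h hn hM => iSup_tvDist_le (hlate h hn hM)⟩

theorem exists_abs_mixTime_sub_le {c δ ε : ℝ} (hc : 0 < c) (hδ : 0 < δ)
    (hε : ε ∈ Set.Ioo (0 : ℝ) 1) :
    ∃ D : ℝ, ∀ {n : ℕ} {K : Matrix (Fin (n + 1)) (Fin (n + 1)) ℝ} {π : Fin (n + 1) → ℝ}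
      {M : Fin (n + 1)}, IsBD K π → 1 ≤ n → IsCentral π M c → (∀ x, δ ≤ K x x) →
      |(mixTime K π ε : ℝ) - hitMean K π M| ≤ D * √(hitVar K π M) := by
  have hη : 0 < (1 - ε) / 4 := by linarith [hε.2]
  obtain ⟨D₁, hD₁, hlate⟩ := exists_maxTV_le hc hδ hε.1
  set D₂ : ℝ := 1 / (min c ((1 - ε) / 4) * c) + 1 / √((1 - ε) / 4)
  have hD₂ : 0 < D₂ := by positivity
  refine ⟨D₁ + 1 + D₂, fun {n K π M} h hn hM hK => ?_⟩
  set α := √(hitVar K π M)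
  have hα : 1 ≤ α := h.one_le_sqrt_hitVar hn
  have hθ : 1 ≤ hitMean K π M := h.one_le_hitMean hn
  have hmem : ⌈hitMean K π M + D₁ * α⌉₊ ∈ {m : ℕ | maxTV K π m ≤ ε} :=
    hlate h hn hM hK
  have hmix : maxTV K π (mixTime K π ε) ≤ ε := Nat.sInf_mem (s := {m | maxTV K π m ≤ ε}) ⟨_, hmem⟩
  have hupper : (mixTime K π ε : ℝ) < hitMean K π M + D₁ * α + 1 :=
    (Nat.cast_le.2 (Nat.sInf_le hmem)).trans_lt (Nat.ceil_lt_add_one (by positivity))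
  have hlower : hitMean K π M - D₂ * α < mixTime K π ε := by
    obtain ⟨x, B, hB, hearly⟩ := h.exists_sum_pow_le_of_early hn hM hη
    by_contra! hle
    have := one_sub_le_iSup_tvDist (h.pow_row_sum _ x) h.weight_sum hB (hearly _ hle)
    linarith [hε.2, this.trans hmix]
  have h₁ : 0 ≤ (D₁ + 1) * α := by positivity
  have h₂ : 0 ≤ D₂ * α := mul_nonneg hD₂.le (by positivity)
  rw [abs_le]
  constructor <;> linarith

theorem exists_abs_mixTimec_sub_le {c ε : ℝ} (hc : 0 < c) (hε : ε ∈ Set.Ioo (0 : ℝ) 1) :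
    ∃ D : ℝ, ∀ {n : ℕ} {K : Matrix (Fin (n + 1)) (Fin (n + 1)) ℝ} {π : Fin (n + 1) → ℝ}
      {M : Fin (n + 1)}, IsBD K π → 1 ≤ n → IsCentral π M c →
      |mixTimec K π ε - hitMean K π M| ≤ D * √(hitVar K π M) := by
  have hη : 0 < (1 - ε) / 4 := by linarith [hε.2]
  obtain ⟨D₁, hD₁, hlate⟩ := exists_maxTVc_le hc hε.1
  obtain ⟨D₂, hD₂, hearly⟩ := exists_sum_heat_le_of_early hc hη
  refine ⟨D₁ + D₂, fun {n K π M} h hn hM => ?_⟩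
  set α := √(hitVar K π M)
  have hθ : 1 ≤ hitMean K π M := h.one_le_hitMean hn
  have hmem : hitMean K π M + D₁ * α ∈ {t : ℝ | 0 ≤ t ∧ maxTVc K π t ≤ ε} :=
    ⟨by positivity, hlate h hn hM⟩
  have hupper : mixTimec K π ε ≤ hitMean K π M + D₁ * α := csInf_le ⟨0, fun t ht => ht.1⟩ hmem
  have hlower : hitMean K π M - D₂ * α ≤ mixTimec K π ε := by
    obtain ⟨x, B, hB, hB'⟩ := hearly h hn hM
    refine le_csInf ⟨_, hmem⟩ fun t ht => ?_
    by_contra! hlt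
    have := one_sub_le_iSup_tvDist (h.heat_row_sum t x) h.weight_sum hB (hB' t ht.1 hlt.le)
    linarith [hε.2, this.trans ht.2]
  have h₁ : 0 ≤ D₁ * α := by positivity
  have h₂ : 0 ≤ D₂ * α := mul_nonneg hD₂.le (by positivity)
  rw [abs_le]
  constructor <;> linarith

variable {n : ℕ} {K : Matrix (Fin (n + 1)) (Fin (n + 1)) ℝ} {π : Fin (n + 1) → ℝ}
  {M : Fin (n + 1)} {c δ ε : ℝ} (h : IsBD K π) (hn : 1 ≤ n)
include h hn

lemma maxTV_mixTime_le (hM : IsCentral π M c) (hδ : 0 < δ) (hK : ∀ x, δ ≤ K x x) (hε : 0 < ε) :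
    maxTV K π (mixTime K π ε) ≤ ε := by
  obtain ⟨D, -, hmix⟩ := exists_maxTV_le hM.pos hδ hε
  exact Nat.sInf_mem (s := {m | maxTV K π m ≤ ε}) ⟨_, hmix h hn hM hK⟩

lemma half_exp_le_maxTV (hgap : spectralGap K ≤ 1 / 2) (m : ℕ) :
    Real.exp (-(2 * (spectralGap K * m))) / 2 ≤ maxTV K π m := by
  set lam := spectralGap K
  have hexp : Real.exp (-(2 * lam)) ≤ 1 - lam := by
    have hlam : 0 < lam := h.spectralGap_pos hn
    rw [Real.exp_neg, inv_le_comm₀ (Real.exp_pos _) (by linarith)]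
    refine le_trans ?_ (Real.add_one_le_exp (2 * lam))
    rw [inv_le_iff_one_le_mul₀ (by linarith)]
    nlinarith
  have hpow : Real.exp (-(2 * (lam * m))) ≤ 2 * maxTV K π m :=
    calc Real.exp (-(2 * (lam * m))) = Real.exp (-(2 * lam)) ^ m := by
          rw [← Real.exp_nat_mul]
          ring_nf
      _ ≤ (1 - lam) ^ m := by gcongr
      _ ≤ 2 * maxTV K π m := (le_abs_self _).trans (h.abs_pow_le_maxTV hn _)
  linarith

/-- The relaxation bound `|1 - spectralGap K| ^ m ≤ 2 * maxTV K π m` says nothing when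
`spectralGap K` is close to `1`, whence the second alternative. -/
lemma log_le_spectralGap_mul_mixTime (hM : IsCentral π M c) (hδ : 0 < δ) (hK : ∀ x, δ ≤ K x x)
    (hε : 0 < ε) :
    Real.log (1 / (2 * ε)) ≤ 2 * (spectralGap K * mixTime K π ε) ∨ 1 / 2 ≤ spectralGap K := by
  refine or_iff_not_imp_right.2 fun hgap => ?_
  rw [one_div, Real.log_inv, neg_le, Real.le_log_iff_exp_le (by positivity)]
  linarith [h.half_exp_le_maxTV hn (le_of_not_ge hgap) (mixTime K π ε),
    h.maxTV_mixTime_le hn hM hδ hK hε]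

lemma log_le_spectralGap_mul_mixTimec (hM : IsCentral π M c) (hε : 0 < ε) :
    Real.log (1 / (2 * ε)) ≤ spectralGap K * mixTimec K π ε := by
  obtain ⟨D, hD, hmix⟩ := exists_maxTVc_le hM.pos hε
  have hθ : 1 ≤ hitMean K π M := h.one_le_hitMean hn
  rw [← div_le_iff₀' (h.spectralGap_pos hn)]
  refine le_csInf ⟨_, by positivity, hmix h hn hM⟩ fun t ht => ?_
  rw [div_le_iff₀' (h.spectralGap_pos hn), one_div, Real.log_inv, neg_le,
    Real.le_log_iff_exp_le (by positivity), ← neg_mul]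
  linarith [h.exp_le_maxTVc hn t, ht.2]

end IsBD

end MixingTimes

/-! ### Hitting times of the discrete time chain -/

section PathSpace

lemma killed_succ_last {ι : Type*} [Fintype ι] [DecidableEq ι] (K : Matrix ι ι ℝ) (z : ι)
    (f : ι → ℝ) (m : ℕ) (x : ι) :
    killed K z f (m + 1) x = killed K z (fun y => ∑ w, K y w * if w = z then 0 else f w) m x := by
  induction m generalizing x with
  | zero => simp only [killed]
  | succ m ih =>
    rw [killed, killed]
    simp only [ih]

variable {n : ℕ} (C : BirthDeathChain n) {x z : Fin (n + 1)}

instance (x : Fin (n + 1)) : IsProbabilityMeasure (chainLaw C x) := by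
  unfold chainLaw
  infer_instance

lemma lintegral_stepKernel (x : Fin (n + 1)) (g : Fin (n + 1) → ENNReal) :
    ∫⁻ y, g y ∂(stepKernel C x) = ∑ y, ENNReal.ofReal (C.K x y) * g y := by
  change ∫⁻ y, g y ∂(∑ y, ENNReal.ofReal (C.K x y) • Measure.dirac y) = _
  simp only [lintegral_finsetSum_measure, lintegral_smul_measure, lintegral_dirac, smul_eq_mul]

/-- The trajectory up to time `m`. -/
abbrev past (m : ℕ) (X : ℕ → Fin (n + 1)) : Finset.Iic m → Fin (n + 1) :=
  Preorder.frestrictLe (π := fun _ : ℕ => Fin (n + 1)) m X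

lemma ae_chainLaw_zero_eq (x : Fin (n + 1)) : ∀ᵐ X ∂(chainLaw C x), X 0 = x := by
  have hmap : (chainLaw C x).map (past 0) = Measure.dirac fun _ => x := by
    rw [chainLaw, Kernel.traj_map_frestrictLe_apply, Kernel.partialTraj_self, Kernel.id_apply]
  have hstart : ∀ᵐ h ∂((chainLaw C x).map (past 0)), h ⟨0, Finset.mem_Iic.2 le_rfl⟩ = x := by
    rw [hmap, ae_dirac_eq]
    rfl
  exact ae_of_ae_map (by fun_prop) hstart

lemma map_past_chainLaw_compProd (x : Fin (n + 1)) (m : ℕ) :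
    ((chainLaw C x).map (past m)) ⊗ₘ historyKernel C m =
      (chainLaw C x).map fun X => (past m X, X (m + 1)) := by
  have hpast := Kernel.traj_map_frestrictLe_apply (X := fun _ => Fin (n + 1))
    (κ := historyKernel C) 0 m fun _ => x
  have hnext := Kernel.partialTraj_compProd_eq_map_traj (X := fun _ => Fin (n + 1))
    (κ := historyKernel C) (Nat.zero_le m) (x₀ := fun _ => x)
  rw [← hpast] at hnext
  exact hnext

/-- The Markov property at time `m`. -/
lemma lintegral_chainLaw_succ (x : Fin (n + 1)) (m : ℕ)
    (G : (Finset.Iic m → Fin (n + 1)) → Fin (n + 1) → ENNReal) :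
    ∫⁻ X, G (past m X) (X (m + 1)) ∂(chainLaw C x) =
      ∫⁻ X, ∑ y, ENNReal.ofReal (C.K (X m) y) * G (past m X) y ∂(chainLaw C x) := by
  have hG : Measurable (Function.uncurry G) := measurable_of_countable _
  have hpast : Measurable (past (n := n) m) := by fun_prop
  calc
    _ = ∫⁻ p, Function.uncurry G p ∂((chainLaw C x).map fun X => (past m X, X (m + 1))) :=
      (lintegral_map hG (by fun_prop)).symm
    _ = ∫⁻ h, ∫⁻ y, G h y ∂(historyKernel C m h) ∂((chainLaw C x).map (past m)) := by
      rw [← map_past_chainLaw_compProd, Measure.lintegral_compProd hG]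
      rfl
    _ = ∫⁻ X, ∫⁻ y, G (past m X) y ∂(stepKernel C (X m)) ∂(chainLaw C x) :=
      lintegral_map (measurable_of_countable _) hpast
    _ = _ := lintegral_congr fun X => lintegral_stepKernel C _ _

/-- The set of trajectories that avoid `z` up to and including time `m`, i.e. the event
`{τ_z > m}`. -/
def avoid (z : Fin (n + 1)) (m : ℕ) : Set (ℕ → Fin (n + 1)) := {X | ∀ k ≤ m, X k ≠ z}

lemma measurableSet_avoid (z : Fin (n + 1)) (m : ℕ) : MeasurableSet (avoid z m) := by
  have : avoid z m = ⋂ k, ⋂ _ : k ≤ m, (fun X : ℕ → Fin (n + 1) => X k) ⁻¹' {z}ᶜ := by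
    ext X
    simp [avoid]
  rw [this]
  exact MeasurableSet.iInter fun k => MeasurableSet.iInter fun _ =>
    measurable_pi_apply k MeasurableSet.of_discrete

lemma mem_avoid_succ {m : ℕ} {X : ℕ → Fin (n + 1)} :
    X ∈ avoid z (m + 1) ↔ X ∈ avoid z m ∧ X (m + 1) ≠ z := by
  simp only [avoid, Nat.le_succ_iff_eq_or_le, Set.mem_ofPred_eq, forall_eq_or_imp, and_comm]

lemma lintegral_indicator_avoid_succ (x z : Fin (n + 1)) (m : ℕ) {f : Fin (n + 1) → ℝ}
    (hf : ∀ y, 0 ≤ f y) :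
    ∫⁻ X, (avoid z (m + 1)).indicator (fun X => ENNReal.ofReal (f (X (m + 1)))) X
        ∂(chainLaw C x) =
      ∫⁻ X, (avoid z m).indicator
        (fun X => ENNReal.ofReal (∑ y, C.K (X m) y * if y = z then 0 else f y)) X
        ∂(chainLaw C x) := by
  let S : Set (Finset.Iic m → Fin (n + 1)) := {h | ∀ k, h k ≠ z}
  have hS : ∀ X, past m X ∈ S ↔ X ∈ avoid z m := fun X =>
    ⟨fun H k hk => H ⟨k, Finset.mem_Iic.2 hk⟩, fun H k => H k (Finset.mem_Iic.1 k.2)⟩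
  have hg : ∀ y, 0 ≤ if y = z then 0 else f y := fun y => by split_ifs <;> simp [hf]
  have hmarkov := lintegral_chainLaw_succ C x m
    fun h y => S.indicator (fun _ => ENNReal.ofReal (if y = z then 0 else f y)) h
  refine Eq.trans (lintegral_congr fun X => ?_)
    (hmarkov.trans (lintegral_congr fun X => ?_))
  · by_cases h₁ : X ∈ avoid z m <;> by_cases h₂ : X (m + 1) = z <;>
      simp [Set.indicator, mem_avoid_succ, hS, h₁, h₂]
  · by_cases hX : X ∈ avoid z m
    · simp only [Set.indicator, hS, hX, if_true]
      rw [ENNReal.ofReal_sum_of_nonneg fun y _ => mul_nonneg (C.nonneg _ y) (hg y)]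
      simp only [ENNReal.ofReal_mul (C.nonneg _ _)]
    · simp [Set.indicator, hS, hX]

lemma lintegral_indicator_avoid (x z : Fin (n + 1)) (m : ℕ) {f : Fin (n + 1) → ℝ}
    (hf : ∀ y, 0 ≤ f y) :
    ∫⁻ X, (avoid z m).indicator (fun X => ENNReal.ofReal (f (X m))) X ∂(chainLaw C x) =
      ENNReal.ofReal (killed C.K z f m x) := by
  induction m generalizing f with
  | zero =>
    have hstart : ∀ᵐ X ∂(chainLaw C x),
        (avoid z 0).indicator (fun X => ENNReal.ofReal (f (X 0))) X =
          ENNReal.ofReal (killed C.K z f 0 x) := by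
      filter_upwards [ae_chainLaw_zero_eq C x] with X hX
      by_cases hx : x = z <;> simp [Set.indicator, avoid, killed, hX, hx]
    rw [lintegral_congr_ae hstart, lintegral_const, measure_univ, mul_one]
  | succ m ih =>
    rw [lintegral_indicator_avoid_succ C x z m hf, killed_succ_last]
    refine ih fun y => Finset.sum_nonneg (f := fun w => C.K y w * if w = z then 0 else f w)
      fun w _ => mul_nonneg (C.nonneg y w) ?_
    split_ifs <;> simp [hf]

lemma chainLaw_avoid (x z : Fin (n + 1)) (m : ℕ) :
    chainLaw C x (avoid z m) = ENNReal.ofReal (surv C.K z m x) := by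
  rw [surv, ← lintegral_indicator_avoid C x z m fun _ => zero_le_one, ENNReal.ofReal_one,
    lintegral_indicator (measurableSet_avoid z m), setLIntegral_one]

/-- The hitting time `hit z`, as a natural number. It is `0` on the trajectories that never
visit `z`. -/
def hitNat (z : Fin (n + 1)) (X : ℕ → Fin (n + 1)) : ℕ := sInf {m : ℕ | X m = z}

lemma lt_hitNat_iff {X : ℕ → Fin (n + 1)} (hX : ∃ m, X m = z) (k : ℕ) :
    k < hitNat z X ↔ X ∈ avoid z k := by
  refine ⟨fun hk j hj hz => ?_, fun h => ?_⟩
  · exact (hj.trans_lt hk).not_ge (Nat.sInf_le (s := {m : ℕ | X m = z}) hz)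
  · by_contra! hk
    exact h _ hk (Nat.sInf_mem (s := {m : ℕ | X m = z}) hX)

lemma measurable_hitNat (z : Fin (n + 1)) : Measurable (hitNat z) := by
  have hvisit : {X : ℕ → Fin (n + 1) | ∃ m, X m = z} = ⋃ m, (fun X => X m) ⁻¹' {z} := by
    ext X
    simp
  have hmeas : MeasurableSet {X : ℕ → Fin (n + 1) | ∃ m, X m = z} :=
    hvisit ▸ MeasurableSet.iUnion fun m => measurable_pi_apply m MeasurableSet.of_discrete
  refine measurable_of_Ioi fun k => ?_
  have hlevel : hitNat z ⁻¹' Set.Ioi k = {X | ∃ m, X m = z} ∩ avoid z k := by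
    ext X
    by_cases hX : ∃ m, X m = z
    · simpa [hX] using lt_hitNat_iff hX k
    · have hzero : hitNat z X = 0 := by
        simpa [hitNat, Set.eq_empty_iff_forall_notMem] using Or.inr hX
      simp [hzero, hX]
  exact hlevel ▸ hmeas.inter (measurableSet_avoid z k)

lemma measurable_hit (z : Fin (n + 1)) : Measurable (hit z) :=
  measurable_from_nat.comp (measurable_hitNat z)

variable {C}

lemma ae_exists_hit (h : Tendsto (fun m => surv C.K z m x) atTop (𝓝 0)) :
    ∀ᵐ X ∂(chainLaw C x), ∃ m, X m = z := by
  rw [ae_iff]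
  have hle : ∀ m, chainLaw C x {X | ¬ ∃ m, X m = z} ≤ ENNReal.ofReal (surv C.K z m x) := by
    intro m
    rw [← chainLaw_avoid]
    exact measure_mono fun X hX k _ hk => hX ⟨k, hk⟩
  have hlim := ENNReal.tendsto_ofReal h
  rw [ENNReal.ofReal_zero] at hlim
  exact le_antisymm (ge_of_tendsto' hlim hle) bot_le

/-- Layer cake formula: take `a = 1` for the mean of the hitting time and `a k = 2 * k + 1` for its
second moment. -/
lemma lintegral_sum_range_hitNat {a : ℕ → ℝ} {S : ℝ}
    (h : Tendsto (fun m => surv C.K z m x) atTop (𝓝 0)) (ha : ∀ k, 0 ≤ a k)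
    (hS : HasSum (fun k => a k * surv C.K z k x) S) :
    ∫⁻ X, ENNReal.ofReal (∑ k ∈ Finset.range (hitNat z X), a k) ∂(chainLaw C x) =
      ENNReal.ofReal S := by
  have hlayer : ∀ᵐ X ∂(chainLaw C x), ENNReal.ofReal (∑ k ∈ Finset.range (hitNat z X), a k) =
      ∑' k, (avoid z k).indicator (fun _ => ENNReal.ofReal (a k)) X := by
    filter_upwards [ae_exists_hit h] with X hX
    have hmem : ∀ k, k ∈ Finset.range (hitNat z X) ↔ X ∈ avoid z k := fun k =>
      Finset.mem_range.trans (lt_hitNat_iff hX k)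
    rw [ENNReal.ofReal_sum_of_nonneg fun k _ => ha k, tsum_eq_sum fun k hk =>
      Set.indicator_of_notMem (mt (hmem k).2 hk) _]
    exact Finset.sum_congr rfl fun k hk =>
      (Set.indicator_of_mem ((hmem k).1 hk) fun _ => ENNReal.ofReal (a k)).symm
  rw [lintegral_congr_ae hlayer, lintegral_tsum
    fun k => (measurable_const.indicator (measurableSet_avoid z k)).aemeasurable,
    ← hS.tsum_eq, ENNReal.ofReal_tsum_of_nonneg
    (fun k => mul_nonneg (ha k) (surv_nonneg C.nonneg k x)) hS.summable]
  refine tsum_congr fun k => ?_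
  rw [lintegral_indicator (measurableSet_avoid z k), setLIntegral_const, chainLaw_avoid,
    ENNReal.ofReal_mul (ha k)]

lemma integrable_and_integral_eq_of_lintegral {Ω : Type*} [MeasurableSpace Ω]
    {μ : Measure Ω} {f : Ω → ℝ} (hf : AEStronglyMeasurable f μ) (hf₀ : ∀ᵐ ω ∂μ, 0 ≤ f ω) {S : ℝ}
    (hS : 0 ≤ S) (h : ∫⁻ ω, ENNReal.ofReal (f ω) ∂μ = ENNReal.ofReal S) :
    Integrable f μ ∧ ∫ ω, f ω ∂μ = S :=
  ⟨⟨hf, by rw [hasFiniteIntegral_iff_ofReal hf₀, h]; exact ENNReal.ofReal_lt_top⟩,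
    by rw [integral_eq_lintegral_of_nonneg_ae hf₀ hf, h, ENNReal.toReal_ofReal hS]⟩

lemma integral_hit {a : ℝ} (ha : HasSum (fun k => surv C.K z k x) a) :
    ∫ X, hit z X ∂(chainLaw C x) = a := by
  have hmean := lintegral_sum_range_hitNat ha.summable.tendsto_atTop_zero (a := fun _ => 1)
    (fun _ => zero_le_one) (by simpa only [one_mul] using ha)
  simp only [Finset.sum_const, Finset.card_range, nsmul_eq_mul, mul_one] at hmean
  exact (integrable_and_integral_eq_of_lintegral (f := hit z)
    (measurable_hit z).aestronglyMeasurable (ae_of_all _ fun X => Nat.cast_nonneg _)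
    (ha.nonneg fun k => surv_nonneg C.nonneg k x) hmean).2

lemma sum_range_odd (m : ℕ) : ∑ k ∈ Finset.range m, (2 * k + 1 : ℝ) = (m : ℝ) ^ 2 := by
  induction m with
  | zero => simp
  | succ m ih =>
    rw [Finset.sum_range_succ, ih]
    push_cast
    ring

lemma integrable_hit_sq_and_integral_eq {b : ℝ}
    (hs : Tendsto (fun m => surv C.K z m x) atTop (𝓝 0))
    (hb : HasSum (fun k : ℕ => (2 * k + 1 : ℝ) * surv C.K z k x) b) :
    Integrable (fun X => hit z X ^ 2) (chainLaw C x) ∧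
      ∫ X, hit z X ^ 2 ∂(chainLaw C x) = b := by
  have hsq := lintegral_sum_range_hitNat hs (a := fun k => 2 * k + 1) (fun k => by positivity) hb
  simp only [sum_range_odd] at hsq
  exact integrable_and_integral_eq_of_lintegral (f := fun X => hit z X ^ 2)
    ((measurable_hit z).pow_const 2).aestronglyMeasurable (ae_of_all _ fun X => sq_nonneg _)
    (hb.nonneg fun k => mul_nonneg (by positivity) (surv_nonneg C.nonneg k x)) hsq

lemma memLp_hit {b : ℝ} (hs : Tendsto (fun m => surv C.K z m x) atTop (𝓝 0))
    (hb : HasSum (fun k : ℕ => (2 * k + 1 : ℝ) * surv C.K z k x) b) :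
    MemLp (hit z) 2 (chainLaw C x) :=
  (memLp_two_iff_integrable_sq (measurable_hit z).aestronglyMeasurable).2
    (integrable_hit_sq_and_integral_eq hs hb).1

lemma variance_hit {a b : ℝ} (ha : HasSum (fun k => surv C.K z k x) a)
    (hb : HasSum (fun k : ℕ => (2 * k + 1 : ℝ) * surv C.K z k x) b) :
    variance (hit z) (chainLaw C x) = b - a ^ 2 := by
  have hs := ha.summable.tendsto_atTop_zero
  rw [variance_eq_sub (memLp_hit hs hb), integral_hit ha,
    ← (integrable_hit_sq_and_integral_eq hs hb).2]
  rfl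

end PathSpace

/-! ### The Poisson clock -/

section Clock

lemma ae_pos_expMeasure {r : ℝ} (hr : 0 < r) : ∀ᵐ x ∂(expMeasure r), 0 < x := by
  have := isProbabilityMeasure_expMeasure hr
  have hIic : expMeasure r (Set.Iic 0) = 0 := by
    rw [← ofReal_cdf, cdf_expMeasure_eq hr, mul_zero, neg_zero, Real.exp_zero, sub_self, ite_self,
      ENNReal.ofReal_zero]
  simpa only [ae_iff, not_lt, Set.Iic] using hIic

lemma lintegral_pow_expMeasure {r : ℝ} (hr : 0 < r) (k : ℕ) :
    ∫⁻ x, ENNReal.ofReal (x ^ k) ∂(expMeasure r) = ENNReal.ofReal (k.factorial / r ^ k) := by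
  have hgamma : ∀ x, gammaPDF 1 r x * ENNReal.ofReal (x ^ k) =
      ENNReal.ofReal (k.factorial / r ^ k) * gammaPDF (k + 1) r x := fun x => by
    rcases lt_or_ge x 0 with hx | hx
    · rw [gammaPDF_of_neg hx, gammaPDF_of_neg hx, zero_mul, mul_zero]
    · rw [gammaPDF_of_nonneg hx, gammaPDF_of_nonneg hx, ← ENNReal.ofReal_mul (by positivity),
        ← ENNReal.ofReal_mul (by positivity), Real.Gamma_nat_eq_factorial, Real.Gamma_one,
        add_sub_cancel_right, sub_self, Real.rpow_zero, Real.rpow_one, Real.rpow_natCast,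
        Real.rpow_add_one hr.ne', Real.rpow_natCast]
      congr 1
      field_simp
  calc ∫⁻ x, ENNReal.ofReal (x ^ k) ∂(expMeasure r)
      = ∫⁻ x, gammaPDF 1 r x * ENNReal.ofReal (x ^ k) :=
        lintegral_withDensity_eq_lintegral_mul _
          (measurable_gammaPDFReal 1 r).ennreal_ofReal (by fun_prop)
    _ = ENNReal.ofReal (k.factorial / r ^ k) * ∫⁻ x, gammaPDF (k + 1) r x := by
        simp only [hgamma]
        exact lintegral_const_mul _ (measurable_gammaPDFReal _ r).ennreal_ofReal
    _ = ENNReal.ofReal (k.factorial / r ^ k) := by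
        rw [lintegral_gammaPDF_eq_one (by positivity) hr, mul_one]

lemma integrable_pow_expMeasure_and_integral_eq {r : ℝ} (hr : 0 < r) (k : ℕ) :
    Integrable (fun x => x ^ k) (expMeasure r) ∧
      ∫ x, x ^ k ∂(expMeasure r) = k.factorial / r ^ k :=
  integrable_and_integral_eq_of_lintegral (by fun_prop)
    ((ae_pos_expMeasure hr).mono fun x hx => by positivity) (by positivity)
    (lintegral_pow_expMeasure hr k)

instance : IsProbabilityMeasure (expMeasure 1) := isProbabilityMeasure_expMeasure one_pos

instance : IsProbabilityMeasure clockLaw := by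
  unfold clockLaw
  infer_instance

lemma measurePreserving_clock (l : ℕ) :
    MeasurePreserving (fun ξ : ℕ → ℝ => ξ l) clockLaw (expMeasure 1) :=
  measurePreserving_eval_infinitePi (fun _ : ℕ => expMeasure 1) l

lemma ae_clock_pos : ∀ᵐ ξ ∂clockLaw, ∀ l, 0 < ξ l :=
  ae_all_iff.2 fun l =>
    (measurePreserving_clock l).quasiMeasurePreserving.ae (ae_pos_expMeasure one_pos)

lemma memLp_clock (l : ℕ) : MemLp (fun ξ : ℕ → ℝ => ξ l) 2 clockLaw :=
  ((memLp_two_iff_integrable_sq aestronglyMeasurable_id).2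
    (integrable_pow_expMeasure_and_integral_eq one_pos 2).1).comp_measurePreserving
    (measurePreserving_clock l)

lemma integral_clock_pow (l k : ℕ) : ∫ ξ, ξ l ^ k ∂clockLaw = k.factorial := by
  have hpow := (integrable_pow_expMeasure_and_integral_eq one_pos k).2
  rw [← (measurePreserving_clock l).map_eq, integral_map
    (measurePreserving_clock l).aemeasurable (by fun_prop), one_pow, div_one] at hpow
  exact hpow

lemma integral_clock (l : ℕ) : ∫ ξ, ξ l ∂clockLaw = 1 := by
  simpa using integral_clock_pow l 1

lemma variance_clock (l : ℕ) : variance (fun ξ : ℕ → ℝ => ξ l) clockLaw = 1 := by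
  have hsq := integral_clock_pow l 2
  rw [variance_eq_sub (memLp_clock l), integral_clock]
  simp only [Pi.pow_apply, hsq]
  norm_num

/-- The time of the `k`-th jump of the Poisson process, with the convention that the `0`-th one
is at time `0`. -/
def arrival (k : ℕ) (ξ : ℕ → ℝ) : ℝ := ∑ l ∈ Finset.range k, ξ l

lemma arrival_nonneg {ξ : ℕ → ℝ} (hξ : ∀ l, 0 < ξ l) (k : ℕ) : 0 ≤ arrival k ξ :=
  Finset.sum_nonneg fun l _ => (hξ l).le

lemma measurable_arrival (k : ℕ) : Measurable (arrival k) := by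
  unfold arrival
  fun_prop

lemma memLp_arrival (k : ℕ) : MemLp (arrival k) 2 clockLaw :=
  memLp_finsetSum _ fun l _ => memLp_clock l

lemma integral_arrival (k : ℕ) : ∫ ξ, arrival k ξ ∂clockLaw = k := by
  simp only [arrival, integral_finsetSum _ fun l _ => (memLp_clock l).integrable one_le_two,
    integral_clock, Finset.sum_const, Finset.card_range, nsmul_eq_mul, mul_one]

lemma variance_arrival (k : ℕ) : variance (arrival k) clockLaw = k := by
  have hindep : iIndepFun (fun (l : ℕ) (ξ : ℕ → ℝ) => ξ l) clockLaw :=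
    iIndepFun_infinitePi (P := fun _ : ℕ => expMeasure 1) (X := fun _ x => x) fun _ => measurable_id
  have hsum := IndepFun.variance_sum (s := Finset.range k) (fun l _ => memLp_clock l)
    fun i _ j _ hij => hindep.indepFun hij
  simp only [variance_clock, Finset.sum_const, Finset.card_range, nsmul_eq_mul, mul_one] at hsum
  rw [← hsum]
  congr 1
  ext ξ
  rw [arrival, Finset.sum_apply]

lemma integral_arrival_sq (k : ℕ) : ∫ ξ, arrival k ξ ^ 2 ∂clockLaw = (k : ℝ) ^ 2 + k := by
  have hvar := variance_eq_sub (memLp_arrival k)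
  rw [variance_arrival, integral_arrival] at hvar
  simp only [Pi.pow_apply] at hvar
  linarith

lemma lintegral_arrival (k : ℕ) :
    ∫⁻ ξ, ENNReal.ofReal (arrival k ξ) ∂clockLaw = ENNReal.ofReal k := by
  rw [← ofReal_integral_eq_lintegral_ofReal ((memLp_arrival k).integrable one_le_two)
    (ae_clock_pos.mono fun ξ hξ => arrival_nonneg hξ k), integral_arrival]

lemma lintegral_arrival_sq (k : ℕ) :
    ∫⁻ ξ, ENNReal.ofReal (arrival k ξ ^ 2) ∂clockLaw = ENNReal.ofReal ((k : ℝ) ^ 2 + k) := by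
  rw [← ofReal_integral_eq_lintegral_ofReal (memLp_arrival k).integrable_sq
    (ae_of_all _ fun ξ => sq_nonneg _), integral_arrival_sq]

section Sampled

variable {Ω : Type*} [MeasurableSpace Ω] {μ : Measure Ω} {N : Ω → ℕ}

lemma measurable_arrival_comp (hN : Measurable N) :
    Measurable fun ω : Ω × (ℕ → ℝ) => arrival (N ω.1) ω.2 :=
  (measurable_from_prod_countable_right (f := fun p : ℕ × (ℕ → ℝ) => arrival p.1 p.2)
    measurable_arrival).comp
    ((hN.comp measurable_fst).prodMk measurable_snd)

lemma integral_arrival_comp (hN : Measurable N) (hint : Integrable (fun ω => (N ω : ℝ)) μ) :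
    ∫ ω, arrival (N ω.1) ω.2 ∂(μ.prod clockLaw) = ∫ ω, (N ω : ℝ) ∂μ := by
  have hmeas := measurable_arrival_comp hN
  refine (integrable_and_integral_eq_of_lintegral hmeas.aestronglyMeasurable
    ((Measure.quasiMeasurePreserving_snd.ae ae_clock_pos).mono fun ω hω => arrival_nonneg hω _)
    (integral_nonneg fun ω => Nat.cast_nonneg _) ?_).2
  rw [lintegral_prod _ hmeas.ennreal_ofReal.aemeasurable,
    ofReal_integral_eq_lintegral_ofReal hint (ae_of_all _ fun ω => Nat.cast_nonneg _)]
  simp only [lintegral_arrival]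

variable [IsProbabilityMeasure μ]

lemma integrable_arrival_comp_sq_and_integral_eq (hN : Measurable N)
    (hL2 : MemLp (fun ω => (N ω : ℝ)) 2 μ) :
    Integrable (fun ω => arrival (N ω.1) ω.2 ^ 2) (μ.prod clockLaw) ∧
      ∫ ω, arrival (N ω.1) ω.2 ^ 2 ∂(μ.prod clockLaw) =
        ∫ ω, (N ω : ℝ) ^ 2 ∂μ + ∫ ω, (N ω : ℝ) ∂μ := by
  have hmeas := (measurable_arrival_comp hN).pow_const 2
  have hint := hL2.integrable one_le_two
  have hnonneg : ∀ ω, 0 ≤ (N ω : ℝ) ^ 2 + N ω := fun ω => by positivity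
  rw [← integral_add hL2.integrable_sq hint]
  refine integrable_and_integral_eq_of_lintegral hmeas.aestronglyMeasurable
    (ae_of_all _ fun ω => sq_nonneg _) (integral_nonneg hnonneg) ?_
  rw [lintegral_prod _ hmeas.ennreal_ofReal.aemeasurable,
    ofReal_integral_eq_lintegral_ofReal (f := fun ω => (N ω : ℝ) ^ 2 + N ω)
      (hL2.integrable_sq.add hint) (ae_of_all _ hnonneg)]
  simp only [lintegral_arrival_sq]

lemma memLp_arrival_comp (hN : Measurable N) (hL2 : MemLp (fun ω => (N ω : ℝ)) 2 μ) :
    MemLp (fun ω => arrival (N ω.1) ω.2) 2 (μ.prod clockLaw) :=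
  (memLp_two_iff_integrable_sq (measurable_arrival_comp hN).aestronglyMeasurable).2
    (integrable_arrival_comp_sq_and_integral_eq hN hL2).1

lemma variance_arrival_comp (hN : Measurable N) (hL2 : MemLp (fun ω => (N ω : ℝ)) 2 μ) :
    variance (fun ω => arrival (N ω.1) ω.2) (μ.prod clockLaw) =
      variance (fun ω => (N ω : ℝ)) μ + ∫ ω, (N ω : ℝ) ∂μ := by
  rw [variance_eq_sub (memLp_arrival_comp hN hL2), variance_eq_sub hL2,
    integral_arrival_comp hN (hL2.integrable one_le_two)]
  simp only [Pi.pow_apply, (integrable_arrival_comp_sq_and_integral_eq hN hL2).2]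
  ring

end Sampled

lemma arrival_strictMono {ξ : ℕ → ℝ} (hξ : ∀ l, 0 < ξ l) : StrictMono fun k => arrival k ξ :=
  strictMono_nat_of_lt_succ fun k => by
    rw [arrival, arrival, Finset.sum_range_succ]
    exact lt_add_of_pos_right _ (hξ k)

lemma poissonProcess_arrival {ξ : ℕ → ℝ} (hξ : ∀ l, 0 < ξ l) (k : ℕ) :
    poissonProcess ξ (arrival k ξ) = k := by
  have hjumps : {j : ℕ | ∑ l ∈ Finset.range (j + 1), ξ l ≤ arrival k ξ} = Finset.range k := by
    ext j
    rw [Finset.mem_coe, Finset.mem_range, ← Nat.succ_le_iff]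
    exact (arrival_strictMono hξ).le_iff_le
  rw [poissonProcess, hjumps, Set.ncard_coe_finset, Finset.card_range]

lemma poissonProcess_lt {ξ : ℕ → ℝ} (hξ : ∀ l, 0 < ξ l) {k : ℕ} {t : ℝ} (ht₀ : 0 ≤ t)
    (ht : t < arrival k ξ) : poissonProcess ξ t < k := by
  have hk : k ≠ 0 := by
    rintro rfl
    exact ht₀.not_gt ht
  have hjumps : {j : ℕ | ∑ l ∈ Finset.range (j + 1), ξ l ≤ t} ⊆ Finset.range (k - 1) := by
    intro j hj
    have := (arrival_strictMono hξ).lt_iff_lt.1 ((show arrival (j + 1) ξ ≤ t from hj).trans_lt ht)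
    exact Finset.mem_coe.2 (Finset.mem_range.2 (by omega))
  have hcard := Set.ncard_le_ncard hjumps (Finset.finite_toSet _)
  rw [Set.ncard_coe_finset, Finset.card_range] at hcard
  rw [poissonProcess]
  omega

end Clock

/-! ### Hitting times of the continuous time chain -/

section ContinuousTime

variable {n : ℕ} {C : BirthDeathChain n} {x z : Fin (n + 1)}

lemma isLeast_arrival_hitNat {X : ℕ → Fin (n + 1)} {ξ : ℕ → ℝ} (hX : ∃ m, X m = z)
    (hξ : ∀ l, 0 < ξ l) :
    IsLeast {t : ℝ | 0 ≤ t ∧ X (poissonProcess ξ t) = z} (arrival (hitNat z X) ξ) := by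
  have hz : X (hitNat z X) = z := Nat.sInf_mem (s := {m : ℕ | X m = z}) hX
  refine ⟨⟨arrival_nonneg hξ _, by rwa [poissonProcess_arrival hξ]⟩, fun t ht => ?_⟩
  by_contra! hlt
  exact (poissonProcess_lt hξ ht.1 hlt).not_ge (Nat.sInf_le ht.2)

lemma ae_jointLaw_isLeast_arrival (hex : ∀ᵐ X ∂(chainLaw C x), ∃ m, X m = z) :
    ∀ᵐ ω ∂(jointLaw C x), IsLeast {t : ℝ | 0 ≤ t ∧ ω.1 (poissonProcess ω.2 t) = z}
      (arrival (hitNat z ω.1) ω.2) := by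
  unfold jointLaw
  filter_upwards [Measure.quasiMeasurePreserving_fst.ae hex,
    Measure.quasiMeasurePreserving_snd.ae ae_clock_pos] with ω hX hξ
  exact isLeast_arrival_hitNat hX hξ

lemma ae_jointLaw_exists_hit (hex : ∀ᵐ X ∂(chainLaw C x), ∃ m, X m = z) :
    ∀ᵐ ω ∂(jointLaw C x), ∃ t, 0 ≤ t ∧ ω.1 (poissonProcess ω.2 t) = z :=
  (ae_jointLaw_isLeast_arrival hex).mono fun _ hω => ⟨_, hω.1⟩

lemma hitc_ae_eq_arrival (hex : ∀ᵐ X ∂(chainLaw C x), ∃ m, X m = z) :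
    hitc z =ᵐ[(chainLaw C x).prod clockLaw] fun ω => arrival (hitNat z ω.1) ω.2 :=
  (ae_jointLaw_isLeast_arrival hex).mono fun _ hω => hω.csInf_eq

lemma memLp_hitc (hex : ∀ᵐ X ∂(chainLaw C x), ∃ m, X m = z)
    (hL2 : MemLp (hit z) 2 (chainLaw C x)) : MemLp (hitc z) 2 (jointLaw C x) :=
  (memLp_congr_ae (hitc_ae_eq_arrival hex)).2 (memLp_arrival_comp (measurable_hitNat z) hL2)

lemma integral_hitc (hex : ∀ᵐ X ∂(chainLaw C x), ∃ m, X m = z)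
    (hL2 : MemLp (hit z) 2 (chainLaw C x)) :
    ∫ ω, hitc z ω ∂(jointLaw C x) = ∫ X, hit z X ∂(chainLaw C x) :=
  (integral_congr_ae (hitc_ae_eq_arrival hex)).trans
    (integral_arrival_comp (measurable_hitNat z) (hL2.integrable one_le_two))

lemma variance_hitc (hex : ∀ᵐ X ∂(chainLaw C x), ∃ m, X m = z)
    (hL2 : MemLp (hit z) 2 (chainLaw C x)) :
    variance (hitc z) (jointLaw C x) =
      variance (hit z) (chainLaw C x) + ∫ X, hit z X ∂(chainLaw C x) :=
  (variance_congr (hitc_ae_eq_arrival hex)).trans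
    (variance_arrival_comp (measurable_hitNat z) hL2)

end ContinuousTime

/-! ### Mean and variance of the hitting times -/

section Hitting

variable {n : ℕ} {K : Matrix (Fin (n + 1)) (Fin (n + 1)) ℝ} {C : BirthDeathChain n}
  {π : Fin (n + 1) → ℝ} {x z : Fin (n + 1)} {a b : ℝ}

/-- The larger of the variances of the two discrete hitting times of `M` from the ends; the
continuous counterpart is `hitVar`. -/
def stepVar (K : Matrix (Fin (n + 1)) (Fin (n + 1)) ℝ) (π : Fin (n + 1) → ℝ) (M : Fin (n + 1)) :
    ℝ :=
  max (upVar K π M 0 - upMean K π M 0)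
    (upVar (revK K) (revW π) M.rev 0 - upMean (revK K) (revW π) M.rev 0)

lemma IsBD.stepVar_le_hitVar (h : IsBD K π) (M : Fin (n + 1)) : stepVar K π M ≤ hitVar K π M :=
  max_le_max (sub_le_self _ (h.upMean_nonneg M 0)) (sub_le_self _ (h.rev.upMean_nonneg M.rev 0))

lemma IsBD.mul_hitVar_le_stepVar (h : IsBD K π) {δ : ℝ} (hδ : 0 ≤ δ) (hK : ∀ x, δ ≤ K x x)
    (M : Fin (n + 1)) : δ * hitVar K π M ≤ stepVar K π M := by
  have hup := h.upMean_le_mul_upVar hK M.is_le 0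
  have hdown := h.rev.upMean_le_mul_upVar (δ := δ) (fun x => hK _) M.rev.is_le 0
  rw [hitVar, mul_max_of_nonneg _ _ hδ]
  exact max_le_max (by linarith) (by linarith)

lemma IsBD.hasSum_surv_last_upMean (h : IsBD K π) (M : Fin (n + 1)) :
    HasSum (fun k => surv K M k (Fin.last n)) (upMean (revK K) (revW π) M.rev 0) := by
  simpa only [← surv_rev (z := M) _ (Fin.last n), Fin.rev_last, Fin.val_zero] using
    h.rev.hasSum_surv_upMean (Fin.zero_le M.rev)

lemma IsBD.hasSum_surv_last_upVar (h : IsBD K π) (M : Fin (n + 1)) :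
    HasSum (fun k : ℕ => (2 * k + 1 : ℝ) * surv K M k (Fin.last n))
      (upVar (revK K) (revW π) M.rev 0 - upMean (revK K) (revW π) M.rev 0 +
        upMean (revK K) (revW π) M.rev 0 ^ 2) := by
  simpa only [← surv_rev (z := M) _ (Fin.last n), Fin.rev_last, Fin.val_zero] using
    h.rev.hasSum_surv_upVar (Fin.zero_le M.rev)

lemma hitRegular_of_hasSum (ha : HasSum (fun k => surv C.K z k x) a)
    (hb : HasSum (fun k : ℕ => (2 * k + 1 : ℝ) * surv C.K z k x) b) : HitRegular C x z := by
  have hsurv := ha.summable.tendsto_atTop_zero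
  have hex := ae_exists_hit hsurv
  have hL2 := memLp_hit hsurv hb
  exact ⟨hex, ae_jointLaw_exists_hit hex, hL2, memLp_hitc hex hL2⟩

lemma HitRegular.integral_hitc (h : HitRegular C x z) :
    ∫ ω, hitc z ω ∂(jointLaw C x) = ∫ X, hit z X ∂(chainLaw C x) :=
  BDCutoff.integral_hitc h.1 h.2.2.1

lemma variance_hitc_of_hasSum (ha : HasSum (fun k => surv C.K z k x) a)
    (hb : HasSum (fun k : ℕ => (2 * k + 1 : ℝ) * surv C.K z k x) (b - a + a ^ 2)) :
    variance (hitc z) (jointLaw C x) = b := by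
  have hreg := hitRegular_of_hasSum ha hb
  rw [variance_hitc hreg.1 hreg.2.2.1, variance_hit ha hb, integral_hit ha]
  ring

lemma variance_hit_of_hasSum (ha : HasSum (fun k => surv C.K z k x) a)
    (hb : HasSum (fun k : ℕ => (2 * k + 1 : ℝ) * surv C.K z k x) (b - a + a ^ 2)) :
    variance (hit z) (chainLaw C x) = b - a := by
  rw [variance_hit ha hb, add_sub_cancel_right]

namespace IsBD

variable (h : IsBD C.K π) (M : Fin (n + 1))
include h

lemma hitRegular_zero : HitRegular C 0 M :=
  hitRegular_of_hasSum (h.hasSum_surv_upMean (Fin.zero_le M)) (h.hasSum_surv_upVar (Fin.zero_le M))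

lemma hitRegular_last : HitRegular C (Fin.last n) M :=
  hitRegular_of_hasSum (h.hasSum_surv_last_upMean M) (h.hasSum_surv_last_upVar M)

lemma theta_eq_thetac : theta C M = thetac C M := by
  rw [theta, thetac, (h.hitRegular_zero M).integral_hitc, (h.hitRegular_last M).integral_hitc]

lemma theta_eq : theta C M = hitMean C.K π M := by
  rw [theta, integral_hit (h.hasSum_surv_upMean (Fin.zero_le M)),
    integral_hit (h.hasSum_surv_last_upMean M), hitMean, Fin.val_zero]

lemma alpha_eq : alpha C M = √(hitVar C.K π M) := by
  rw [alpha, hitVar, variance_hitc_of_hasSum (h.hasSum_surv_upMean (Fin.zero_le M))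
      (h.hasSum_surv_upVar (Fin.zero_le M)),
    variance_hitc_of_hasSum (h.hasSum_surv_last_upMean M) (h.hasSum_surv_last_upVar M),
    Fin.val_zero]

lemma beta_eq : beta C M = √(stepVar C.K π M) := by
  rw [beta, stepVar, variance_hit_of_hasSum (h.hasSum_surv_upMean (Fin.zero_le M))
      (h.hasSum_surv_upVar (Fin.zero_le M)),
    variance_hit_of_hasSum (h.hasSum_surv_last_upMean M) (h.hasSum_surv_last_upVar M), Fin.val_zero]

lemma beta_le_alpha : beta C M ≤ alpha C M := by
  rw [h.beta_eq, h.alpha_eq]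
  exact Real.sqrt_le_sqrt (h.stepVar_le_hitVar M)

lemma sqrt_mul_alpha_le_beta {δ : ℝ} (hδ : 0 ≤ δ) (hK : ∀ x, δ ≤ C.K x x) :
    √δ * alpha C M ≤ beta C M := by
  rw [h.beta_eq, h.alpha_eq, ← Real.sqrt_mul hδ]
  exact Real.sqrt_le_sqrt (h.mul_hitVar_le_stepVar hδ hK M)

end IsBD

end Hitting

/-! ### Cutoff criteria for sequences of mixing times -/

section Sequences

lemma tendsto_div_of_tendsto_div_atTop {ι : Type*} {l : Filter ι} {θ b : ι → ℝ}
    (h : Tendsto (fun n => θ n / b n) l atTop) : Tendsto (fun n => b n / θ n) l (𝓝 0) := by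
  simpa only [Pi.inv_def, inv_div] using h.inv_tendsto_atTop

lemma exists_log_eq {R : ℝ} (hR : 0 ≤ R) : ∃ ε ∈ Set.Ioo (0 : ℝ) 1, Real.log (1 / (2 * ε)) = R := by
  have hexp : Real.exp (-R) ≤ 1 := Real.exp_le_one_iff.2 (neg_nonpos.2 hR)
  refine ⟨Real.exp (-R) / 2, ⟨by positivity, by linarith⟩, ?_⟩
  rw [mul_div_cancel₀ _ two_ne_zero, one_div, ← Real.exp_neg, neg_neg, Real.log_exp]

lemma HasCutoffc.eventually_le_mul {S : ℕ → ℝ → ℝ} (h : HasCutoffc S) {ε ε' r : ℝ}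
    (hε : ε ∈ Set.Ioo (0 : ℝ) 1) (hε' : ε' ∈ Set.Ioo (0 : ℝ) 1) (hr : 1 < r) :
    ∀ᶠ n in atTop, S n ε ≤ r * S n ε' := by
  obtain ⟨t, ht, hS⟩ := h
  have hlim : Tendsto (fun n => S n ε / t n - r * (S n ε' / t n)) atTop (𝓝 (1 - r * 1)) :=
    (hS ε hε).sub ((hS ε' hε').const_mul r)
  filter_upwards [hlim.eventually_lt_const (by linarith : 1 - r * 1 < 0), eventually_ge_atTop 1]
    with n hlt hn
  rw [sub_neg, mul_div_assoc', div_lt_div_iff_of_pos_right (ht n hn)] at hlt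
  exact hlt.le

/-- Quantities controlling a family of mixing times `S`: the mean `θ` of the hitting times, the
square root `α` of their variance in continuous time, the spectral gap `lam`, and a window `b`
comparable to `α`. The constants `c` and `ρ` do not depend on the member of the family. -/
structure CutoffData (S : ℕ → ℝ → ℝ) (θ α lam b : ℕ → ℝ) (c ρ : ℝ) : Prop where
  c_pos : 0 < c
  ρ_pos : 0 < ρ
  gap_pos : ∀ n, 1 ≤ n → 0 < lam n
  one_le_scale : ∀ n, 1 ≤ n → 1 ≤ α n
  half_le_mean : ∀ n : ℕ, 1 ≤ n → (n : ℝ) / 2 ≤ θ n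
  one_le_gap_mul : ∀ n, 1 ≤ n → 1 ≤ lam n * α n
  gap_mul_sq_le : ∀ n, 1 ≤ n → lam n * c * α n ^ 2 ≤ 2 * θ n
  window_le : ∀ n, 1 ≤ n → b n ≤ α n
  le_window : ∀ n, 1 ≤ n → ρ * α n ≤ b n
  mixing : ∀ ε ∈ Set.Ioo (0 : ℝ) 1, ∃ D : ℝ, ∀ n, 1 ≤ n → |S n ε - θ n| ≤ D * α n
  relaxation : ∀ ε ∈ Set.Ioo (0 : ℝ) 1, ∀ n, 1 ≤ n →
    Real.log (1 / (2 * ε)) ≤ 2 * (lam n * S n ε) ∨ 1 / 2 ≤ lam n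

namespace CutoffData

variable {S : ℕ → ℝ → ℝ} {θ α lam b : ℕ → ℝ} {c ρ : ℝ} (H : CutoffData S θ α lam b c ρ)
include H

lemma mean_pos {n : ℕ} (hn : 1 ≤ n) : 0 < θ n :=
  (half_pos (Nat.cast_pos.2 hn)).trans_le (H.half_le_mean n hn)

lemma scale_pos {n : ℕ} (hn : 1 ≤ n) : 0 < α n :=
  one_pos.trans_le (H.one_le_scale n hn)

lemma window_pos {n : ℕ} (hn : 1 ≤ n) : 0 < b n :=
  (mul_pos H.ρ_pos (H.scale_pos hn)).trans_le (H.le_window n hn)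

lemma tendsto_mean : Tendsto θ atTop atTop :=
  tendsto_atTop_mono' _ ((eventually_ge_atTop 1).mono H.half_le_mean)
    (tendsto_natCast_atTop_atTop.atTop_div_const two_pos)

lemma mul_scale_le_mean {n : ℕ} (hn : 1 ≤ n) {B : ℝ} (hB : 2 * B ^ 2 / c ≤ θ n * lam n) :
    B * α n ≤ θ n := by
  have hθ := H.mean_pos hn
  refine le_of_sq_le_sq ?_ hθ.le
  rw [div_le_iff₀ H.c_pos] at hB
  have hsq : 2 * (B * α n) ^ 2 ≤ 2 * θ n ^ 2 := by
    calc 2 * (B * α n) ^ 2 = 2 * B ^ 2 * α n ^ 2 := by ring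
      _ ≤ θ n * lam n * c * α n ^ 2 := by gcongr
      _ = θ n * (lam n * c * α n ^ 2) := by ring
      _ ≤ θ n * (2 * θ n) := mul_le_mul_of_nonneg_left (H.gap_mul_sq_le n hn) hθ.le
      _ = 2 * θ n ^ 2 := by ring
  linarith

lemma tendsto_mean_div_window (h : Tendsto (fun n => θ n * lam n) atTop atTop) :
    Tendsto (fun n => θ n / b n) atTop atTop := by
  refine tendsto_atTop.2 fun B => ?_
  filter_upwards [h.eventually_ge_atTop (2 * B ^ 2 / c), eventually_ge_atTop 1] with n hB hn
  have hb := H.window_pos hn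
  rw [le_div_iff₀ hb]
  rcases le_or_gt B 0 with hB0 | hB0
  · exact (mul_nonpos_of_nonpos_of_nonneg hB0 hb.le).trans (H.mean_pos hn).le
  · exact (mul_le_mul_of_nonneg_left (H.window_le n hn) hB0.le).trans (H.mul_scale_le_mean hn hB)

lemma le_gap_mul_window {n : ℕ} (hn : 1 ≤ n) : ρ ≤ lam n * b n :=
  calc ρ ≤ ρ * (lam n * α n) := le_mul_of_one_le_right H.ρ_pos.le (H.one_le_gap_mul n hn)
    _ = lam n * (ρ * α n) := by ring
    _ ≤ lam n * b n := mul_le_mul_of_nonneg_left (H.le_window n hn) (H.gap_pos n hn).le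

lemma tendsto_mean_mul_gap (h : Tendsto (fun n => θ n / b n) atTop atTop) :
    Tendsto (fun n => θ n * lam n) atTop atTop := by
  refine tendsto_atTop_mono' _ ((eventually_ge_atTop 1).mono fun n hn => ?_)
    (h.const_mul_atTop H.ρ_pos)
  rw [mul_div_assoc', div_le_iff₀ (H.window_pos hn), mul_comm ρ, mul_assoc]
  exact mul_le_mul_of_nonneg_left (H.le_gap_mul_window hn) (H.mean_pos hn).le

theorem tendsto_mul_gap_iff :
    Tendsto (fun n => θ n * lam n) atTop atTop ↔ Tendsto (fun n => θ n / b n) atTop atTop :=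
  ⟨H.tendsto_mean_div_window, H.tendsto_mean_mul_gap⟩

lemma exists_scale {ε : ℝ} (hε : ε ∈ Set.Ioo (0 : ℝ) 1) :
    ∃ D : ℝ, 0 ≤ D ∧ ∀ n, 1 ≤ n → |S n ε - θ n| ≤ D * α n := by
  obtain ⟨D, hD⟩ := H.mixing ε hε
  exact ⟨D, nonneg_of_mul_nonneg_left ((abs_nonneg _).trans (hD 1 le_rfl)) (H.scale_pos le_rfl), hD⟩

lemma exists_window {ε : ℝ} (hε : ε ∈ Set.Ioo (0 : ℝ) 1) :
    ∃ D : ℝ, ∀ n, 1 ≤ n → |S n ε - θ n| ≤ D * b n := by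
  obtain ⟨D, hD0, hD⟩ := H.exists_scale hε
  have hρ := H.ρ_pos
  refine ⟨D / ρ, fun n hn => ?_⟩
  calc |S n ε - θ n| ≤ D * α n := hD n hn
    _ = D / ρ * (ρ * α n) := by field_simp
    _ ≤ D / ρ * b n := mul_le_mul_of_nonneg_left (H.le_window n hn) (div_nonneg hD0 hρ.le)

lemma tendsto_div_mean (h : Tendsto (fun n => θ n / b n) atTop atTop) {ε : ℝ}
    (hε : ε ∈ Set.Ioo (0 : ℝ) 1) : Tendsto (fun n => S n ε / θ n) atTop (𝓝 1) := by
  obtain ⟨D, hD⟩ := H.exists_window hε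
  have hwindow : Tendsto (fun n => D * (b n / θ n)) atTop (𝓝 0) := by
    simpa only [mul_zero] using (tendsto_div_of_tendsto_div_atTop h).const_mul D
  refine tendsto_iff_dist_tendsto_zero.2 (squeeze_zero' (Eventually.of_forall fun n => dist_nonneg)
    ((eventually_ge_atTop 1).mono fun n hn => ?_) hwindow)
  have hθ := H.mean_pos hn
  rw [Real.dist_eq, div_sub_one hθ.ne', abs_div, abs_of_pos hθ, mul_div_assoc']
  exact div_le_div_of_nonneg_right (hD n hn) hθ.le

lemma hasWindow (h : Tendsto (fun n => θ n / b n) atTop atTop) : HasWindow S θ b := by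
  refine ⟨fun n hn => ⟨H.mean_pos hn, H.window_pos hn⟩, tendsto_div_of_tendsto_div_atTop h,
    fun ε hε => ?_⟩
  obtain ⟨D, hD⟩ := H.exists_window hε
  exact ⟨D, (eventually_ge_atTop 1).mono fun n hn => (div_le_iff₀ (H.window_pos hn)).2 (hD n hn)⟩

lemma gap_mul_scale_le {n : ℕ} (hn : 1 ≤ n) : lam n * α n ≤ 1 + 2 / c * (θ n * lam n) := by
  have hsq : (lam n * α n) ^ 2 ≤ 2 / c * (θ n * lam n) := by
    have := mul_le_mul_of_nonneg_left (H.gap_mul_sq_le n hn) (H.gap_pos n hn).le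
    rw [div_mul_eq_mul_div, le_div_iff₀ H.c_pos]
    linarith
  nlinarith [sq_nonneg (lam n * α n - 1)]

lemma gap_mul_le {n : ℕ} (hn : 1 ≤ n) {s D : ℝ} (hD : 0 ≤ D) (hs : |s - θ n| ≤ D * α n) :
    lam n * s ≤ D + (1 + 2 * D / c) * (θ n * lam n) :=
  calc lam n * s ≤ lam n * (θ n + D * α n) :=
        mul_le_mul_of_nonneg_left (by linarith [(abs_le.1 hs).2]) (H.gap_pos n hn).le
    _ = θ n * lam n + D * (lam n * α n) := by ring
    _ ≤ θ n * lam n + D * (1 + 2 / c * (θ n * lam n)) := by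
        gcongr
        exact H.gap_mul_scale_le hn
    _ = D + (1 + 2 * D / c) * (θ n * lam n) := by ring

/-- If `S n ε` and `S n (1 / 4)` are of the same order for every `ε`, letting `ε → 0` in the
relaxation bound forces `lam n * S n (1 / 4)`, hence `θ n * lam n`, to be unbounded. -/
lemma tendsto_mul_gap_of_hasCutoffc (h : HasCutoffc S) :
    Tendsto (fun n => θ n * lam n) atTop atTop := by
  have hquarter : (1 / 4 : ℝ) ∈ Set.Ioo (0 : ℝ) 1 := by norm_num
  obtain ⟨D, hD0, hD⟩ := H.exists_scale hquarter
  have hcoef : 0 < 1 + 2 * D / c := by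
    have := div_nonneg (mul_nonneg zero_le_two hD0) H.c_pos.le
    linarith
  refine tendsto_atTop.2 fun B => ?_
  obtain ⟨ε, hε, hlog⟩ := exists_log_eq (R := 4 * (D + (1 + 2 * D / c) * |B|)) (by positivity)
  filter_upwards [h.eventually_le_mul hε hquarter one_lt_two,
    H.tendsto_mean.eventually_ge_atTop (2 * |B|), eventually_ge_atTop 1] with n hratio hmean hn
  refine (le_abs_self B).trans ?_
  rcases H.relaxation ε hε n hn with hrel | hgap
  · rw [hlog] at hrel
    have hmul := mul_le_mul_of_nonneg_left hratio (H.gap_pos n hn).le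
    exact le_of_mul_le_mul_left (by linarith [H.gap_mul_le hn hD0 (hD n hn)]) hcoef
  · linarith [mul_le_mul hmean hgap (by norm_num) (H.mean_pos hn).le]

theorem hasCutoffc_iff : HasCutoffc S ↔ Tendsto (fun n => θ n * lam n) atTop atTop :=
  ⟨H.tendsto_mul_gap_of_hasCutoffc, fun h =>
    ⟨θ, fun _ hn => H.mean_pos hn, fun _ => H.tendsto_div_mean (H.tendsto_mul_gap_iff.1 h)⟩⟩

theorem hasWindow_of_hasCutoffc (h : HasCutoffc S) : HasWindow S θ b :=
  H.hasWindow (H.tendsto_mul_gap_iff.1 (H.hasCutoffc_iff.1 h))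

end CutoffData

theorem CutoffData.hasCutoff_iff_hasCutoffc {T : ℕ → ℝ → ℕ} {θ α lam b : ℕ → ℝ} {c ρ : ℝ}
    (H : CutoffData (fun n ε => (T n ε : ℝ)) θ α lam b c ρ) :
    HasCutoff T ↔ HasCutoffc fun n ε => (T n ε : ℝ) := by
  refine ⟨fun ⟨t, ht, h⟩ => ⟨fun n => t n, fun n hn => Nat.cast_pos.2 (ht n hn), h⟩, fun h => ?_⟩
  have hdiv := H.tendsto_mul_gap_iff.1 (H.hasCutoffc_iff.1 h)
  refine ⟨fun n => ⌈θ n⌉₊, fun n hn => Nat.ceil_pos.2 (H.mean_pos hn), fun ε hε => ?_⟩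
  have hceil := (tendsto_nat_ceil_div_atTop (R := ℝ)).comp H.tendsto_mean
  have hquot := (H.tendsto_div_mean hdiv hε).div hceil one_ne_zero
  rw [div_one] at hquot
  refine hquot.congr' ((eventually_ge_atTop 1).mono fun n hn => ?_)
  exact div_div_div_cancel_right₀ (H.mean_pos hn).ne' _ _

end Sequences

/-! ### Families of birth and death chains -/

section Families

variable {C : (n : ℕ) → BirthDeathChain n} {π : (n : ℕ) → Fin (n + 1) → ℝ}
  {M : (n : ℕ) → Fin (n + 1)} {c : ℝ}

lemma isCentral_of_le_sum {n : ℕ} {w : Fin (n + 1) → ℝ} {m : Fin (n + 1)} {c₁ c₂ : ℝ}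
    (hc₁ : 0 < c₁) (hc₂ : 0 < c₂) (hleft : c₁ ≤ ∑ i ∈ Finset.Iic m, w i)
    (hright : c₂ ≤ ∑ i ∈ Finset.Ici m, w i) : IsCentral w m (min c₁ c₂) where
  pos := lt_min hc₁ hc₂
  le_cum := cum_eq_sum_Iic (π := w) m ▸ (min_le_left _ _).trans hleft
  le_tailWt := tailWt_eq_sum_Ici (π := w) m ▸ (min_le_right _ _).trans hright

variable (hbd : ∀ n, 1 ≤ n → IsBD (C n).K (π n)) (hM : ∀ n, 1 ≤ n → IsCentral (π n) (M n) c)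
include hbd hM

lemma cutoffData_of_window {S : ℕ → ℝ → ℝ} {b : ℕ → ℝ} {ρ : ℝ} (hρ : 0 < ρ)
    (hle : ∀ n, 1 ≤ n → b n ≤ alpha (C n) (M n))
    (hge : ∀ n, 1 ≤ n → ρ * alpha (C n) (M n) ≤ b n)
    (hmix : ∀ ε ∈ Set.Ioo (0 : ℝ) 1, ∃ D : ℝ, ∀ n, 1 ≤ n →
      |S n ε - hitMean (C n).K (π n) (M n)| ≤ D * √(hitVar (C n).K (π n) (M n)))
    (hrel : ∀ ε ∈ Set.Ioo (0 : ℝ) 1, ∀ n, 1 ≤ n →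
      Real.log (1 / (2 * ε)) ≤ 2 * (spectralGap (C n).K * S n ε) ∨ 1 / 2 ≤ spectralGap (C n).K) :
    CutoffData S (fun n => theta (C n) (M n)) (fun n => alpha (C n) (M n))
      (fun n => spectralGap (C n).K) b c ρ where
  c_pos := (hM 1 le_rfl).pos
  ρ_pos := hρ
  gap_pos n hn := (hbd n hn).spectralGap_pos hn
  one_le_scale n hn := (hbd n hn).alpha_eq (M n) ▸ (hbd n hn).one_le_sqrt_hitVar hn
  half_le_mean n hn := (hbd n hn).theta_eq (M n) ▸ (hbd n hn).half_le_hitMean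
  one_le_gap_mul n hn := (hbd n hn).alpha_eq (M n) ▸ (hbd n hn).one_le_spectralGap_mul hn
  gap_mul_sq_le n hn := by
    rw [(hbd n hn).alpha_eq, (hbd n hn).theta_eq, (hbd n hn).sq_sqrt_hitVar]
    exact (hbd n hn).mul_hitVar_le ((hbd n hn).spectralGap_pos hn).le
      (hbd n hn).poincare_spectralGap (hM n hn)
  window_le := hle
  le_window := hge
  mixing ε hε := (hmix ε hε).imp fun D hD n hn => by
    rw [(hbd n hn).alpha_eq, (hbd n hn).theta_eq]
    exact hD n hn
  relaxation := hrel

lemma cutoffData_mixTimec :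
    CutoffData (fun n => mixTimec (C n).K (π n)) (fun n => theta (C n) (M n))
      (fun n => alpha (C n) (M n)) (fun n => spectralGap (C n).K)
      (fun n => alpha (C n) (M n)) c 1 := by
  refine cutoffData_of_window hbd hM one_pos (fun n _ => le_rfl) (fun n _ => (one_mul _).le)
    (fun ε hε => ?_) fun ε hε n hn => Or.inl ?_
  · obtain ⟨D, hD⟩ := IsBD.exists_abs_mixTimec_sub_le (hM 1 le_rfl).pos hε
    exact ⟨D, fun n hn => hD (hbd n hn) hn (hM n hn)⟩
  · have hlog := (hbd n hn).log_le_spectralGap_mul_mixTimec hn (hM n hn) hε.1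
    have hnonneg : 0 ≤ spectralGap (C n).K * mixTimec (C n).K (π n) ε :=
      mul_nonneg ((hbd n hn).spectralGap_pos hn).le (Real.sInf_nonneg fun t ht => ht.1)
    linarith

lemma cutoffData_mixTime {δ : ℝ} (hδ : 0 < δ) (hK : ∀ n, 1 ≤ n → ∀ i, δ ≤ (C n).K i i) :
    CutoffData (fun n ε => (mixTime (C n).K (π n) ε : ℝ)) (fun n => theta (C n) (M n))
      (fun n => alpha (C n) (M n)) (fun n => spectralGap (C n).K)
      (fun n => beta (C n) (M n)) c √δ := by
  refine cutoffData_of_window hbd hM (Real.sqrt_pos.2 hδ)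
    (fun n hn => (hbd n hn).beta_le_alpha (M n))
    (fun n hn => (hbd n hn).sqrt_mul_alpha_le_beta (M n) hδ.le (hK n hn))
    (fun ε hε => ?_) fun ε hε n hn =>
      (hbd n hn).log_le_spectralGap_mul_mixTime hn (hM n hn) hδ (hK n hn) hε.1
  obtain ⟨D, hD⟩ := IsBD.exists_abs_mixTime_sub_le (hM 1 le_rfl).pos hδ hε
  exact ⟨D, fun n hn => hD (hbd n hn) hn (hM n hn) (hK n hn)⟩

end Families

end BDCutoff

end

theorem theorem1p6
    (C : (n : ℕ) → BDCutoff.BirthDeathChain n)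
    (π : (n : ℕ) → Fin (n + 1) → ℝ)
    (hπ : ∀ n, 1 ≤ n → BDCutoff.IsStationary (C n).K (π n))
    (M : (n : ℕ) → Fin (n + 1))
    (hleft : ∃ c : ℝ, 0 < c ∧ ∀ n, 1 ≤ n → c ≤ ∑ i ∈ Finset.Iic (M n), π n i)
    (hright : ∃ c : ℝ, 0 < c ∧ ∀ n, 1 ≤ n → c ≤ ∑ i ∈ Finset.Ici (M n), π n i) :
    -- the hitting times are regular, and the two expressions for `θ_n` agree
    (∀ n, 1 ≤ n →
      BDCutoff.HitRegular (C n) 0 (M n) ∧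
      BDCutoff.HitRegular (C n) (Fin.last n) (M n) ∧
      BDCutoff.theta (C n) (M n) = BDCutoff.thetac (C n) (M n)) ∧
    -- continuous time
    ((BDCutoff.HasCutoffc (fun n => BDCutoff.mixTimec (C n).K (π n)) ↔
        Tendsto (fun n => BDCutoff.theta (C n) (M n) * BDCutoff.spectralGap (C n).K)
          atTop atTop) ∧
      (Tendsto (fun n => BDCutoff.theta (C n) (M n) * BDCutoff.spectralGap (C n).K)
          atTop atTop ↔
        Tendsto (fun n => BDCutoff.theta (C n) (M n) / BDCutoff.alpha (C n) (M n))
          atTop atTop) ∧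
      (BDCutoff.HasCutoffc (fun n => BDCutoff.mixTimec (C n).K (π n)) →
        BDCutoff.HasWindow (fun n => BDCutoff.mixTimec (C n).K (π n))
          (fun n => BDCutoff.theta (C n) (M n)) (fun n => BDCutoff.alpha (C n) (M n)))) ∧
    -- discrete time
    ((∃ δ : ℝ, 0 < δ ∧ ∀ n, 1 ≤ n → ∀ i, δ ≤ (C n).K i i) →
      (BDCutoff.HasCutoff (fun n => BDCutoff.mixTime (C n).K (π n)) ↔
        Tendsto (fun n => BDCutoff.theta (C n) (M n) * BDCutoff.spectralGap (C n).K)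
          atTop atTop) ∧
      (Tendsto (fun n => BDCutoff.theta (C n) (M n) * BDCutoff.spectralGap (C n).K)
          atTop atTop ↔
        Tendsto (fun n => BDCutoff.theta (C n) (M n) / BDCutoff.beta (C n) (M n))
          atTop atTop) ∧
      (BDCutoff.HasCutoff (fun n => BDCutoff.mixTime (C n).K (π n)) →
        BDCutoff.HasWindow (fun n ε => (BDCutoff.mixTime (C n).K (π n) ε : ℝ))
          (fun n => BDCutoff.theta (C n) (M n)) (fun n => BDCutoff.beta (C n) (M n)))) := by
  obtain ⟨c₁, hc₁, hc₁_le⟩ := hleft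
  obtain ⟨c₂, hc₂, hc₂_le⟩ := hright
  have hbd : ∀ n, 1 ≤ n → BDCutoff.IsBD (C n).K (π n) := fun n hn => (C n).isBD (hπ n hn)
  have hM : ∀ n, 1 ≤ n → BDCutoff.IsCentral (π n) (M n) (min c₁ c₂) := fun n hn =>
    BDCutoff.isCentral_of_le_sum hc₁ hc₂ (hc₁_le n hn) (hc₂_le n hn)
  refine ⟨fun n hn => ⟨(hbd n hn).hitRegular_zero (M n), (hbd n hn).hitRegular_last (M n),
    (hbd n hn).theta_eq_thetac (M n)⟩, ?_, ?_⟩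
  · have H := BDCutoff.cutoffData_mixTimec hbd hM
    exact ⟨H.hasCutoffc_iff, H.tendsto_mul_gap_iff, H.hasWindow_of_hasCutoffc⟩
  · rintro ⟨δ, hδ, hK⟩
    have H := BDCutoff.cutoffData_mixTime hbd hM hδ hK
    exact ⟨H.hasCutoff_iff_hasCutoffc.trans H.hasCutoffc_iff, H.tendsto_mul_gap_iff,
      fun h => H.hasWindow_of_hasCutoffc (H.hasCutoff_iff_hasCutoffc.1 h)⟩
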